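/- Let $M$ be a compact manifold of class $\mathcal C^\infty$ and real dimension $2n-k$, with a smooth CR structure $H_{0,1}M\subset T_{\mathbb C}M$ of CR dimension $n-k$ (a subbundle of complex rank $n-k$, closed under brackets, with $H_{0,1}M\cap H_{1,0}M=0$, where $H_{1,0}M=\overline{H_{0,1}M}$); put $HM=H_{1,0}M\oplus H_{0,1}M$. Smooth $(p,r)$-forms are the sections of $\Lambda^p(T_{\mathbb C}M/H_{0,1}M)^*\otimes\Lambda^r(H_{0,1}M)^*$, $\bar\partial_b$ is the tangential Cauchy–Riemann operator on them, and $H^{p,r}(M)$ is the corresponding smooth cohomology. Let $(\mathcal B^l(M))_{l\in\mathbb N}$ be a sequence of anisotropic Banach spaces: Banach spaces of integrable functions on $M$, continuously included in $L^1(M)$, with $\mathcal B^{l+1}(M)\subset\mathcal B^l(M)$, such that $Xf\in\mathcal B^{l}(M)$ (weak derivative) for $f\in\mathcal B^{l+1}(M)$ and every smooth section $X$ of $HM$, and such that $fg\in\mathcal B^l(M)$ for $f\in\mathcal B^l(M)$ and $g\in\mathcal C^{\theta(l)}(M)$, where $\theta:\mathbb N\to\mathbb N$ is nondecreasing. Let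 $\mathcal B^l_{p,r}(M)$ be the space of $(p,r)$-forms with coefficients in $\mathcal B^l(M)$. The spaces are called adapted in degree $r\ge1$ if for every $p$ with $H^{p,r}(M)=0$ there are linear operators $A_s:\mathcal B^0_{p,s}(M)\to\mathcal B^0_{p,s-1}(M)$, $s=r,r+1$, that are continuous from $\mathcal B^l_{p,s}(M)$ to $\mathcal B^{l+1}_{p,s-1}(M)$ for every $l\in\mathbb N$ and satisfy $f=\bar\partial_bA_rf+A_{r+1}\bar\partial_bf$ for every $f\in\mathcal B^l_{p,r}(M)$, $l\ge1$. Assume $\bigcap_l\mathcal B^l(M)=\mathcal C^\infty(M)$. Let $q$ be an integer with $1\le q\le(n-k)/2$ and let $s_1(q),s_2(q)$ be natural numbers. Then there are $\delta_l>0$, $l\in\mathbb N$, such that the following holds for every smooth form $\Phi\in\mathcal C^\infty_{0,1}(M,H_{1,0}M)$ for which the horizontal perturbation $\widehat H_{0,1}M=\{\bar Z-\Phi(\bar Z)\mid\bar Z\in H_{0,1}M\}$ is a CR structure and which satisfies $\|\Phi\|_{\mathcal C^{\theta(l)}}<\delta_l$ for all $l$. Write $\widehat M=(M,\widehat H_{0,1}M)$,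 let $\bar\partial_b^\Phi$ be its tangential Cauchy–Riemann operator, and let $H^{p,r}_\Phi(\widehat M)$ be the quotient of the smooth $\bar\partial_b^\Phi$-closed $(p,r)$-forms of $\widehat M$ by the image under $\bar\partial_b^\Phi$ of its smooth $(p,r-1)$-forms. (i) Suppose that the spaces are adapted in every degree $r$ with $1\le r\le s_1(q)$. If $1\le r\le s_1(q)$ and $H^{p,r-p}(M)=0$ for all $0\le p\le r-1$, then $H^{0,r}_\Phi(\widehat M)=0$. (ii) Suppose that the spaces are adapted in every degree $r\ge1$ with $s_2(q)\le r\le n-k$. If $r\ge1$, $s_2(q)\le r\le n-k$ and $H^{n-p,r+p}(M)=0$ for all $0\le p\le n-k-r$, then $H^{n,r}_\Phi(\widehat M)=0$. -/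

import Mathlib

open MeasureTheory
open scoped Manifold ContDiff

noncomputable section

namespace CR

/-! ### Smooth complex functions and complex vector fields -/

/-- Multiplication of complex numbers is smooth over the reals. -/
instance instContMDiffRingComplex : ContMDiffRing 𝓘(ℝ, ℂ) ∞ ℂ :=
  { instNormedSpaceLieAddGroup with
    contMDiff_mul := by
      rw [contMDiff_iff]
      refine ⟨continuous_mul, fun x y => ?_⟩
      simp only [mfld_simps, chartAt_self_eq]
      rw [contDiffOn_univ]
      exact contDiff_mul }

/-- `C^∞(M)`: smooth complex-valued functions on an `m`-dimensional real manifold. -/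
abbrev Smooth (m : ℕ) (M : Type*) [TopologicalSpace M]
    [ChartedSpace (EuclideanSpace ℝ (Fin m)) M] : Type _ :=
  C^∞⟮𝓡 m, M; 𝓘(ℝ, ℂ), ℂ⟯

/-- Smooth sections of the complexified tangent bundle, as derivations of `C^∞(M)`.
(An `ℝ`-linear derivation kills the constant `i`, hence is `ℂ`-linear.) The bracket of
derivations is the Lie bracket of vector fields. -/
abbrev VF (m : ℕ) (M : Type*) [TopologicalSpace M]
    [ChartedSpace (EuclideanSpace ℝ (Fin m)) M] : Type _ :=
  Derivation ℝ (Smooth m M) (Smooth m M)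

section Basic

variable {m : ℕ} {M : Type*} [TopologicalSpace M] [ChartedSpace (EuclideanSpace ℝ (Fin m)) M]

/-- Complex conjugation of functions. -/
def conjFn (a : Smooth m M) : Smooth m M :=
  ⟨fun x => (starRingEnd ℂ) (a x), Complex.conjCLE.contDiff.contMDiff.comp a.contMDiff⟩

@[simp]
theorem conjFn_apply (a : Smooth m M) (x : M) : conjFn a x = (starRingEnd ℂ) (a x) := rfl

/-- Complex conjugation of vector fields, `X̄ a = conj (X (conj a))`. -/
def conjVF (X : VF m M) : VF m M :=
  Derivation.mk'
    { toFun := fun a => conjFn (X (conjFn a))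
      map_add' := fun a b => by
        have h : conjFn (a + b) = conjFn a + conjFn b := by ext x; simp
        rw [h, map_add]; ext x; simp
      map_smul' := fun c a => by
        have h : conjFn (c • a) = c • conjFn a := by ext x; simp
        rw [h, X.map_smul]; ext x; simp }
    (fun a b => by
      have h : conjFn (a * b) = conjFn a * conjFn b := by ext x; simp
      change conjFn (X (conjFn (a * b))) = _
      rw [h, Derivation.leibniz]; ext x; simp)

@[simp]
theorem conjVF_apply (X : VF m M) (a : Smooth m M) : conjVF X a = conjFn (X (conjFn a)) := rfl

/-- The conjugate `{X | X̄ ∈ S}` of a module of vector fields. -/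
def conjSub (S : Submodule (Smooth m M) (VF m M)) : Submodule (Smooth m M) (VF m M) where
  carrier := {X | conjVF X ∈ S}
  add_mem' := fun {X Y} hX hY => by
    have h : conjVF (X + Y) = conjVF X + conjVF Y := by ext a x; simp
    simpa only [Set.mem_ofPred_eq, h] using S.add_mem hX hY
  zero_mem' := by
    have h : conjVF (0 : VF m M) = 0 := by ext a x; simp
    simp only [Set.mem_ofPred_eq, h, S.zero_mem]
  smul_mem' := fun c X hX => by
    have h : conjVF (c • X) = conjFn c • conjVF X := by ext a x; simp
    simpa only [Set.mem_ofPred_eq, h] using S.smul_mem (conjFn c) hX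

/-- The fibre at `x` of a module `S` of vector fields: the complex space of tangent vectors
`a ↦ (X a)(x)`, `X ∈ S`. -/
def fiber (S : Submodule (Smooth m M) (VF m M)) (x : M) : Submodule ℂ (Smooth m M → ℂ) :=
  Submodule.span ℂ (Set.range fun (X : S) (a : Smooth m M) => (X : VF m M) a x)

end Basic

/-! ### CR structures and their `(p,r)`-forms -/

/-- A smooth CR structure of CR dimension `d` on `M`, given by the module `H` of the smooth
sections of `H_{0,1}M`. Submodules of vector fields that have a complement are the same as smooth
subbundles, so the first two conditions say that `H_{0,1}` and its conjugate `H_{1,0}` are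
subbundles that meet only in zero at every point. -/
structure CRStructure (m : ℕ) (M : Type*) [TopologicalSpace M]
    [ChartedSpace (EuclideanSpace ℝ (Fin m)) M] (d : ℕ) where
  /-- sections of `H_{0,1}M` -/
  H : Submodule (Smooth m M) (VF m M)
  disjoint_conj : Disjoint H (conjSub H)
  exists_isCompl : ∃ K : Submodule (Smooth m M) (VF m M), IsCompl (H ⊔ conjSub H) K
  rank_eq : ∀ x : M, Module.finrank ℂ (fiber H x) = d
  lie_mem : ∀ Z ∈ H, ∀ W ∈ H, ⁅Z, W⁆ ∈ H

section Forms

variable {m : ℕ} {M : Type*} [TopologicalSpace M] [ChartedSpace (EuclideanSpace ℝ (Fin m)) M]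
  {d : ℕ}

/-- The bracket of two sections of `H_{0,1}M`. -/
def CRStructure.br (S : CRStructure m M d) (Z W : S.H) : S.H :=
  ⟨⁅(Z : VF m M), (W : VF m M)⁆, S.lie_mem Z Z.2 W W.2⟩

/-- `(p,r)`-forms with coefficients in the `C^∞(M)`-module `N`: sections of
`Λ^p (T_ℂM / H_{0,1}M)^* ⊗ Λ^r (H_{0,1}M)^*` with coefficients in `N`, as alternating maps. -/
abbrev Form (S : CRStructure m M d) (p r : ℕ) (N : Type*) [AddCommGroup N]
    [Module (Smooth m M) N] : Type _ :=
  S.H [⋀^Fin r]→ₗ[Smooth m M] ((VF m M ⧸ S.H) [⋀^Fin p]→ₗ[Smooth m M] N)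

/-- The value `f(Z_1,…,Z_r; X_1,…,X_p)` with `Z_i` in `H_{0,1}M` and with arbitrary vector fields
`X_j`, taken modulo `H_{0,1}M`. -/
def Form.ev {S : CRStructure m M d} {p r : ℕ} {N : Type*} [AddCommGroup N]
    [Module (Smooth m M) N] (f : Form S p r N) (Z : Fin r → S.H) (X : Fin p → VF m M) : N :=
  f Z (fun j => S.H.mkQ (X j))

/-- The value `(∂̄_b f)(Z_0,…,Z_r; X_1,…,X_p)` of the tangential Cauchy-Riemann operator, where
`act` is the action of vector fields on coefficients. This is the invariant formula for the
exterior derivative along `H_{0,1}M`; the bracket `[Z_i, Z_j]`, `i < j`, stands in the place of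
`Z_j`, which absorbs the usual sign `(-1)^(i+j)`. -/
def dbar {S : CRStructure m M d} {p r : ℕ} {N : Type*} [AddCommGroup N]
    [Module (Smooth m M) N] (act : VF m M → N → N) (f : Form S p r N)
    (Z : Fin (r + 1) → S.H) (X : Fin p → VF m M) : N :=
  ∑ i : Fin (r + 1), (-1 : ℤ) ^ (i : ℕ) •
    (act (Z i) (f.ev (i.removeNth Z) X)
      - (∑ j : Fin r, if i ≤ j.castSucc then
          f.ev (Function.update (i.removeNth Z) j (S.br (Z i) (i.removeNth Z j))) X else 0)
      - ∑ j : Fin p, f.ev (i.removeNth Z) (Function.update X j ⁅(Z i : VF m M), X j⁆))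

/-- A smooth `(p,r)`-form with `∂̄_b f = 0`. -/
def IsClosedForm {S : CRStructure m M d} {p r : ℕ} (f : Form S p r (Smooth m M)) : Prop :=
  ∀ Z X, dbar (fun Y a => Y a) f Z X = 0

/-- `H^{p,r}(M) = 0` for the smooth tangential Cauchy-Riemann cohomology of the CR structure. -/
def CohomologyVanishes (S : CRStructure m M d) (p : ℕ) : ℕ → Prop
  | 0 => ∀ f : Form S p 0 (Smooth m M), IsClosedForm f → f = 0
  | r + 1 => ∀ f : Form S p (r + 1) (Smooth m M), IsClosedForm f →
      ∃ u : Form S p r (Smooth m M), ∀ Z X, dbar (fun Y a => Y a) u Z X = f.ev Z X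

/-- The graph `{Z - Φ(Z) | Z ∈ H_{0,1}M}` of a smooth form `Φ : H_{0,1}M → H_{1,0}M`. -/
def graph (S : CRStructure m M d) (Φ : S.H →ₗ[Smooth m M] conjSub S.H) :
    Submodule (Smooth m M) (VF m M) :=
  LinearMap.range (S.H.subtype - (conjSub S.H).subtype ∘ₗ Φ)

/-! ### Norms -/

/-- Finite families used to write norms: `X` generates all vector fields, with coefficients
given by the 1-forms `ξ`, and `Z` generates the sections of `H_{0,1}M`. -/
structure Frames (S : CRStructure m M d) where
  N₁ : ℕ
  N₂ : ℕ
  X : Fin N₁ → VF m M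
  ξ : Fin N₁ → VF m M →ₗ[Smooth m M] Smooth m M
  sum_eq : ∀ Y, ∑ i, ξ i Y • X i = Y
  Z : Fin N₂ → S.H
  span_eq : Submodule.span (Smooth m M) (Set.range Z) = ⊤

/-- The `C^l` norm of a smooth function, through derivatives of order `≤ l` along `X`. -/
def cNorm {N : ℕ} (X : Fin N → VF m M) : ℕ → Smooth m M → ℝ
  | 0, a => ⨆ x : M, ‖a x‖
  | l + 1, a => (⨆ x : M, ‖a x‖) + ∑ i, cNorm X l (X i a)

/-- The `C^l` norm of `Φ`, i.e. of its coefficients. -/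
def Frames.normΦ {S : CRStructure m M d} (F : Frames S) (l : ℕ)
    (Φ : S.H →ₗ[Smooth m M] conjSub S.H) : ℝ :=
  ∑ i, ∑ j, cNorm F.X l (F.ξ i (Φ (F.Z j)))

end Forms

/-! ### Function spaces -/

section Spaces

variable {m : ℕ} {M : Type*} [TopologicalSpace M] [ChartedSpace (EuclideanSpace ℝ (Fin m)) M]
  [MeasurableSpace M] [BorelSpace M] {μ : Measure M}

/-- A smooth function as an almost everywhere class. -/
def toAE (μ : Measure M) (a : Smooth m M) : M →ₘ[μ] ℂ :=
  AEEqFun.mk a a.contMDiff.continuous.aestronglyMeasurable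

/-- Multiplication of measurable functions by smooth functions. -/
instance instModuleSmooth : Module (Smooth m M) (M →ₘ[μ] ℂ) where
  smul a f := toAE μ a * f
  one_smul f := AEEqFun.induction_on f fun f hf => by
    change toAE μ 1 * _ = _
    rw [toAE, AEEqFun.mk_mul_mk]; congr 1; ext x; simp
  mul_smul a b f := AEEqFun.induction_on f fun f hf => by
    change toAE μ (a * b) * _ = toAE μ a * (toAE μ b * _)
    simp only [toAE, AEEqFun.mk_mul_mk]; congr 1; ext x; simp [mul_assoc]
  smul_zero a := by
    change toAE μ a * AEEqFun.mk _ _ = AEEqFun.mk _ _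
    simp only [toAE, AEEqFun.mk_mul_mk]; congr 1; ext x; simp
  smul_add a f g := AEEqFun.induction_on₂ f g fun f hf g hg => by
    change toAE μ a * (_ + _) = toAE μ a * _ + toAE μ a * _
    simp only [toAE, AEEqFun.mk_mul_mk, AEEqFun.mk_add_mk]; congr 1; ext x; simp [mul_add]
  add_smul a b f := AEEqFun.induction_on f fun f hf => by
    change toAE μ (a + b) * _ = toAE μ a * _ + toAE μ b * _
    simp only [toAE, AEEqFun.mk_mul_mk, AEEqFun.mk_add_mk]; congr 1; ext x; simp [add_mul]
  zero_smul f := AEEqFun.induction_on f fun f hf => by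
    change toAE μ 0 * _ = AEEqFun.mk _ _
    simp only [toAE, AEEqFun.mk_mul_mk]; congr 1; ext x; simp

instance instSMulCommSmooth : SMulCommClass (Smooth m M) ℂ (M →ₘ[μ] ℂ) where
  smul_comm a c f := AEEqFun.induction_on f fun f hf => by
    change toAE μ a * (c • _) = c • (toAE μ a * _)
    simp only [toAE, AEEqFun.mk_mul_mk, AEEqFun.smul_mk]; congr 1; ext x
    simp [mul_left_comm]

/-- `δ` is the divergence of `Y` with respect to `μ`. -/
def IsDivergence (μ : Measure M) (Y : VF m M) (δ : Smooth m M) : Prop :=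
  ∀ φ : Smooth m M, ∫ x, Y φ x ∂μ = - ∫ x, δ x * φ x ∂μ

/-- Every vector field has a smooth divergence. For a finite measure that is positive on
nonempty open sets, this means that `μ` has a smooth positive density in every chart. -/
def HasSmoothDivergence (m : ℕ) {M : Type*} [TopologicalSpace M]
    [ChartedSpace (EuclideanSpace ℝ (Fin m)) M] [MeasurableSpace M] (μ : Measure M) : Prop :=
  ∀ Y : VF m M, ∃ δ : Smooth m M, IsDivergence μ Y δ

/-- `Y f = g` in the weak sense, for integrable `f` and `g`. -/
def IsWeakDeriv (Y : VF m M) (f g : M →ₘ[μ] ℂ) : Prop :=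
  Integrable f μ ∧ Integrable g μ ∧ ∃ δ : Smooth m M, IsDivergence μ Y δ ∧
    ∀ φ : Smooth m M, ∫ x, g x * φ x ∂μ = - ∫ x, f x * (Y φ x + δ x * φ x) ∂μ

open Classical in
/-- The weak derivative `Y f` (zero if there is none). -/
def weakDeriv (Y : VF m M) (f : M →ₘ[μ] ℂ) : M →ₘ[μ] ℂ :=
  if h : ∃ g, IsWeakDeriv Y f g then h.choose else 0

/-- A Banach space of (classes of) integrable functions on `M`, with continuous inclusion in
`L¹`. The value of `nrm` matters only on `carrier`. -/
structure BanachFunctionSpace (μ : Measure M) where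
  carrier : Submodule ℂ (M →ₘ[μ] ℂ)
  nrm : (M →ₘ[μ] ℂ) → ℝ
  nrm_add_le : ∀ f ∈ carrier, ∀ g ∈ carrier, nrm (f + g) ≤ nrm f + nrm g
  nrm_smul : ∀ (c : ℂ), ∀ f ∈ carrier, nrm (c • f) = ‖c‖ * nrm f
  integrable : ∀ f ∈ carrier, Integrable f μ
  exists_integral_le : ∃ C : ℝ, ∀ f ∈ carrier, ∫ x, ‖f x‖ ∂μ ≤ C * nrm f
  complete : ∀ u : ℕ → (M →ₘ[μ] ℂ), (∀ i, u i ∈ carrier) →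
    (∀ ε > 0, ∃ N, ∀ i ≥ N, ∀ j ≥ N, nrm (u i - u j) < ε) →
    ∃ f ∈ carrier, ∀ ε > 0, ∃ N, ∀ i ≥ N, nrm (u i - f) < ε

variable {d : ℕ}

/-- A sequence of anisotropic Banach spaces `B^l(M)`: derivatives along sections of
`HM = H_{1,0}M ⊕ H_{0,1}M` map `B^{l+1}` to `B^l`, and `C^{θ(l)}` functions multiply `B^l`. -/
structure AnisotropicSpaces (S : CRStructure m M d) (μ : Measure M) where
  B : ℕ → BanachFunctionSpace μ
  θ : ℕ → ℕ
  antitone_B : ∀ l, (B (l + 1)).carrier ≤ (B l).carrier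
  monotone_θ : Monotone θ
  exists_weakDeriv : ∀ l, ∀ f ∈ (B (l + 1)).carrier, ∀ Y ∈ S.H ⊔ conjSub S.H,
    ∃ g ∈ (B l).carrier, IsWeakDeriv Y f g
  mul_mem : ∀ l, ∀ f ∈ (B l).carrier, ∀ g : C(M, ℂ), ContMDiff (𝓡 m) 𝓘(ℝ, ℂ) (θ l) g →
    g.toAEEqFun μ * f ∈ (B l).carrier

namespace AnisotropicSpaces

variable {S : CRStructure m M d}

/-- `⋂_l B^l(M) = C^∞(M)`. -/
def InterEqSmooth (B : AnisotropicSpaces S μ) : Prop :=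
  ∀ f : M →ₘ[μ] ℂ, (∀ l, f ∈ (B.B l).carrier) ↔ ∃ a : Smooth m M, f = toAE μ a

/-- `B^l_{p,r}(M)`: the `(p,r)`-forms with coefficients in `B^l(M)`. -/
def forms (B : AnisotropicSpaces S μ) (l p r : ℕ) : Submodule ℂ (Form S p r (M →ₘ[μ] ℂ)) where
  carrier := {f | ∀ Z X, f.ev Z X ∈ (B.B l).carrier}
  add_mem' := fun hf hg Z X => (B.B l).carrier.add_mem (hf Z X) (hg Z X)
  zero_mem' := fun _ _ => (B.B l).carrier.zero_mem
  smul_mem' := fun c _ hf Z X => (B.B l).carrier.smul_mem c (hf Z X)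

/-- The norm of `B^l_{p,r}(M)`, through the coefficients with respect to frames. -/
def formNorm (B : AnisotropicSpaces S μ) (F : Frames S) (l : ℕ) {p r : ℕ}
    (f : Form S p r (M →ₘ[μ] ℂ)) : ℝ :=
  ∑ J : Fin r → Fin F.N₂, ∑ I : Fin p → Fin F.N₁,
    (B.B l).nrm (f.ev (fun i => F.Z (J i)) (fun i => F.X (I i)))

/-- A linear operator `B^0_{p,r} → B^0_{p,s}` that is continuous from `B^l_{p,r}` to `B^{l+1}_{p,s}`
for every `l`. -/
def GainsOne (B : AnisotropicSpaces S μ) (F : Frames S) {p r s : ℕ}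
    (A : B.forms 0 p r →ₗ[ℂ] B.forms 0 p s) : Prop :=
  ∀ l, (∀ f, f.1 ∈ B.forms l p r → (A f).1 ∈ B.forms (l + 1) p s) ∧
    ∃ C : ℝ, ∀ f, f.1 ∈ B.forms l p r → B.formNorm F (l + 1) (A f).1 ≤ C * B.formNorm F l f.1

/-- The spaces are adapted to the `∂̄_b`-equation in degree `r ≥ 1` (no condition for `r = 0`):
whenever `H^{p,r}(M) = 0`, there are operators `A_r` and `A_{r+1}` that gain one order, with
`f = ∂̄_b A_r f + A_{r+1} ∂̄_b f` for `f ∈ B^l_{p,r}`, `l ≥ 1`. -/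
def IsAdapted (B : AnisotropicSpaces S μ) (F : Frames S) : ℕ → Prop
  | 0 => True
  | r + 1 => ∀ p, CohomologyVanishes S p (r + 1) →
      ∃ (A₁ : B.forms 0 p (r + 1) →ₗ[ℂ] B.forms 0 p r)
        (A₂ : B.forms 0 p (r + 2) →ₗ[ℂ] B.forms 0 p (r + 1)),
        B.GainsOne F A₁ ∧ B.GainsOne F A₂ ∧
        ∀ (f : B.forms 0 p (r + 1)) (g : B.forms 0 p (r + 2)), f.1 ∈ B.forms 1 p (r + 1) →
          (∀ Z X, g.1.ev Z X = dbar weakDeriv f.1 Z X) →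
          ∀ Z X, f.1.ev Z X = dbar weakDeriv (A₁ f).1 Z X + (A₂ g).1.ev Z X

end AnisotropicSpaces

end Spaces

end CR

end

/-
The automorphism `ψ = id - Φ` of the vector fields (`Φ` extended by zero on the conjugate side)
carries `H_{0,1}M` onto the perturbed structure, so `∂̄_b^Φ` can be pulled back to an operator `D`
on the forms of `M` itself. The difference `D - ∂̄_b` is of first order with coefficients built
from `Φ`; as it only involves derivatives along `HM`, it maps `B^{l+1}` to `B^l` with a norm that
tends to zero with the `C^k` norms of `Φ`. Composed with the homotopy operators `A_r`, `A_{r+1}`,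
which gain one order, it is small on every `B^l`. Hence, for `f` with `D f = 0`, a Neumann series
in the Fréchet space `⋂ B^l = C^∞` solves `g + (D - ∂̄_b) A_r g = f`; then
`f - D A_r g = A_{r+1} ∂̄_b g` is annihilated by `D`, which forces `∂̄_b g = 0`, because
`D A_{r+1}` is close to `∂̄_b A_{r+1}`, and `f = D A_r g`. This works in each bidegree separately.

The smallness of `Φ` is measured in `C^{θ(l)}` only. These norms control all `C^k` norms because
`θ` is unbounded: if all `C^k` functions were multipliers of every `B^l`, they would multiply
`1 ∈ ⋂ B^l` into `C^∞`, yet some `C^k` function is not smooth. As there are countably many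
smallness conditions, a diagonal choice yields the `δ_l`.
-/

noncomputable section

open Filter Topology

namespace CR

section LieRinehart

/-- A module `Q` over both `R` and a Lie ring `L` that acts on `R`, on which `L` acts by the Leibniz
rule. The adjoint representation of a Lie-Rinehart ring is the main example that need not be
`R`-linear in the `L`-variable. -/
class IsLeibnizModule (R L Q : Type*) [CommRing R] [LieRing L] [LieRingModule L R]
    [AddCommGroup Q] [Module R Q] [LieRingModule L Q] : Prop where
  leibniz : ∀ (x : L) (a : R) (q : Q), ⁅x, a • q⁆ = a • ⁅x, q⁆ + ⁅x, a⁆ • q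

/-- A module over a Lie-Rinehart ring `(R, L)`, that is, an `R`-module with a flat connection along
`L`. -/
class IsRinehartModule (R L N : Type*) [CommRing R] [LieRing L] [Module R L] [LieRingModule L R]
    [AddCommGroup N] [Module R N] [LieRingModule L N] : Prop extends IsLeibnizModule R L N where
  smul_bracket : ∀ (a : R) (x : L) (n : N), ⁅a • x, n⁆ = a • ⁅x, n⁆

variable {R L Q N : Type*} [CommRing R] [LieRing L]
  [AddCommGroup Q] [Module R Q] [AddCommGroup N] [Module R N] {r : ℕ}

instance [LieRingModule L R] [Module R L] [LieRinehartRing R L] : IsRinehartModule R L R where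
  leibniz x a b := by simp only [smul_eq_mul, LieRinehartRing.leibniz_mul_right]
  smul_bracket a x b := LieRinehartRing.lie_smul_eq_mul a b x

instance [LieRingModule L R] [Module R L] [LieRinehartRing R L] : IsLeibnizModule R L L where
  leibniz x a y := LieRinehartRing.leibniz_smul_right x y a

section Alternating

theorem ext_curryLeft {f g : Q [⋀^Fin (r + 1)]→ₗ[R] N}
    (h : ∀ q, f.curryLeft q = g.curryLeft q) : f = g := by
  ext v
  rw [← Fin.cons_self_tail v]
  exact DFunLike.congr_fun (h (v 0)) (Fin.tail v)

theorem exists_alternatingMap_curryLeft_eq (T : Q → Q [⋀^Fin (r + 1)]→ₗ[R] N)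
    (T_add : ∀ x y, T (x + y) = T x + T y)
    (T_self : ∀ x (v : Fin r → Q), T x (Matrix.vecCons x v) = 0) :
    ∃ g : Q [⋀^Fin (r + 2)]→ₗ[R] N, ∀ x v, g (Matrix.vecCons x v) = T x v := by
  have T_swap (x y) (v : Fin r → Q) : T x (Matrix.vecCons y v) = -T y (Matrix.vecCons x v) := by
    have h := T_self (x + y) v
    rw [T_add, AlternatingMap.add_apply, AlternatingMap.map_vecCons_add,
      AlternatingMap.map_vecCons_add, T_self, T_self, zero_add, add_zero] at h
    exact eq_neg_of_add_eq_zero_left h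
  have T_smul (a : R) (x) : T (a • x) = a • T x := ext_curryLeft fun y => by
    ext v
    rw [AlternatingMap.curryLeft_apply_apply, AlternatingMap.curryLeft_apply_apply,
      AlternatingMap.smul_apply, T_swap, AlternatingMap.map_vecCons_smul, T_swap x, smul_neg]
  have T_mem (v : Fin (r + 1) → Q) (i) : T (v i) v = 0 := by
    have h0 : T (v i) (v ∘ Equiv.swap 0 i) = 0 := by
      rw [← Fin.cons_self_tail (v ∘ Equiv.swap 0 i), Function.comp_apply, Equiv.swap_apply_left]
      exact T_self _ _
    rwa [AlternatingMap.map_perm, smul_eq_zero_iff_eq] at h0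
  refine ⟨{ toFun := fun v => T (v 0) (Fin.tail v)
            map_update_add' := ?_, map_update_smul' := ?_, map_eq_zero_of_eq' := ?_ },
    fun x v => rfl⟩
  · intro inst v i x y
    obtain rfl : inst = instDecidableEqFin _ := Subsingleton.elim _ _
    refine Fin.cases ?_ (fun i => ?_) i <;>
      simp [T_add, Function.update_of_ne (Fin.succ_ne_zero _).symm]
  · intro inst v i a x
    obtain rfl : inst = instDecidableEqFin _ := Subsingleton.elim _ _
    refine Fin.cases ?_ (fun i => ?_) i <;>
      simp [T_smul, Function.update_of_ne (Fin.succ_ne_zero _).symm]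
  · intro v i j
    refine Fin.cases ?_ (fun i => ?_) i <;> refine Fin.cases ?_ (fun j => ?_) j <;> intro hv hij
    · exact absurd rfl hij
    · exact hv ▸ T_mem (Fin.tail v) j
    · exact hv ▸ T_mem (Fin.tail v) i
    · exact (T (v 0)).map_eq_zero_of_eq _ hv fun h => hij (congrArg Fin.succ h)

theorem sum_update_update (τ : Q → Q) (f : Q [⋀^Fin r]→ₗ[R] N) (v : Fin r → Q) (i : Fin r)
    (q : Q) :
    ∑ j, f (Function.update (Function.update v i q) j (τ (Function.update v i q j)))
      = f (Function.update v i (τ q)) +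
        ∑ j ∈ Finset.univ.erase i, f (Function.update (Function.update v j (τ (v j))) i q) := by
  rw [← Finset.add_sum_erase _ _ (Finset.mem_univ i)]
  congr 1
  · simp
  · refine Finset.sum_congr rfl fun j hj => ?_
    rw [Function.update_of_ne (Finset.ne_of_mem_erase hj),
      Function.update_comm (Finset.ne_of_mem_erase hj)]

theorem sum_map_update_eq_zero (τ : Q → Q) (f : Q [⋀^Fin r]→ₗ[R] N) {v : Fin r → Q}
    {i j : Fin r} (hv : v i = v j) (hij : i ≠ j) :
    ∑ k, f (Function.update v k (τ (v k))) = 0 := by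
  have hswap : Function.update v j (τ (v j)) = Function.update v i (τ (v i)) ∘ Equiv.swap i j := by
    rw [Function.update_comp_equiv, Equiv.comp_swap_eq_update, Equiv.symm_swap,
      Equiv.swap_apply_left, hv, Function.update_eq_self, ← hv, Function.update_eq_self]
  rw [← Finset.add_sum_erase _ _ (Finset.mem_univ i),
    ← Finset.add_sum_erase _ _ (Finset.mem_erase.2 ⟨hij.symm, Finset.mem_univ j⟩), ← add_assoc,
    hswap, f.map_swap _ hij, add_neg_cancel, zero_add]
  refine Finset.sum_eq_zero fun k hk => f.map_eq_zero_of_eq _ ?_ hij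
  rw [Function.update_of_ne (Finset.ne_of_mem_erase (Finset.mem_of_mem_erase hk)).symm,
    Function.update_of_ne (Finset.ne_of_mem_erase hk).symm, hv]

end Alternating

section LieDerivative

variable [LieRingModule L R] [LieRingModule L Q] [LieRingModule L N]
  [IsLeibnizModule R L Q] [IsLeibnizModule R L N]

/-- The Lie derivative of an alternating map along `x`. -/
def lieDeriv (x : L) (f : Q [⋀^Fin r]→ₗ[R] N) : Q [⋀^Fin r]→ₗ[R] N where
  toFun v := ⁅x, f v⁆ - ∑ j, f (Function.update v j ⁅x, v j⁆)
  map_update_add' {inst} v i q q' := by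
    obtain rfl : inst = instDecidableEqFin r := Subsingleton.elim _ _
    simp only [sum_update_update (fun q => ⁅x, q⁆), lie_add, f.map_update_add,
      Finset.sum_add_distrib]
    abel
  map_update_smul' {inst} v i a q := by
    obtain rfl : inst = instDecidableEqFin r := Subsingleton.elim _ _
    simp only [sum_update_update (fun q => ⁅x, q⁆), IsLeibnizModule.leibniz, f.map_update_add,
      f.map_update_smul, smul_sub, smul_add, Finset.smul_sum]
    abel
  map_eq_zero_of_eq' v i j hv hij := by
    rw [f.map_eq_zero_of_eq v hv hij, lie_zero, sum_map_update_eq_zero _ f hv hij, sub_zero]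

theorem lieDeriv_apply (x : L) (f : Q [⋀^Fin r]→ₗ[R] N) (v : Fin r → Q) :
    lieDeriv x f v = ⁅x, f v⁆ - ∑ j, f (Function.update v j ⁅x, v j⁆) := rfl

theorem lieDeriv_add (x : L) (f g : Q [⋀^Fin r]→ₗ[R] N) :
    lieDeriv x (f + g) = lieDeriv x f + lieDeriv x g := by
  ext v
  simp only [lieDeriv_apply, AlternatingMap.add_apply, lie_add, Finset.sum_add_distrib]
  abel

theorem lieDeriv_sub (x : L) (f g : Q [⋀^Fin r]→ₗ[R] N) :
    lieDeriv x (f - g) = lieDeriv x f - lieDeriv x g :=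
  map_sub (AddMonoidHom.mk' _ (lieDeriv_add x)) f g

theorem curryLeft_lieDeriv (x : L) (f : Q [⋀^Fin (r + 1)]→ₗ[R] N) (q : Q) :
    (lieDeriv x f).curryLeft q = lieDeriv x (f.curryLeft q) - f.curryLeft ⁅x, q⁆ := by
  ext v
  have update_zero : Function.update (Matrix.vecCons q v) 0 ⁅x, q⁆ = Matrix.vecCons ⁅x, q⁆ v :=
    Fin.update_cons_zero _ _ _
  have update_succ (j : Fin r) : Function.update (Matrix.vecCons q v) j.succ ⁅x, v j⁆
      = Matrix.vecCons q (Function.update v j ⁅x, v j⁆) :=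
    (Fin.cons_update (α := fun _ => Q) q v j ⁅x, v j⁆).symm
  simp only [AlternatingMap.curryLeft_apply_apply, AlternatingMap.sub_apply, lieDeriv_apply,
    Fin.sum_univ_succ, Matrix.cons_val_zero, Matrix.cons_val_succ, update_zero, update_succ]
  abel

theorem lieDeriv_lie (x y : L) (f : Q [⋀^Fin r]→ₗ[R] N) :
    lieDeriv ⁅x, y⁆ f = lieDeriv x (lieDeriv y f) - lieDeriv y (lieDeriv x f) := by
  induction r with
  | zero =>
    ext v
    simp [lieDeriv_apply, lie_lie]
  | succ r ih =>
    refine ext_curryLeft fun q => ?_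
    have curryLeft_sub (f g : Q [⋀^Fin (r + 1)]→ₗ[R] N) :
      (f - g).curryLeft q = f.curryLeft q - g.curryLeft q := rfl
    rw [curryLeft_lieDeriv, ih, lie_lie, curryLeft_sub]
    simp only [curryLeft_lieDeriv, lieDeriv_sub, map_sub]
    abel

theorem lieDeriv_add_left (x y : L) (f : Q [⋀^Fin r]→ₗ[R] N) :
    lieDeriv (x + y) f = lieDeriv x f + lieDeriv y f := by
  ext v
  simp only [lieDeriv_apply, AlternatingMap.add_apply, add_lie, f.map_update_add,
    Finset.sum_add_distrib]
  abel

instance : LieRingModule L (Q [⋀^Fin r]→ₗ[R] N) where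
  bracket := lieDeriv
  add_lie := lieDeriv_add_left
  lie_add := lieDeriv_add
  leibniz_lie x y f := by
    change lieDeriv x (lieDeriv y f) = lieDeriv ⁅x, y⁆ f + lieDeriv y (lieDeriv x f)
    rw [lieDeriv_lie, sub_add_cancel]

theorem lie_alternatingMap_apply (x : L) (f : Q [⋀^Fin r]→ₗ[R] N) (v : Fin r → Q) :
    ⁅x, f⁆ v = ⁅x, f v⁆ - ∑ j, f (Function.update v j ⁅x, v j⁆) := rfl

theorem curryLeft_lie (x : L) (f : Q [⋀^Fin (r + 1)]→ₗ[R] N) (q : Q) :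
    ⁅x, f⁆.curryLeft q = ⁅x, f.curryLeft q⁆ - f.curryLeft ⁅x, q⁆ :=
  curryLeft_lieDeriv x f q

instance : IsLeibnizModule R L (Q [⋀^Fin r]→ₗ[R] N) where
  leibniz x a f := by
    ext v
    simp only [lie_alternatingMap_apply, AlternatingMap.add_apply, AlternatingMap.smul_apply,
      IsLeibnizModule.leibniz, smul_sub, Finset.smul_sum]
    abel

end LieDerivative

instance [Module R L] [LieRingModule L R] [LieRingModule L Q] [LieRingModule L N]
    [IsRinehartModule R L Q] [IsRinehartModule R L N] :
    IsRinehartModule R L (Q [⋀^Fin r]→ₗ[R] N) where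
  smul_bracket a x f := by
    ext v
    simp only [lie_alternatingMap_apply, AlternatingMap.smul_apply, IsRinehartModule.smul_bracket,
      f.map_update_smul, smul_sub, Finset.smul_sum]

section Differential

variable [Module R L] [LieRingModule L N]

/-- The values of the Chevalley-Eilenberg differential. In the bracket terms `⁅x i, x j⁆` replaces
`x j`, for `i < j`, which absorbs the usual sign `(-1) ^ (i + j)`. -/
def ceDifferentialVal (f : L [⋀^Fin r]→ₗ[R] N) (x : Fin (r + 1) → L) : N :=
  ∑ i : Fin (r + 1), (-1 : ℤ) ^ (i : ℕ) •
    (⁅x i, f (i.removeNth x)⁆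
      - ∑ j : Fin r, if i ≤ j.castSucc then
          f (Function.update (i.removeNth x) j ⁅x i, i.removeNth x j⁆) else 0)

theorem ceDifferentialVal_add (f g : L [⋀^Fin r]→ₗ[R] N) (x : Fin (r + 1) → L) :
    ceDifferentialVal (f + g) x = ceDifferentialVal f x + ceDifferentialVal g x := by
  simp only [ceDifferentialVal, ← Finset.sum_add_distrib, ← smul_add]
  refine Finset.sum_congr rfl fun i _ => congrArg _ ?_
  simp only [AlternatingMap.add_apply, lie_add, sub_add_sub_comm, ← Finset.sum_add_distrib,
    ite_add_ite, add_zero]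

theorem ceDifferentialVal_zero (x : Fin (r + 1) → L) :
    ceDifferentialVal (0 : L [⋀^Fin r]→ₗ[R] N) x = 0 := by
  simp [ceDifferentialVal]

variable [LieRingModule L R] [LieRinehartRing R L] [IsRinehartModule R L N]

theorem ceDifferentialVal_of_zero_form (f : L [⋀^Fin 0]→ₗ[R] N) (x : Fin 1 → L) :
    ceDifferentialVal f x = ⁅x 0, f⁆ (Fin.tail x) := by
  simp [ceDifferentialVal, lie_alternatingMap_apply,
    Subsingleton.elim (Fin.removeNth 0 x) (Fin.tail x)]

theorem ceDifferentialVal_vecCons (f : L [⋀^Fin (r + 1)]→ₗ[R] N) (x : L) (y : Fin (r + 1) → L) :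
    ceDifferentialVal f (Matrix.vecCons x y)
      = ⁅x, f⁆ y - ceDifferentialVal (f.curryLeft x) y := by
  have removeNth_zero : (0 : Fin (r + 2)).removeNth (Matrix.vecCons x y) = y := by
    simp [Matrix.vecCons]
  have removeNth_succ (i : Fin (r + 1)) : i.succ.removeNth (Matrix.vecCons x y)
      = Matrix.vecCons x (i.removeNth y) := by
    ext j
    refine Fin.cases ?_ (fun j => ?_) j <;> simp [Fin.removeNth]
  have update_succ (v : Fin r → L) (j z) : Function.update (Matrix.vecCons x v) (Fin.succ j) z
      = Matrix.vecCons x (Function.update v j z) :=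
    (Fin.cons_update (α := fun _ => L) x v j z).symm
  rw [ceDifferentialVal, Fin.sum_univ_succ, sub_eq_add_neg (⁅x, f⁆ y)]
  congr 1
  · simp [removeNth_zero, lie_alternatingMap_apply]
  · rw [ceDifferentialVal, ← Finset.sum_neg_distrib]
    refine Finset.sum_congr rfl fun i _ => ?_
    rw [removeNth_succ, Fin.val_succ, pow_succ, mul_neg_one, neg_smul, Fin.sum_univ_succ]
    simp [update_succ]

theorem exists_ceDifferential (f : L [⋀^Fin r]→ₗ[R] N) :
    ∃ g : L [⋀^Fin (r + 1)]→ₗ[R] N, ∀ x, g x = ceDifferentialVal f x := by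
  induction r with
  | zero =>
    let T : L →ₗ[R] N :=
      { toFun := fun x => ⁅x, f⁆ ![]
        map_add' := fun x y => by rw [add_lie]; rfl
        map_smul' := fun a x => by
          simp [lie_alternatingMap_apply, IsRinehartModule.smul_bracket] }
    refine ⟨AlternatingMap.ofSubsingleton R L N (0 : Fin 1) T, fun x => ?_⟩
    rw [ceDifferentialVal_of_zero_form, Subsingleton.elim (Fin.tail x) ![]]
    rfl
  | succ r ih =>
    choose d hd using ih
    have d_add (f g) : d (f + g) = d f + d g := by
      ext v
      simp only [AlternatingMap.add_apply, hd, ceDifferentialVal_add]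
    have cartan_self (x : L) (v : Fin r → L) :
        (⁅x, f⁆ - d (f.curryLeft x)) (Matrix.vecCons x v) = 0 := by
      have h := DFunLike.congr_fun (curryLeft_lie x f x) v
      rw [AlternatingMap.curryLeft_apply_apply, lie_self, map_zero, sub_zero] at h
      rw [AlternatingMap.sub_apply, h, hd, sub_eq_zero]
      cases r with
      | zero =>
        rw [ceDifferentialVal_of_zero_form]
        rfl
      | succ r =>
        rw [ceDifferentialVal_vecCons, AlternatingMap.curryLeft_same, ceDifferentialVal_zero,
          sub_zero]
    obtain ⟨g, hg⟩ := exists_alternatingMap_curryLeft_eq (fun x => ⁅x, f⁆ - d (f.curryLeft x))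
      (fun x y => by rw [add_lie, map_add, d_add]; abel) cartan_self
    refine ⟨g, fun x => ?_⟩
    rw [← Fin.cons_self_tail x]
    exact (hg _ _).trans (by rw [AlternatingMap.sub_apply, hd]; exact
      (ceDifferentialVal_vecCons f _ _).symm)

/-- The Chevalley-Eilenberg differential of a Lie-Rinehart ring with coefficients in `N`. -/
def ceDifferential (r : ℕ) : (L [⋀^Fin r]→ₗ[R] N) →+ (L [⋀^Fin (r + 1)]→ₗ[R] N) :=
  AddMonoidHom.mk' (fun f => (exists_ceDifferential f).choose) fun f g => by
    ext x
    rw [AlternatingMap.add_apply, (exists_ceDifferential f).choose_spec,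
      (exists_ceDifferential g).choose_spec, (exists_ceDifferential (f + g)).choose_spec,
      ceDifferentialVal_add]

theorem ceDifferential_apply (f : L [⋀^Fin r]→ₗ[R] N) (x : Fin (r + 1) → L) :
    ceDifferential r f x = ceDifferentialVal f x :=
  (exists_ceDifferential f).choose_spec x

theorem curryLeft_ceDifferential_zero (f : L [⋀^Fin 0]→ₗ[R] N) (x : L) :
    (ceDifferential 0 f).curryLeft x = ⁅x, f⁆ := by
  ext v
  rw [AlternatingMap.curryLeft_apply_apply, ceDifferential_apply, ceDifferentialVal_of_zero_form]
  rfl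

theorem curryLeft_ceDifferential_succ (f : L [⋀^Fin (r + 1)]→ₗ[R] N) (x : L) :
    (ceDifferential (r + 1) f).curryLeft x = ⁅x, f⁆ - ceDifferential r (f.curryLeft x) := by
  ext v
  rw [AlternatingMap.curryLeft_apply_apply, ceDifferential_apply, ceDifferentialVal_vecCons,
    AlternatingMap.sub_apply, ceDifferential_apply]

theorem lie_ceDifferential (x : L) (f : L [⋀^Fin r]→ₗ[R] N) :
    ⁅x, ceDifferential r f⁆ = ceDifferential r ⁅x, f⁆ := by
  induction r with
  | zero =>
    refine ext_curryLeft fun y => ?_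
    simp only [curryLeft_lie, curryLeft_ceDifferential_zero, lie_lie]
    abel
  | succ r ih =>
    refine ext_curryLeft fun y => ?_
    simp only [curryLeft_lie, curryLeft_ceDifferential_succ, lie_lie, lie_sub, ih, map_sub]
    abel

theorem ceDifferential_ceDifferential (f : L [⋀^Fin r]→ₗ[R] N) :
    ceDifferential (r + 1) (ceDifferential r f) = 0 := by
  induction r with
  | zero =>
    refine ext_curryLeft fun x => ?_
    rw [curryLeft_ceDifferential_succ, curryLeft_ceDifferential_zero, lie_ceDifferential, sub_self]
    rfl
  | succ r ih =>
    refine ext_curryLeft fun x => ?_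
    rw [curryLeft_ceDifferential_succ, curryLeft_ceDifferential_succ, map_sub, ih,
      lie_ceDifferential, sub_zero, sub_self]
    rfl

end Differential

end LieRinehart

theorem alternatingMap_sum_apply {R Q N ι κ : Type*} [CommRing R] [AddCommGroup Q] [Module R Q]
    [AddCommGroup N] [Module R N] (s : Finset κ) (f : κ → Q [⋀^ι]→ₗ[R] N) (v : ι → Q) :
    (∑ i ∈ s, f i) v = ∑ i ∈ s, f i v :=
  map_sum (AddMonoidHom.mk' (fun f : Q [⋀^ι]→ₗ[R] N => f v) fun _ _ => rfl) f s

section TangentialComplex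

variable {m : ℕ} {M : Type*} [TopologicalSpace M] [ChartedSpace (EuclideanSpace ℝ (Fin m)) M]
  {d : ℕ} {S : CRStructure m M d} {p r : ℕ}

section Values

variable {N : Type*} [AddCommGroup N] [Module (Smooth m M) N]

theorem Form.ext_ev {f g : Form S p r N} (h : ∀ Z X, f.ev Z X = g.ev Z X) : f = g := by
  refine AlternatingMap.ext fun Z => AlternatingMap.ext fun X => ?_
  choose Y hY using fun j => S.H.mkQ_surjective (X j)
  obtain rfl : (fun j => S.H.mkQ (Y j)) = X := funext hY
  exact h Z Y

theorem mkQ_comp_update (X : Fin p → VF m M) (j : Fin p) (V : VF m M) :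
    (fun i => S.H.mkQ (Function.update X j V i))
      = Function.update (fun i => S.H.mkQ (X i)) j (S.H.mkQ V) :=
  Function.comp_update S.H.mkQ X j V

/-- The values of a form as a linear function of its `j`-th argument in `H_{0,1}M`. -/
def Form.evLeft (f : Form S p r N) (Z : Fin r → S.H) (X : Fin p → VF m M) (j : Fin r) :
    S.H →ₗ[Smooth m M] N where
  toFun V := f.ev (Function.update Z j V) X
  map_add' V W := by simp only [Form.ev, f.map_update_add, AlternatingMap.add_apply]
  map_smul' a V := by
    simp only [Form.ev, f.map_update_smul, AlternatingMap.smul_apply, RingHom.id_apply]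

/-- The values of a form as a linear function of its `j`-th argument in `T_ℂM`. -/
def Form.evRight (f : Form S p r N) (Z : Fin r → S.H) (X : Fin p → VF m M) (j : Fin p) :
    VF m M →ₗ[Smooth m M] N where
  toFun V := f.ev Z (Function.update X j V)
  map_add' V W := by simp only [Form.ev, mkQ_comp_update, map_add, (f Z).map_update_add]
  map_smul' a V := by
    simp only [Form.ev, mkQ_comp_update, map_smul, (f Z).map_update_smul, RingHom.id_apply]

end Values

instance : LieRing S.H where
  bracket := S.br
  add_lie Z W X := Subtype.ext (add_lie (Z : VF m M) (W : VF m M) (X : VF m M))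
  lie_add Z W X := Subtype.ext (lie_add (Z : VF m M) (W : VF m M) (X : VF m M))
  lie_self Z := Subtype.ext (lie_self (Z : VF m M))
  leibniz_lie Z W X := Subtype.ext (LieRing.leibniz_lie (Z : VF m M) (W : VF m M) (X : VF m M))

instance : LieRingModule S.H (Smooth m M) where
  bracket Z a := (Z : VF m M) a
  add_lie _ _ _ := rfl
  lie_add _ _ _ := map_add _ _ _
  leibniz_lie Z W a := by
    change (Z : VF m M) ((W : VF m M) a)
      = ⁅(Z : VF m M), (W : VF m M)⁆ a + (W : VF m M) ((Z : VF m M) a)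
    rw [Derivation.commutator_apply, sub_add_cancel]

theorem lie_smooth (Z : S.H) (a : Smooth m M) : ⁅Z, a⁆ = (Z : VF m M) a := rfl

instance : LieRinehartRing (Smooth m M) S.H where
  lie_smul_eq_mul' _ _ _ := rfl
  leibniz_mul_right' Z a b := LieRinehartRing.leibniz_mul_right (Z : VF m M) a b
  leibniz_smul_right' Z W a :=
    Subtype.ext (LieRinehartRing.leibniz_smul_right (Z : VF m M) (W : VF m M) a)

/-- The Bott connection: `H_{0,1}M` acts on `T_ℂM / H_{0,1}M` by brackets. -/
instance instBottConnection : LieRingModule S.H (VF m M ⧸ S.H) where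
  bracket Z := QuotientAddGroup.map S.H.toAddSubgroup S.H.toAddSubgroup
    (AddMonoidHom.mk' (fun X : VF m M => ⁅(Z : VF m M), X⁆) fun X Y => lie_add (Z : VF m M) X Y)
    fun X hX => S.lie_mem Z Z.2 X hX
  add_lie Z W q := by
    obtain ⟨X, rfl⟩ := S.H.mkQ_surjective q
    exact congrArg S.H.mkQ (add_lie (Z : VF m M) (W : VF m M) X)
  lie_add _ _ _ := map_add _ _ _
  leibniz_lie Z W q := by
    obtain ⟨X, rfl⟩ := S.H.mkQ_surjective q
    exact congrArg S.H.mkQ (LieRing.leibniz_lie (Z : VF m M) (W : VF m M) X)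

theorem lie_mkQ (Z : S.H) (X : VF m M) : ⁅Z, S.H.mkQ X⁆ = S.H.mkQ ⁅(Z : VF m M), X⁆ := rfl

theorem smul_lie_eq (a : Smooth m M) (Y X : VF m M) : ⁅a • Y, X⁆ = a • ⁅Y, X⁆ - X a • Y := by
  ext1 b
  simp only [Derivation.commutator_apply, Derivation.sub_apply, Derivation.smul_apply,
    Derivation.leibniz, smul_eq_mul]
  ring

instance : IsRinehartModule (Smooth m M) S.H (VF m M ⧸ S.H) where
  leibniz Z a q := by
    obtain ⟨X, rfl⟩ := S.H.mkQ_surjective q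
    exact congrArg S.H.mkQ (LieRinehartRing.leibniz_smul_right (Z : VF m M) X a)
  smul_bracket a Z q := by
    obtain ⟨X, rfl⟩ := S.H.mkQ_surjective q
    have h : S.H.mkQ (X a • (Z : VF m M)) = 0 :=
      (Submodule.Quotient.mk_eq_zero _).2 (S.H.smul_mem _ Z.2)
    rw [lie_mkQ, lie_mkQ, Submodule.coe_smul, smul_lie_eq, map_sub, map_smul, h, sub_zero]

/-- The tangential Cauchy-Riemann operator `∂̄_b` on smooth `(p,r)`-forms. -/
def dForm : Form S p r (Smooth m M) →+ Form S p (r + 1) (Smooth m M) := ceDifferential r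

theorem dForm_dForm (f : Form S p r (Smooth m M)) : dForm (dForm f) = 0 :=
  ceDifferential_ceDifferential f

theorem dForm_ev (f : Form S p r (Smooth m M)) (Z : Fin (r + 1) → S.H) (X : Fin p → VF m M) :
    (dForm f).ev Z X = dbar (fun Y a => Y a) f Z X := by
  rw [Form.ev, dForm, ceDifferential_apply, ceDifferentialVal, dbar, alternatingMap_sum_apply]
  refine Finset.sum_congr rfl fun i _ => ?_
  have lie_ev : ⁅Z i, f (i.removeNth Z)⁆ (fun j => S.H.mkQ (X j))
      = (Z i : VF m M) (f.ev (i.removeNth Z) X)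
        - ∑ j, f.ev (i.removeNth Z) (Function.update X j ⁅(Z i : VF m M), X j⁆) := by
    simp only [lie_alternatingMap_apply, Form.ev, mkQ_comp_update, lie_mkQ, lie_smooth]
  rw [AlternatingMap.smul_apply, AlternatingMap.sub_apply, alternatingMap_sum_apply, lie_ev,
    sub_right_comm]
  congr 3
  refine Finset.sum_congr rfl fun j _ => ?_
  split_ifs <;> rfl

theorem isClosedForm_iff (f : Form S p r (Smooth m M)) : IsClosedForm f ↔ dForm f = 0 := by
  refine ⟨fun h => Form.ext_ev fun Z X => ?_, fun h Z X => ?_⟩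
  · rw [dForm_ev, h Z X]; rfl
  · rw [← dForm_ev, h]; rfl

theorem cohomologyVanishes_succ_iff (S : CRStructure m M d) (p r : ℕ) :
    CohomologyVanishes S p (r + 1) ↔ ∀ f : Form S p (r + 1) (Smooth m M), dForm f = 0 →
      ∃ u : Form S p r (Smooth m M), dForm u = f := by
  simp only [CohomologyVanishes, isClosedForm_iff]
  refine forall₂_congr fun f _ => exists_congr fun u => ⟨fun h => Form.ext_ev fun Z X => ?_, ?_⟩
  · rw [dForm_ev, h]
  · rintro rfl Z X; rw [dForm_ev]

end TangentialComplex

section Pullback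

variable {m : ℕ} {M : Type*} [TopologicalSpace M] [ChartedSpace (EuclideanSpace ℝ (Fin m)) M]
  {d : ℕ} {S S' : CRStructure m M d} {p r : ℕ}

/-- The pullback of forms along a linear automorphism of the vector fields that maps `H_{0,1}M` of
one CR structure to that of another. -/
def Form.pullback (ψ : VF m M ≃ₗ[Smooth m M] VF m M)
    (h : S.H.map (ψ : VF m M →ₗ[Smooth m M] VF m M) = S'.H) :
    Form S' p r (Smooth m M) →ₗ[Smooth m M] Form S p r (Smooth m M) where
  toFun f := ((AlternatingMap.domLCongr (Smooth m M) (Smooth m M) (Fin p) (Smooth m M)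
    (Submodule.Quotient.equiv S.H S'.H ψ h).symm).toLinearMap.compAlternatingMap f).compLinearMap
      (ψ.ofSubmodules S.H S'.H h)
  map_add' f g := AlternatingMap.ext fun Z => by simp
  map_smul' a f := AlternatingMap.ext fun Z => by simp

variable (ψ : VF m M ≃ₗ[Smooth m M] VF m M)
  (h : S.H.map (ψ : VF m M →ₗ[Smooth m M] VF m M) = S'.H)

theorem Form.pullback_ev (f : Form S' p r (Smooth m M)) (Z : Fin r → S.H) (X : Fin p → VF m M) :
    (Form.pullback ψ h f).ev Z X
      = f.ev (fun i => ψ.ofSubmodules S.H S'.H h (Z i)) (fun j => ψ (X j)) := rfl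

include h in
theorem map_symm_eq : S'.H.map (ψ.symm : VF m M →ₗ[Smooth m M] VF m M) = S.H :=
  (Submodule.map_symm_eq_iff ψ).2 h

theorem Form.pullback_pullback_symm (f : Form S p r (Smooth m M)) :
    Form.pullback ψ h (Form.pullback ψ.symm (map_symm_eq ψ h) f) = f :=
  Form.ext_ev fun Z X => by
    simp only [Form.pullback_ev, LinearEquiv.symm_apply_apply]
    exact congrArg (f.ev · X) (funext fun i => (ψ.ofSubmodules S.H S'.H h).symm_apply_apply (Z i))

theorem Form.pullback_symm_pullback (f : Form S' p r (Smooth m M)) :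
    Form.pullback ψ.symm (map_symm_eq ψ h) (Form.pullback ψ h f) = f :=
  Form.pullback_pullback_symm ψ.symm (map_symm_eq ψ h) f

/-- The tangential Cauchy-Riemann operator of `S'`, conjugated to an operator on forms of `S`. -/
def pulledD : Form S p r (Smooth m M) →+ Form S p (r + 1) (Smooth m M) :=
  (Form.pullback ψ h).toAddMonoidHom.comp
    (dForm.comp (Form.pullback ψ.symm (map_symm_eq ψ h)).toAddMonoidHom)

theorem pulledD_apply (f : Form S p r (Smooth m M)) :
    pulledD ψ h f = Form.pullback ψ h (dForm (Form.pullback ψ.symm (map_symm_eq ψ h) f)) := rfl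

theorem pulledD_pullback (f : Form S' p r (Smooth m M)) :
    pulledD ψ h (Form.pullback ψ h f) = Form.pullback ψ h (dForm f) := by
  rw [pulledD_apply, Form.pullback_symm_pullback]

theorem pulledD_pulledD (f : Form S p r (Smooth m M)) : pulledD ψ h (pulledD ψ h f) = 0 := by
  rw [pulledD_apply ψ h f, pulledD_pullback, dForm_dForm, map_zero]

theorem cohomologyVanishes_of_pulledD
    (H : ∀ f : Form S p (r + 1) (Smooth m M), pulledD ψ h f = 0 →
      ∃ u : Form S p r (Smooth m M), pulledD ψ h u = f) : CohomologyVanishes S' p (r + 1) := by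
  refine (cohomologyVanishes_succ_iff S' p r).2 fun f hf => ?_
  obtain ⟨u, hu⟩ := H (Form.pullback ψ h f) (by rw [pulledD_pullback, hf, map_zero])
  refine ⟨Form.pullback ψ.symm (map_symm_eq ψ h) u, ?_⟩
  rw [← Form.pullback_symm_pullback ψ h (dForm _), ← pulledD_apply, hu,
    Form.pullback_symm_pullback]

/-- The bracket of vector fields, conjugated by `ψ`. -/
def pulledBr (Z X : VF m M) : VF m M := ψ.symm ⁅ψ Z, ψ X⁆

include h in
theorem pulledBr_mem (Z W : S.H) : pulledBr ψ Z W ∈ S.H := by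
  have lie_mem := S'.lie_mem _ (h ▸ Submodule.mem_map_of_mem Z.2) _
    (h ▸ Submodule.mem_map_of_mem W.2)
  exact (map_symm_eq ψ h).le (Submodule.mem_map_of_mem lie_mem)

theorem pulledD_ev (f : Form S p r (Smooth m M)) (Z : Fin (r + 1) → S.H) (X : Fin p → VF m M) :
    (pulledD ψ h f).ev Z X = ∑ i : Fin (r + 1), (-1 : ℤ) ^ (i : ℕ) •
      (ψ (Z i) (f.ev (i.removeNth Z) X)
        - (∑ j : Fin r, if i ≤ j.castSucc then
            f.ev (Function.update (i.removeNth Z) j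
              ⟨pulledBr ψ (Z i) (i.removeNth Z j), pulledBr_mem ψ h _ _⟩) X else 0)
        - ∑ j : Fin p, f.ev (i.removeNth Z) (Function.update X j (pulledBr ψ (Z i) (X j)))) := by
  set e := ψ.ofSubmodules S.H S'.H h
  have symm_update_left (W : Fin r → S.H) (j) (V : S'.H) :
      (fun k => e.symm (Function.update (fun k => e (W k)) j V k))
        = Function.update W j (e.symm V) := by
    refine (Function.comp_update e.symm _ j V).trans ?_
    simp only [Function.comp_def, LinearEquiv.symm_apply_apply]
  have symm_update_right (j) (V : VF m M) :
      (fun k => ψ.symm (Function.update (fun k => ψ (X k)) j V k))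
        = Function.update X j (ψ.symm V) := by
    refine (Function.comp_update ψ.symm _ j V).trans ?_
    simp only [Function.comp_def, LinearEquiv.symm_apply_apply]
  have ev_symm (W : Fin r → S'.H) (Y : Fin p → VF m M) :
      (Form.pullback ψ.symm (map_symm_eq ψ h) f).ev W Y
        = f.ev (fun k => e.symm (W k)) (fun k => ψ.symm (Y k)) := rfl
  have ev_map (W : Fin r → S.H) :
      (Form.pullback ψ.symm (map_symm_eq ψ h) f).ev (fun k => e (W k)) (fun k => ψ (X k))
        = f.ev W X := by
    simp only [ev_symm, LinearEquiv.symm_apply_apply]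
  rw [pulledD_apply, Form.pullback_ev, dForm_ev, dbar]
  refine Finset.sum_congr rfl fun i _ => ?_
  change (-1 : ℤ) ^ (i : ℕ) • (ψ (Z i) ((Form.pullback ψ.symm (map_symm_eq ψ h) f).ev
      (fun k => e (i.removeNth Z k)) fun k => ψ (X k))
    - (∑ j : Fin r, if i ≤ j.castSucc then (Form.pullback ψ.symm (map_symm_eq ψ h) f).ev
        (Function.update (fun k => e (i.removeNth Z k)) j (S'.br (e (Z i)) (e (i.removeNth Z j))))
        (fun k => ψ (X k)) else 0)
    - ∑ j : Fin p, (Form.pullback ψ.symm (map_symm_eq ψ h) f).ev (fun k => e (i.removeNth Z k))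
        (Function.update (fun k => ψ (X k)) j ⁅ψ (Z i), ψ (X j)⁆)) = _
  simp only [ev_map]
  simp only [ev_symm, symm_update_left, symm_update_right, LinearEquiv.symm_apply_apply]
  rfl

/-- The difference of the two tangential Cauchy-Riemann operators. -/
def pertOp (f : Form S p r (Smooth m M)) : Form S p (r + 1) (Smooth m M) :=
  pulledD ψ h f - dForm f

/-- The change of the bracket under `ψ`. -/
def brDiff (Z X : VF m M) : VF m M := pulledBr ψ Z X - ⁅Z, X⁆

include h in
theorem brDiff_mem (Z W : S.H) : brDiff ψ Z W ∈ S.H :=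
  S.H.sub_mem (pulledBr_mem ψ h Z W) (S.lie_mem _ Z.2 _ W.2)

theorem pertOp_ev (f : Form S p r (Smooth m M)) (Z : Fin (r + 1) → S.H) (X : Fin p → VF m M) :
    (pertOp ψ h f).ev Z X = ∑ i : Fin (r + 1), (-1 : ℤ) ^ (i : ℕ) •
      ((ψ (Z i) - Z i) (f.ev (i.removeNth Z) X)
        - (∑ j : Fin r, if i ≤ j.castSucc then
            f.evLeft (i.removeNth Z) X j
              ⟨brDiff ψ (Z i) (i.removeNth Z j), brDiff_mem ψ h _ _⟩ else 0)
        - ∑ j : Fin p, f.evRight (i.removeNth Z) X j (brDiff ψ (Z i) (X j))) := by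
  have ev_sub : (pertOp ψ h f).ev Z X = (pulledD ψ h f).ev Z X - (dForm f).ev Z X := rfl
  have evLeft_brDiff (i : Fin (r + 1)) (j : Fin r) : f.evLeft (i.removeNth Z) X j
        ⟨brDiff ψ (Z i) (i.removeNth Z j), brDiff_mem ψ h _ _⟩
      = f.ev (Function.update (i.removeNth Z) j
          ⟨pulledBr ψ (Z i) (i.removeNth Z j), pulledBr_mem ψ h _ _⟩) X
        - f.ev (Function.update (i.removeNth Z) j (S.br (Z i) (i.removeNth Z j))) X := by
    have brDiff_eq (Z W : S.H) : (⟨brDiff ψ Z W, brDiff_mem ψ h Z W⟩ : S.H)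
        = ⟨pulledBr ψ Z W, pulledBr_mem ψ h Z W⟩ - S.br Z W := Subtype.ext rfl
    rw [brDiff_eq, map_sub]
    rfl
  have evRight_brDiff (i : Fin (r + 1)) (j : Fin p) :
      f.evRight (i.removeNth Z) X j (brDiff ψ (Z i) (X j))
      = f.ev (i.removeNth Z) (Function.update X j (pulledBr ψ (Z i) (X j)))
        - f.ev (i.removeNth Z) (Function.update X j ⁅(Z i : VF m M), X j⁆) :=
    map_sub (f.evRight (i.removeNth Z) X j) _ _
  rw [ev_sub, pulledD_ev, dForm_ev, dbar, ← Finset.sum_sub_distrib]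
  refine Finset.sum_congr rfl fun i _ => ?_
  rw [← smul_sub]
  congr 1
  simp only [evLeft_brDiff, evRight_brDiff, Derivation.sub_apply, ← Finset.sum_filter,
    Finset.sum_sub_distrib]
  abel

end Pullback

section Horizontal

variable {m : ℕ} {M : Type*} [TopologicalSpace M] [ChartedSpace (EuclideanSpace ℝ (Fin m)) M]
  {d : ℕ} (S : CRStructure m M d)

theorem exists_projH : ∃ π : VF m M →ₗ[Smooth m M] S.H,
    (∀ Z : S.H, π Z = Z) ∧ ∀ W ∈ conjSub S.H, π W = 0 := by
  obtain ⟨K, hK⟩ := S.exists_isCompl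
  have h := S.disjoint_conj.isCompl_sup_right_of_isCompl_sup_left hK
  exact ⟨Submodule.projectionOnto _ _ h, Submodule.projectionOnto_apply_left h, fun W hW =>
    (Submodule.projectionOnto_apply_eq_zero_iff h).2 (le_sup_left (a := conjSub S.H) hW)⟩

theorem exists_projBar : ∃ π : VF m M →ₗ[Smooth m M] conjSub S.H,
    ∀ W : conjSub S.H, π W = W := by
  obtain ⟨K, hK⟩ := S.exists_isCompl
  rw [sup_comm] at hK
  have h := S.disjoint_conj.symm.isCompl_sup_right_of_isCompl_sup_left hK
  exact ⟨Submodule.projectionOnto _ _ h, Submodule.projectionOnto_apply_left h⟩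

/-- A projection of the vector fields to `H_{0,1}M`, zero on `H_{1,0}M`. -/
def projH : VF m M →ₗ[Smooth m M] S.H := (exists_projH S).choose

theorem projH_coe (Z : S.H) : projH S Z = Z := (exists_projH S).choose_spec.1 Z

theorem projH_bar (W : conjSub S.H) : projH S W = 0 := (exists_projH S).choose_spec.2 W W.2

/-- A projection of the vector fields to `H_{1,0}M`. -/
def projBar : VF m M →ₗ[Smooth m M] conjSub S.H := (exists_projBar S).choose

theorem projBar_coe (W : conjSub S.H) : projBar S W = W := (exists_projBar S).choose_spec W

variable {S} (Φ : S.H →ₗ[Smooth m M] conjSub S.H)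

/-- The extension of `Φ` by zero to all vector fields, along `projH`. -/
def extΦ : VF m M →ₗ[Smooth m M] VF m M := (conjSub S.H).subtype ∘ₗ Φ ∘ₗ projH S

theorem extΦ_apply (X : VF m M) : extΦ Φ X = Φ (projH S X) := rfl

theorem extΦ_extΦ (X : VF m M) : extΦ Φ (extΦ Φ X) = 0 := by
  rw [extΦ_apply, extΦ_apply, projH_bar, map_zero]; rfl

/-- The automorphism `X ↦ X - Φ X` of the vector fields. -/
def autΦ : VF m M ≃ₗ[Smooth m M] VF m M where
  toLinearMap := LinearMap.id - extΦ Φ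
  invFun X := X + extΦ Φ X
  left_inv X := by
    change X - extΦ Φ X + extΦ Φ (X - extΦ Φ X) = X
    rw [map_sub, extΦ_extΦ, sub_zero, sub_add_cancel]
  right_inv X := by
    change X + extΦ Φ X - extΦ Φ (X + extΦ Φ X) = X
    rw [map_add, extΦ_extΦ, add_zero, add_sub_cancel_right]

theorem autΦ_apply (X : VF m M) : autΦ Φ X = X - extΦ Φ X := rfl

theorem autΦ_symm_apply (X : VF m M) : (autΦ Φ).symm X = X + extΦ Φ X := rfl

theorem map_autΦ : S.H.map (autΦ Φ : VF m M →ₗ[Smooth m M] VF m M) = graph S Φ := by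
  have autΦ_coe (Z : S.H) : autΦ Φ Z = (S.H.subtype - (conjSub S.H).subtype ∘ₗ Φ) Z := by
    rw [autΦ_apply, extΦ_apply, projH_coe]; rfl
  ext X
  constructor
  · rintro ⟨Z, hZ, rfl⟩
    exact ⟨⟨Z, hZ⟩, (autΦ_coe _).symm⟩
  · rintro ⟨Z, rfl⟩
    exact ⟨Z, Z.2, autΦ_coe Z⟩

theorem brDiff_autΦ (Z X : VF m M) :
    brDiff (autΦ Φ) Z X = (extΦ Φ ⁅Z, X⁆ - ⁅Z, extΦ Φ X⁆ - ⁅extΦ Φ Z, X⁆ + ⁅extΦ Φ Z, extΦ Φ X⁆)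
      + extΦ Φ (⁅extΦ Φ Z, extΦ Φ X⁆ - ⁅Z, extΦ Φ X⁆ - ⁅extΦ Φ Z, X⁆) := by
  have sub_lie_sub (N N' : VF m M) : ⁅Z - N, X - N'⁆ = ⁅Z, X⁆ - ⁅Z, N'⁆ - ⁅N, X⁆ + ⁅N, N'⁆ := by
    ext1 b
    simp only [Derivation.commutator_apply, Derivation.sub_apply, Derivation.add_apply, map_sub]
    ring
  rw [brDiff, pulledBr, autΦ_symm_apply, autΦ_apply, autΦ_apply, sub_lie_sub]
  simp only [map_add, map_sub]
  abel

variable (S) in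
/-- A horizontal perturbation of a CR structure: a form `Φ` and the CR structure whose `H_{0,1}` is
the graph of `Φ`. -/
structure Perturbation where
  Φ : S.H →ₗ[Smooth m M] conjSub S.H
  toCRStructure : CRStructure m M d
  H_eq : toCRStructure.H = graph S Φ

theorem Perturbation.map_autΦ (q : Perturbation S) :
    S.H.map (autΦ q.Φ : VF m M →ₗ[Smooth m M] VF m M) = q.toCRStructure.H :=
  (CR.map_autΦ q.Φ).trans q.H_eq.symm

end Horizontal

section SmoothToContinuous

variable {m : ℕ} {M : Type*} [TopologicalSpace M] [ChartedSpace (EuclideanSpace ℝ (Fin m)) M]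

/-- A smooth function as a continuous function. -/
def Smooth.toC (a : Smooth m M) : C(M, ℂ) := ⟨a, a.contMDiff.continuous⟩

@[simp]
theorem Smooth.toC_apply (a : Smooth m M) (x : M) : a.toC x = a x := rfl

theorem Smooth.toC_sum {ι : Type*} (s : Finset ι) (a : ι → Smooth m M) :
    (∑ i ∈ s, a i).toC = ∑ i ∈ s, (a i).toC :=
  map_sum (AddMonoidHom.mk' (Smooth.toC : Smooth m M → C(M, ℂ)) fun _ _ => rfl) a s

theorem VF.sum_apply {ι : Type*} (s : Finset ι) (Y : ι → VF m M) (a : Smooth m M) :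
    (∑ i ∈ s, Y i) a = ∑ i ∈ s, Y i a :=
  map_sum (AddMonoidHom.mk' (fun Y : VF m M => Y a) fun _ _ => rfl) Y s

end SmoothToContinuous

section SmoothClasses

variable {m : ℕ} {M : Type*} [TopologicalSpace M] [ChartedSpace (EuclideanSpace ℝ (Fin m)) M]
  [MeasurableSpace M] [BorelSpace M] {μ : Measure M}

theorem toAE_add (a b : Smooth m M) : toAE μ (a + b) = toAE μ a + toAE μ b := by
  simp only [toAE, AEEqFun.mk_add_mk]; congr 1

theorem smul_toAE (a b : Smooth m M) : a • toAE μ b = toAE μ (a * b) := by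
  change toAE μ a * toAE μ b = _
  simp only [toAE, AEEqFun.mk_mul_mk]
  congr 1

/-- The inclusion of the smooth functions into the almost everywhere classes. -/
def toAELin (μ : Measure M) : Smooth m M →ₗ[Smooth m M] (M →ₘ[μ] ℂ) where
  toFun := toAE μ
  map_add' := toAE_add
  map_smul' a b := (smul_toAE a b).symm

theorem toAE_sub (a b : Smooth m M) : toAE μ (a - b) = toAE μ a - toAE μ b :=
  map_sub (toAELin μ) a b

theorem toAE_zero : toAE μ (0 : Smooth m M) = 0 := map_zero (toAELin μ)

theorem coeFn_toAE (a : Smooth m M) : toAE μ a =ᵐ[μ] a := AEEqFun.coeFn_mk _ _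

theorem integral_toAE_mul (a : Smooth m M) (ψ : M → ℂ) :
    ∫ x, toAE μ a x * ψ x ∂μ = ∫ x, a x * ψ x ∂μ :=
  integral_congr_ae ((coeFn_toAE a).mono fun x hx => by simp only [hx])

theorem toAE_injective [μ.IsOpenPosMeasure] :
    Function.Injective (toAE μ : Smooth m M → M →ₘ[μ] ℂ) := fun a b h =>
  DFunLike.coe_injective ((a.contMDiff.continuous.ae_eq_iff_eq μ b.contMDiff.continuous).1
    (AEEqFun.mk_eq_mk.1 h))

variable [CompactSpace M]

theorem integrable_mul_continuous {f : M → ℂ} (hf : Integrable f μ) (φ : C(M, ℂ)) :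
    Integrable (fun x => f x * φ x) μ :=
  hf.mul_bdd (c := ‖φ‖) φ.continuous.aestronglyMeasurable
    (Filter.Eventually.of_forall fun x => φ.norm_coe_le_norm x)

theorem integrable_smooth [IsFiniteMeasure μ] (a : Smooth m M) : Integrable a μ := by
  simpa using integrable_mul_continuous (μ := μ) (integrable_const (1 : ℂ)) a.toC

theorem integrable_toAE [IsFiniteMeasure μ] (a : Smooth m M) : Integrable (toAE μ a) μ :=
  (integrable_smooth a).congr (coeFn_toAE a).symm

theorem integral_add_mul {f g : M →ₘ[μ] ℂ} (hf : Integrable f μ)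
    (hg : Integrable g μ) (φ : C(M, ℂ)) : ∫ x, (f + g : M →ₘ[μ] ℂ) x * φ x ∂μ =
      ∫ x, f x * φ x ∂μ + ∫ x, g x * φ x ∂μ := by
  rw [← integral_add (integrable_mul_continuous hf φ) (integrable_mul_continuous hg φ)]
  refine integral_congr_ae ((AEEqFun.coeFn_add f g).mono fun x hx => ?_)
  simp only [hx, Pi.add_apply, add_mul]

omit [TopologicalSpace M] [BorelSpace M] [CompactSpace M] in
theorem integral_smul_mul (c : ℂ) (f : M →ₘ[μ] ℂ) (φ : M → ℂ) :
    ∫ x, (c • f : M →ₘ[μ] ℂ) x * φ x ∂μ = c * ∫ x, f x * φ x ∂μ := by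
  rw [← integral_const_mul]
  refine integral_congr_ae ((AEEqFun.coeFn_smul c f).mono fun x hx => ?_)
  simp only [hx, Pi.smul_apply, smul_eq_mul, mul_assoc]

omit [BorelSpace M] in
theorem norm_integral_mul_le {f : M → ℂ} (hf : Integrable f μ) (φ : C(M, ℂ)) :
    ‖∫ x, f x * φ x ∂μ‖ ≤ ‖φ‖ * ∫ x, ‖f x‖ ∂μ := by
  rw [← integral_const_mul]
  refine norm_integral_le_of_norm_le (hf.norm.const_mul _) (Filter.Eventually.of_forall fun x => ?_)
  rw [norm_mul, mul_comm]
  exact mul_le_mul_of_nonneg_right (φ.norm_coe_le_norm x) (norm_nonneg _)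

theorem isWeakDeriv_toAE [IsFiniteMeasure μ] (hμ : HasSmoothDivergence m μ) (Y : VF m M)
    (a : Smooth m M) : IsWeakDeriv Y (toAE μ a) (toAE μ (Y a)) := by
  obtain ⟨δ, hδ⟩ := hμ Y
  refine ⟨integrable_toAE _, integrable_toAE _, δ, hδ, fun φ => ?_⟩
  rw [integral_toAE_mul, integral_toAE_mul a fun x => Y φ x + δ x * φ x]
  refine eq_neg_iff_add_eq_zero.2 ?_
  calc ∫ x, (Y a * φ) x ∂μ + ∫ x, (a * (Y φ + δ * φ)) x ∂μ
      = ∫ x, Y (a * φ) x ∂μ + ∫ x, (δ * (a * φ)) x ∂μ := by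
        rw [← integral_add (integrable_smooth _) (integrable_smooth _),
          ← integral_add (integrable_smooth _) (integrable_smooth _)]
        congr 1
        ext x
        simp only [Derivation.leibniz, smul_eq_mul, ContMDiffMap.coe_add, ContMDiffMap.coe_mul,
          Pi.add_apply, Pi.mul_apply]
        ring
    _ = 0 := eq_neg_iff_add_eq_zero.1 (hδ (a * φ))

variable [IsManifold (𝓡 m) ∞ M] [T2Space M]

theorem ae_eq_of_integral_smooth {f g : M → ℂ} (hf : Integrable f μ) (hg : Integrable g μ)
    (h : ∀ φ : Smooth m M, ∫ x, f x * φ x ∂μ = ∫ x, g x * φ x ∂μ) : f =ᵐ[μ] g := by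
  refine ae_eq_of_integral_contMDiff_smul_eq (𝓡 m) hf.locallyIntegrable hg.locallyIntegrable ?_
  intro φ hφ _
  simp only [Complex.real_smul, mul_comm (φ _ : ℂ)]
  exact h ⟨fun x => (φ x : ℂ), Complex.ofRealCLM.contDiff.contMDiff.comp hφ⟩

theorem IsDivergence.eq [IsFiniteMeasure μ] [μ.IsOpenPosMeasure] {Y : VF m M} {δ δ' : Smooth m M}
    (h : IsDivergence μ Y δ) (h' : IsDivergence μ Y δ') : δ = δ' := by
  refine toAE_injective (μ := μ) (AEEqFun.ext ?_)
  refine ae_eq_of_integral_smooth (m := m) (integrable_toAE _) (integrable_toAE _) fun φ => ?_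
  rw [integral_toAE_mul, integral_toAE_mul]
  exact neg_injective ((h φ).symm.trans (h' φ))

theorem IsWeakDeriv.eq [IsFiniteMeasure μ] [μ.IsOpenPosMeasure] {Y : VF m M} {f g g' : M →ₘ[μ] ℂ}
    (h : IsWeakDeriv Y f g) (h' : IsWeakDeriv Y f g') : g = g' := by
  obtain ⟨-, hg, δ, hδ, H⟩ := h
  obtain ⟨-, hg', δ', hδ', H'⟩ := h'
  obtain rfl := hδ.eq hδ'
  exact AEEqFun.ext (ae_eq_of_integral_smooth hg hg' fun φ => by rw [H, H'])

theorem weakDeriv_eq [IsFiniteMeasure μ] [μ.IsOpenPosMeasure] {Y : VF m M} {f g : M →ₘ[μ] ℂ}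
    (h : IsWeakDeriv Y f g) : weakDeriv Y f = g := by
  have hex : ∃ g, IsWeakDeriv Y f g := ⟨g, h⟩
  rw [weakDeriv, dif_pos hex]
  exact hex.choose_spec.eq h

theorem weakDeriv_toAE [IsFiniteMeasure μ] [μ.IsOpenPosMeasure] (hμ : HasSmoothDivergence m μ)
    (Y : VF m M) (a : Smooth m M) : weakDeriv Y (toAE μ a) = toAE μ (Y a) :=
  weakDeriv_eq (isWeakDeriv_toAE hμ Y a)

end SmoothClasses

theorem aeEqFun_mul_add {α β : Type*} [MeasurableSpace α] {μ : Measure α} [TopologicalSpace β]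
    [NonUnitalNonAssocSemiring β] [IsTopologicalSemiring β] (u f f' : α →ₘ[μ] β) :
    u * (f + f') = u * f + u * f' :=
  AEEqFun.induction_on₃ u f f' fun u _ f _ f' _ => by
    simp only [AEEqFun.mk_mul_mk, AEEqFun.mk_add_mk, mul_add]

theorem aeEqFun_mul_smul {α β 𝕜 : Type*} [MeasurableSpace α] {μ : Measure α} [TopologicalSpace β]
    [Mul β] [ContinuousMul β] [SMul 𝕜 β] [ContinuousConstSMul 𝕜 β] [SMulCommClass 𝕜 β β]
    (c : 𝕜) (u f : α →ₘ[μ] β) : u * (c • f) = c • (u * f) :=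
  AEEqFun.induction_on₂ u f fun u _ f _ => by
    simp only [AEEqFun.mk_mul_mk, AEEqFun.smul_mk, mul_smul_comm]

namespace BanachFunctionSpace

variable {M : Type*} [MeasurableSpace M] {μ : Measure M} (B : BanachFunctionSpace μ)

theorem nrm_zero : B.nrm 0 = 0 := by
  have h : (0 : ℂ) • (0 : M →ₘ[μ] ℂ) = 0 := zero_smul ℂ (0 : M →ₘ[μ] ℂ)
  have := B.nrm_smul 0 0 B.carrier.zero_mem
  rwa [h, norm_zero, zero_mul] at this

theorem nrm_neg {f : M →ₘ[μ] ℂ} (hf : f ∈ B.carrier) : B.nrm (-f) = B.nrm f := by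
  have h : (-1 : ℂ) • f = -f := neg_one_smul ℂ f
  have := B.nrm_smul (-1) f hf
  rwa [h, norm_neg, norm_one, one_mul] at this

theorem nrm_nonneg {f : M →ₘ[μ] ℂ} (hf : f ∈ B.carrier) : 0 ≤ B.nrm f := by
  have := B.nrm_add_le f hf (-f) (B.carrier.neg_mem hf)
  rw [add_neg_cancel, B.nrm_zero, B.nrm_neg hf] at this
  linarith

theorem eq_zero_of_nrm {f : M →ₘ[μ] ℂ} (hf : f ∈ B.carrier) (h : B.nrm f = 0) : f = 0 := by
  obtain ⟨C, hC⟩ := B.exists_integral_le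
  have integral_norm : ∫ x, ‖f x‖ ∂μ = 0 := le_antisymm (by simpa only [h, mul_zero] using hC f hf)
    (integral_nonneg fun x => norm_nonneg _)
  rw [integral_eq_zero_iff_of_nonneg (fun x => norm_nonneg _) (B.integrable f hf).norm]
    at integral_norm
  refine AEEqFun.ext ?_
  filter_upwards [integral_norm, AEEqFun.coeFn_zero (β := ℂ) (μ := μ)] with x hx zero_x
  rw [zero_x]
  exact norm_eq_zero.1 hx

theorem nrm_sum_le {ι : Type*} (s : Finset ι) (f : ι → M →ₘ[μ] ℂ) (hf : ∀ i ∈ s, f i ∈ B.carrier) :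
    B.nrm (∑ i ∈ s, f i) ≤ ∑ i ∈ s, B.nrm (f i) := by
  classical
  induction s using Finset.induction_on with
  | empty => simp [B.nrm_zero]
  | insert i s hi ih =>
    rw [Finset.sum_insert hi, Finset.sum_insert hi]
    have hs : ∀ j ∈ s, f j ∈ B.carrier := fun j hj => hf j (Finset.mem_insert_of_mem hj)
    exact (B.nrm_add_le _ (hf i (Finset.mem_insert_self i s)) _ (B.carrier.sum_mem hs)).trans
      (add_le_add_right (ih hs) _)

/-- The carrier as a type, to be normed by `nrm`. -/
def Space : Type _ := B.carrier

instance : AddCommGroup B.Space := inferInstanceAs (AddCommGroup B.carrier)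

instance : Module ℂ B.Space := inferInstanceAs (Module ℂ B.carrier)

/-- The almost everywhere class of an element. -/
def Space.val {B : BanachFunctionSpace μ} : B.Space →ₗ[ℂ] (M →ₘ[μ] ℂ) := B.carrier.subtype

/-- The element of the Banach space given by a class in the carrier. -/
def mkSpace (f : M →ₘ[μ] ℂ) (hf : f ∈ B.carrier) : B.Space := ⟨f, hf⟩

variable {B} in
theorem Space.mem (f : B.Space) : Space.val f ∈ B.carrier := Subtype.property f

variable {B} in
theorem Space.val_injective : Function.Injective (Space.val : B.Space →ₗ[ℂ] (M →ₘ[μ] ℂ)) :=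
  Subtype.val_injective

instance : Norm B.Space := ⟨fun f => B.nrm (Space.val f)⟩

theorem norm_def (f : B.Space) : ‖f‖ = B.nrm (Space.val f) := rfl

theorem core : NormedSpace.Core ℂ B.Space where
  norm_nonneg f := B.nrm_nonneg f.mem
  norm_smul c f := by rw [norm_def, map_smul]; exact B.nrm_smul c _ f.mem
  norm_triangle f g := by rw [norm_def, map_add]; exact B.nrm_add_le _ f.mem _ g.mem
  norm_eq_zero_iff f := by
    constructor
    · intro h
      exact Space.val_injective ((B.eq_zero_of_nrm f.mem h).trans (map_zero _).symm)
    · rintro rfl; rw [norm_def, map_zero, B.nrm_zero]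

instance : NormedAddCommGroup B.Space := NormedAddCommGroup.ofCore B.core

instance : NormedSpace ℂ B.Space := NormedSpace.ofCore B.core

instance : CompleteSpace B.Space := by
  refine Metric.complete_of_cauchySeq_tendsto fun u hu => ?_
  rw [Metric.cauchySeq_iff] at hu
  obtain ⟨f, hf, H⟩ := B.complete (fun i => Space.val (u i)) (fun i => (u i).mem) fun ε hε => by
    obtain ⟨N, hN⟩ := hu ε hε
    refine ⟨N, fun i hi j hj => ?_⟩
    have := hN i hi j hj
    rwa [dist_eq_norm, norm_def, map_sub] at this
  refine ⟨B.mkSpace f hf, Metric.tendsto_atTop.2 fun ε hε => ?_⟩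
  obtain ⟨N, hN⟩ := H ε hε
  refine ⟨N, fun i hi => ?_⟩
  rw [dist_eq_norm, norm_def, map_sub]
  exact hN i hi

variable {B} in
theorem exists_nrm_le {B' : BanachFunctionSpace μ} (T : B.Space →ₗ[ℂ] B'.Space)
    (hT : Continuous T) :
    ∃ C : ℝ, 0 ≤ C ∧ ∀ f : B.Space, B'.nrm (Space.val (T f)) ≤ C * B.nrm (Space.val f) :=
  ⟨‖(⟨T, hT⟩ : B.Space →L[ℂ] B'.Space)‖, norm_nonneg _,
    fun f => (⟨T, hT⟩ : B.Space →L[ℂ] B'.Space).le_opNorm f⟩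

variable [TopologicalSpace M] [BorelSpace M] [CompactSpace M]

/-- Integration against a continuous function. -/
def pair (φ : C(M, ℂ)) : B.Space →L[ℂ] ℂ :=
  LinearMap.mkContinuousOfExistsBound
    { toFun := fun f => ∫ x, Space.val f x * φ x ∂μ
      map_add' := fun f g => integral_add_mul (B.integrable _ f.mem) (B.integrable _ g.mem) φ
      map_smul' := fun c f => integral_smul_mul c (Space.val f) φ } <| by
    obtain ⟨C, hC⟩ := B.exists_integral_le
    refine ⟨‖φ‖ * C, fun f => (norm_integral_mul_le (B.integrable _ f.mem) φ).trans ?_⟩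
    rw [mul_assoc]
    exact mul_le_mul_of_nonneg_left (hC _ f.mem) (norm_nonneg _)

theorem pair_apply (φ : C(M, ℂ)) (f : B.Space) : B.pair φ f = ∫ x, Space.val f x * φ x ∂μ := rfl

/-- The pairing with a fixed element as a functional on continuous functions. -/
def pairLeft (f : B.Space) : C(M, ℂ) →L[ℂ] ℂ :=
  LinearMap.mkContinuous
    { toFun := fun φ => B.pair φ f
      map_add' := fun φ ψ => by
        simp only [pair_apply]
        rw [← integral_add (integrable_mul_continuous (B.integrable _ f.mem) φ)
          (integrable_mul_continuous (B.integrable _ f.mem) ψ)]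
        simp only [ContinuousMap.add_apply, mul_add]
      map_smul' := fun c φ => by
        simp only [pair_apply, RingHom.id_apply, smul_eq_mul]
        rw [← integral_const_mul]
        simp only [ContinuousMap.smul_apply, smul_eq_mul, mul_left_comm] }
    (∫ x, ‖Space.val f x‖ ∂μ) fun φ => by
      rw [mul_comm]
      exact norm_integral_mul_le (B.integrable _ f.mem) φ

variable [T2Space M]

variable {B} in
theorem Space.ext_pair (m : ℕ) [ChartedSpace (EuclideanSpace ℝ (Fin m)) M]
    [IsManifold (𝓡 m) ∞ M] {f g : B.Space}
    (h : ∀ φ : Smooth m M, B.pair φ.toC f = B.pair φ.toC g) : f = g :=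
  Space.val_injective (AEEqFun.ext
    (ae_eq_of_integral_smooth (B.integrable _ f.mem) (B.integrable _ g.mem) h))

theorem continuous_of_pair (m : ℕ) [ChartedSpace (EuclideanSpace ℝ (Fin m)) M]
    [IsManifold (𝓡 m) ∞ M] {E : Type*} [NormedAddCommGroup E] [NormedSpace ℂ E] [CompleteSpace E]
    (T : E →ₗ[ℂ] B.Space) (hT : ∀ φ : Smooth m M, Continuous fun f => B.pair φ.toC (T f)) :
    Continuous T := by
  refine T.continuous_of_seq_closed_graph fun u x y hu hy => Space.ext_pair m fun φ => ?_
  exact tendsto_nhds_unique (((B.pair φ.toC).continuous.tendsto y).comp hy)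
    (((hT φ).tendsto x).comp hu)

end BanachFunctionSpace

section Coordinates

variable {m : ℕ} {M : Type*} [TopologicalSpace M] [ChartedSpace (EuclideanSpace ℝ (Fin m)) M]

/-- The field of covectors `∑ c_j dx_j`. -/
def covectorField (c : Fin m → C(M, ℂ)) : C(M, EuclideanSpace ℝ (Fin m) →L[ℝ] ℂ) :=
  ∑ j, ContinuousMap.comp
    (ContinuousLinearMap.smulRightL ℝ (EuclideanSpace ℝ (Fin m)) ℂ (EuclideanSpace.proj j) :
      C(ℂ, EuclideanSpace ℝ (Fin m) →L[ℝ] ℂ)) (c j)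

omit [ChartedSpace (EuclideanSpace ℝ (Fin m)) M] in
theorem covectorField_apply (c : Fin m → C(M, ℂ)) (x : M) : covectorField c x =
    ∑ j, ContinuousLinearMap.smulRightL ℝ (EuclideanSpace ℝ (Fin m)) ℂ (EuclideanSpace.proj j)
      (c j x) := by
  rw [covectorField, ContinuousMap.sum_apply]
  rfl

omit [ChartedSpace (EuclideanSpace ℝ (Fin m)) M] in
theorem continuous_covectorField :
    Continuous (covectorField : (Fin m → C(M, ℂ)) → C(M, EuclideanSpace ℝ (Fin m) →L[ℝ] ℂ)) :=
  continuous_finsetSum _ fun j _ => (ContinuousMap.continuous_postcomp _).comp (continuous_apply j)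

theorem toC_eq_sum_of_frame {N : ℕ} {X : Fin N → VF m M}
    {ξ : Fin N → VF m M →ₗ[Smooth m M] Smooth m M} (hX : ∀ Y, ∑ i, ξ i Y • X i = Y) (Y : VF m M)
    (a : Smooth m M) : (Y a).toC = ∑ i, (ξ i Y).toC * (X i a).toC := by
  ext x
  conv_lhs => rw [← hX Y]
  rw [VF.sum_apply, Smooth.toC_sum]
  simp

theorem hasFDerivAt_of_tendsto [CompactSpace M] {U : Set (EuclideanSpace ℝ (Fin m))} (hU : IsOpen U)
    {ψ : EuclideanSpace ℝ (Fin m) → M} {a : ℕ → Smooth m M} {c : ℕ → Fin m → C(M, ℂ)}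
    {g : C(M, ℂ)} {c₀ : Fin m → C(M, ℂ)} (ha : Tendsto (fun n => (a n).toC) atTop (𝓝 g))
    (hc : Tendsto c atTop (𝓝 c₀))
    (h : ∀ n, ∀ y ∈ U, HasFDerivAt (a n ∘ ψ) (covectorField (c n) (ψ y)) y) :
    ∀ y ∈ U, HasFDerivAt (g ∘ ψ) (covectorField c₀ (ψ y)) y := by
  have hunif := ContinuousMap.tendsto_iff_tendstoUniformly.1
    ((continuous_covectorField.tendsto c₀).comp hc)
  exact fun y hy => hasFDerivAt_of_tendstoUniformlyOn hU (hunif.comp ψ).tendstoUniformlyOn h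
    (fun y _ => ((continuous_eval_const (F := C(M, ℂ)) (ψ y)).tendsto g).comp ha) hy

variable [IsManifold (𝓡 m) ∞ M]

theorem contDiffOn_comp_symm {n : ℕ∞ω} (hn : n ≤ ∞) {f : M → ℂ}
    (hf : ContMDiff (𝓡 m) 𝓘(ℝ, ℂ) n f) (x₀ : M) :
    ContDiffOn ℝ n (f ∘ (extChartAt (𝓡 m) x₀).symm) (extChartAt (𝓡 m) x₀).target := by
  have : IsManifold (𝓡 m) n M := IsManifold.of_le hn
  rw [← contMDiffOn_iff_contDiffOn]
  exact hf.comp_contMDiffOn (contMDiffOn_extChartAt_symm x₀)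

theorem differentiableAt_comp_symm (a : Smooth m M) {x₀ : M} {y : EuclideanSpace ℝ (Fin m)}
    (hy : y ∈ (extChartAt (𝓡 m) x₀).target) :
    DifferentiableAt ℝ (a ∘ (extChartAt (𝓡 m) x₀).symm) y :=
  ((contDiffOn_comp_symm le_rfl a.contMDiff x₀).contDiffAt
    ((isOpen_extChartAt_target x₀).mem_nhds hy)).differentiableAt (by simp)

variable [T2Space M] {x₀ : M} (χ : SmoothBumpFunction (𝓡 m) x₀) (v : EuclideanSpace ℝ (Fin m))

/-- The derivative `χ ∂_v a`, for a bump function `χ` in a chart and a constant vector `v`. -/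
def coordDeriv (a : Smooth m M) : Smooth m M where
  val x := χ x • fderiv ℝ (a ∘ (extChartAt (𝓡 m) x₀).symm) (extChartAt (𝓡 m) x₀ x) v
  property := χ.contMDiff_smul <| by
    have hd := ((contDiffOn_comp_symm le_rfl a.contMDiff x₀).fderiv_of_isOpen
      (isOpen_extChartAt_target x₀) (m := ∞) (by simp)).clm_apply (contDiffOn_const (c := v))
    rw [← contMDiffOn_iff_contDiffOn] at hd
    refine hd.comp contMDiffOn_extChartAt fun x hx => ?_
    exact (extChartAt (𝓡 m) x₀).map_source (by rwa [extChartAt_source])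

omit [IsManifold (𝓡 m) ∞ M] [T2Space M] in
theorem bump_smul_congr {x : M} {z w : ℂ}
    (h : extChartAt (𝓡 m) x₀ x ∈ (extChartAt (𝓡 m) x₀).target →
      (extChartAt (𝓡 m) x₀).symm (extChartAt (𝓡 m) x₀ x) = x → z = w) : χ x • z = χ x • w := by
  by_cases hx : x ∈ (extChartAt (𝓡 m) x₀).source
  · rw [h ((extChartAt (𝓡 m) x₀).map_source hx) ((extChartAt (𝓡 m) x₀).left_inv hx)]
  · rw [extChartAt_source] at hx
    have hχ : χ x = 0 := by_contra fun hne => hx (χ.support_subset_source hne)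
    rw [hχ, zero_smul, zero_smul]

theorem coordDeriv_add (a b : Smooth m M) :
    coordDeriv χ v (a + b) = coordDeriv χ v a + coordDeriv χ v b := by
  ext x
  refine Eq.trans (bump_smul_congr χ fun hx _ => ?_) (smul_add (χ x) _ _)
  exact congrArg (· v)
    (fderiv_add (differentiableAt_comp_symm a hx) (differentiableAt_comp_symm b hx))

theorem coordDeriv_smul (c : ℝ) (a : Smooth m M) :
    coordDeriv χ v (c • a) = c • coordDeriv χ v a := by
  ext x
  refine Eq.trans (bump_smul_congr χ fun hx _ => ?_) (smul_comm (χ x) c _)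
  exact congrArg (· v) (fderiv_const_smul (differentiableAt_comp_symm a hx) c)

theorem coordDeriv_mul (a b : Smooth m M) :
    coordDeriv χ v (a * b) = a * coordDeriv χ v b + b * coordDeriv χ v a := by
  ext x
  refine Eq.trans (bump_smul_congr χ fun hx hinv => ?_) <| (smul_add (χ x) _ _).trans <|
    congrArg₂ (· + ·) (mul_smul_comm (χ x) (a x) _).symm (mul_smul_comm (χ x) (b x) _).symm
  refine (congrArg (· v)
    (fderiv_mul (differentiableAt_comp_symm a hx) (differentiableAt_comp_symm b hx))).trans ?_
  simp only [add_apply, smul_apply, smul_eq_mul, Function.comp_apply, hinv]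

/-- `coordDeriv χ v` as a derivation, that is, the vector field `χ ∂_v`. -/
def coordVF : VF m M :=
  Derivation.mk'
    { toFun := coordDeriv χ v
      map_add' := coordDeriv_add χ v
      map_smul' := coordDeriv_smul χ v }
    (coordDeriv_mul χ v)

theorem coordVF_apply (a : Smooth m M) (x : M) : coordVF χ v a x =
    χ x • fderiv ℝ (a ∘ (extChartAt (𝓡 m) x₀).symm) (extChartAt (𝓡 m) x₀ x) v := rfl

variable (x₀) in
theorem exists_coordinate_frame : ∃ (U : Set (EuclideanSpace ℝ (Fin m))) (Y : Fin m → VF m M),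
    IsOpen U ∧ extChartAt (𝓡 m) x₀ x₀ ∈ U ∧ U ⊆ (extChartAt (𝓡 m) x₀).target ∧
    ∀ y ∈ U, ∀ a : Smooth m M, HasFDerivAt (a ∘ (extChartAt (𝓡 m) x₀).symm)
      (covectorField (fun j => (Y j a).toC) ((extChartAt (𝓡 m) x₀).symm y)) y := by
  obtain ⟨χ⟩ : Nonempty (SmoothBumpFunction (𝓡 m) x₀) := inferInstance
  have hχ : ∀ᶠ y in 𝓝 (extChartAt (𝓡 m) x₀ x₀), χ ((extChartAt (𝓡 m) x₀).symm y) = 1 := by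
    have hc := (continuousAt_extChartAt_symm (I := 𝓡 m) x₀).tendsto
    rw [extChartAt_to_inv] at hc
    exact hc.eventually χ.eventuallyEq_one
  obtain ⟨U, hU, hUo, hx₀⟩ := eventually_nhds_iff.1 <|
    hχ.and ((isOpen_extChartAt_target x₀).mem_nhds (mem_extChartAt_target x₀))
  refine ⟨U, fun j => coordVF χ (EuclideanSpace.single j 1), hUo, hx₀, fun y hy => (hU y hy).2,
    fun y hy a => ?_⟩
  obtain ⟨hy₁, hyt⟩ := hU y hy
  refine (differentiableAt_comp_symm a hyt).hasFDerivAt.congr_fderiv <|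
    ContinuousLinearMap.coe_injective <|
      (EuclideanSpace.basisFun (Fin m) ℝ).toBasis.ext fun i => ?_
  have hY : ∀ j, (coordVF χ (EuclideanSpace.single j 1) a).toC ((extChartAt (𝓡 m) x₀).symm y) =
      fderiv ℝ (a ∘ (extChartAt (𝓡 m) x₀).symm) y (EuclideanSpace.single j 1) := fun j => by
    rw [Smooth.toC_apply, coordVF_apply, hy₁, one_smul, (extChartAt (𝓡 m) x₀).right_inv hyt]
  simp only [covectorField_apply, hY]
  simp [apply_ite (Complex.ofReal), ite_mul]

/-- The iterated derivative of a smooth function along a word in the fields `X`. -/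
def wordAct {N : ℕ} (X : Fin N → VF m M) : List (Fin N) → Smooth m M → Smooth m M
  | [], a => a
  | i :: w, a => wordAct X w (X i a)

omit [T2Space M] in
theorem contMDiffAt_succ {x₀ : M} {k : ℕ} {g : C(M, ℂ)} {c : Fin m → C(M, ℂ)}
    (hc : ∀ j, ContMDiff (𝓡 m) 𝓘(ℝ, ℂ) k (c j)) {U : Set (EuclideanSpace ℝ (Fin m))}
    (hUo : IsOpen U) (hxU : extChartAt (𝓡 m) x₀ x₀ ∈ U) (hUt : U ⊆ (extChartAt (𝓡 m) x₀).target)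
    (hg : ∀ y ∈ U, HasFDerivAt (g ∘ (extChartAt (𝓡 m) x₀).symm)
      (covectorField c ((extChartAt (𝓡 m) x₀).symm y)) y) :
    ContMDiffAt (𝓡 m) 𝓘(ℝ, ℂ) (k + 1) g x₀ := by
  have hderiv : ContDiffOn ℝ k (fun y => covectorField c ((extChartAt (𝓡 m) x₀).symm y)) U := by
    simp only [covectorField_apply]
    refine ContDiffOn.sum fun j _ => ?_
    exact (ContinuousLinearMap.smulRightL ℝ _ ℂ (EuclideanSpace.proj j)).contDiff.comp_contDiffOn
      ((contDiffOn_comp_symm (by exact_mod_cast le_top) (hc j) x₀).mono hUt)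
  have hsucc : ContDiffOn ℝ (k + 1) (g ∘ (extChartAt (𝓡 m) x₀).symm) U := by
    rw [contDiffOn_succ_iff_fderiv_of_isOpen hUo]
    exact ⟨fun y hy => (hg y hy).differentiableAt.differentiableWithinAt, by simp,
      hderiv.congr fun y hy => (hg y hy).fderiv⟩
  rw [contMDiffAt_iff]
  refine ⟨g.continuous.continuousAt, ?_⟩
  rw [extChartAt_model_space_eq_id]
  exact (hsucc.contDiffAt (hUo.mem_nhds hxU)).contDiffWithinAt

theorem contMDiff_of_tendsto [CompactSpace M] {N : ℕ} {X : Fin N → VF m M}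
    {ξ : Fin N → VF m M →ₗ[Smooth m M] Smooth m M} (hX : ∀ Y, ∑ i, ξ i Y • X i = Y) (k : ℕ)
    (a : ℕ → Smooth m M) (g : List (Fin N) → C(M, ℂ))
    (h : ∀ w : List (Fin N), w.length ≤ k →
      Tendsto (fun n => (wordAct X w (a n)).toC) atTop (𝓝 (g w))) :
    ContMDiff (𝓡 m) 𝓘(ℝ, ℂ) k (g []) := by
  induction k generalizing a g with
  | zero =>
    rw [Nat.cast_zero, contMDiff_zero_iff]
    exact (g []).continuous
  | succ k ih =>
    have hg : ∀ i, ContMDiff (𝓡 m) 𝓘(ℝ, ℂ) k (g [i]) := fun i =>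
      ih (fun n => X i (a n)) (fun w => g (i :: w)) fun w hw => h (i :: w) (by simpa using hw)
    intro x₀
    obtain ⟨U, Y, hUo, hxU, hUt, hY⟩ := exists_coordinate_frame (m := m) x₀
    have hlim : Tendsto (fun n j => (Y j (a n)).toC) atTop
        (𝓝 fun j => ∑ i, (ξ i (Y j)).toC * g [i]) := by
      simp only [toC_eq_sum_of_frame hX (Y _)]
      exact tendsto_pi_nhds.2 fun j => tendsto_finsetSum _ fun i _ =>
        tendsto_const_nhds.mul (h [i] (by simp))
    refine contMDiffAt_succ (fun j => ?_) hUo hxU hUt <|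
      hasFDerivAt_of_tendsto hUo (h [] (by simp)) hlim fun n y hy => hY y hy (a n)
    rw [ContinuousMap.coe_sum]
    exact contMDiff_finsetSum' fun i _ => (contDiff_fst.mul contDiff_snd).contMDiff.comp
      (((ξ i (Y j)).contMDiff.of_le (by exact_mod_cast le_top)).prodMk_space (hg i))

end Coordinates

section CNorm

variable {m : ℕ} {M : Type*} [TopologicalSpace M] [ChartedSpace (EuclideanSpace ℝ (Fin m)) M]
  {N : ℕ} (X : Fin N → VF m M)

theorem cNorm_nonneg (k : ℕ) (a : Smooth m M) : 0 ≤ cNorm X k a := by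
  induction k generalizing a with
  | zero => exact Real.iSup_nonneg fun x => norm_nonneg _
  | succ k ih =>
    exact add_nonneg (Real.iSup_nonneg fun x => norm_nonneg _) (Finset.sum_nonneg fun i _ => ih _)

theorem cNorm_le_succ (k : ℕ) (a : Smooth m M) : cNorm X k a ≤ cNorm X (k + 1) a := by
  induction k generalizing a with
  | zero => exact le_add_of_nonneg_right (Finset.sum_nonneg fun i _ => cNorm_nonneg X 0 _)
  | succ k ih => exact add_le_add le_rfl (Finset.sum_le_sum fun i _ => ih _)

theorem cNorm_mono (a : Smooth m M) : Monotone fun k => cNorm X k a :=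
  monotone_nat_of_le_succ fun k => cNorm_le_succ X k a

theorem cNorm_deriv_le (k : ℕ) (a : Smooth m M) (i : Fin N) :
    cNorm X k (X i a) ≤ cNorm X (k + 1) a := by
  refine le_trans ?_ (le_add_of_nonneg_left (Real.iSup_nonneg fun x => norm_nonneg _))
  exact Finset.single_le_sum (f := fun i => cNorm X k (X i a))
    (fun i _ => cNorm_nonneg X k _) (Finset.mem_univ i)

theorem wordAct_add (w : List (Fin N)) (a b : Smooth m M) :
    wordAct X w (a + b) = wordAct X w a + wordAct X w b := by
  induction w generalizing a b with
  | nil => rfl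
  | cons i w ih => simp only [wordAct, map_add, ih]

theorem wordAct_smul (w : List (Fin N)) (c : ℝ) (a : Smooth m M) :
    wordAct X w (c • a) = c • wordAct X w a := by
  induction w generalizing a with
  | nil => rfl
  | cons i w ih => simp only [wordAct, Derivation.map_smul, ih]

variable [CompactSpace M]

theorem cNorm_zero_eq (a : Smooth m M) : cNorm X 0 a = ‖a.toC‖ :=
  (ContinuousMap.norm_eq_iSup_norm a.toC).symm

theorem cNorm_succ_eq (k : ℕ) (a : Smooth m M) :
    cNorm X (k + 1) a = ‖a.toC‖ + ∑ i, cNorm X k (X i a) :=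
  congrArg (· + ∑ i, cNorm X k (X i a)) (ContinuousMap.norm_eq_iSup_norm a.toC).symm

theorem norm_wordAct_le (k : ℕ) (w : List (Fin N)) (hw : w.length ≤ k) (a : Smooth m M) :
    ‖(wordAct X w a).toC‖ ≤ cNorm X k a := by
  induction w generalizing k a with
  | nil =>
    rw [← cNorm_zero_eq X]
    exact cNorm_mono X a (Nat.zero_le k)
  | cons i w ih =>
    obtain ⟨k, rfl⟩ := Nat.exists_eq_add_of_le' (Nat.one_le_of_lt (List.length_cons ▸ hw))
    exact (ih k (by simpa using hw) (X i a)).trans (cNorm_deriv_le X k a i)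

/-- The words of length at most `k` in `N` letters. -/
abbrev Words (N k : ℕ) : Type := {w : List (Fin N) // w.length ≤ k}

instance (N k : ℕ) : Finite (Words N k) := List.finite_length_le (Fin N) k

instance (N k : ℕ) : Fintype (Words N k) := Fintype.ofFinite _

/-- The `k`-jet of a smooth function with respect to the fields `X`. -/
def jet (k : ℕ) : Smooth m M →ₗ[ℝ] (Words N k → C(M, ℂ)) where
  toFun a w := (wordAct X w a).toC
  map_add' a b := by ext1 w; rw [wordAct_add]; rfl
  map_smul' c a := by ext1 w; rw [wordAct_smul]; rfl

theorem norm_jet_le (k : ℕ) (a : Smooth m M) : ‖jet X k a‖ ≤ cNorm X k a :=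
  (pi_norm_le_iff_of_nonneg (cNorm_nonneg X k a)).2 fun w => norm_wordAct_le X k w w.2 a

/-- The Banach space of limits of `k`-jets of smooth functions. -/
abbrev JetSpace (k : ℕ) : Submodule ℝ (Words N k → C(M, ℂ)) :=
  (LinearMap.range (jet X k)).topologicalClosure

/-- The function underlying a jet. -/
def JetSpace.base {k : ℕ} : JetSpace X k →L[ℝ] C(M, ℂ) :=
  (ContinuousLinearMap.proj (⟨[], Nat.zero_le k⟩ : Words N k)).comp (JetSpace X k).subtypeL

theorem JetSpace.contMDiff_base [IsManifold (𝓡 m) ∞ M] [T2Space M] {X : Fin N → VF m M}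
    {ξ : Fin N → VF m M →ₗ[Smooth m M] Smooth m M} (hX : ∀ Y, ∑ i, ξ i Y • X i = Y) {k : ℕ}
    (e : JetSpace X k) : ContMDiff (𝓡 m) 𝓘(ℝ, ℂ) k (JetSpace.base X e) := by
  classical
  have he : (e : Words N k → C(M, ℂ)) ∈ closure (Set.range (jet X k)) := by
    rw [← LinearMap.coe_range, ← Submodule.topologicalClosure_coe]
    exact e.2
  obtain ⟨u, hu, hlim⟩ := mem_closure_iff_seq_limit.1 he
  choose a ha using hu
  let g : List (Fin N) → C(M, ℂ) := fun w => if h : w.length ≤ k then e.1 ⟨w, h⟩ else 0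
  have hg : g [] = JetSpace.base X e := dif_pos (Nat.zero_le k)
  rw [← hg]
  refine contMDiff_of_tendsto hX k a g fun w hw => ?_
  simp only [g, dif_pos hw]
  exact (tendsto_pi_nhds.1 hlim ⟨w, hw⟩).congr fun n => congrFun (ha n).symm ⟨w, hw⟩

end CNorm

section WeakDerivative

variable {m : ℕ} {M : Type*} [TopologicalSpace M] [ChartedSpace (EuclideanSpace ℝ (Fin m)) M]
  [MeasurableSpace M] [BorelSpace M] {μ : Measure M}

theorem IsWeakDeriv.add [IsManifold (𝓡 m) ∞ M] [CompactSpace M] [T2Space M] [IsFiniteMeasure μ]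
    [μ.IsOpenPosMeasure] {Y : VF m M} {f f' g g' : M →ₘ[μ] ℂ} (h : IsWeakDeriv Y f g)
    (h' : IsWeakDeriv Y f' g') : IsWeakDeriv Y (f + f') (g + g') := by
  obtain ⟨hf, hg, δ, hδ, H⟩ := h
  obtain ⟨hf', hg', δ', hδ', H'⟩ := h'
  obtain rfl := hδ.eq hδ'
  refine ⟨(hf.add hf').congr (AEEqFun.coeFn_add f f').symm,
    (hg.add hg').congr (AEEqFun.coeFn_add g g').symm, δ, hδ, fun φ => ?_⟩
  have hleft := integral_add_mul hg hg' φ.toC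
  have hright := integral_add_mul hf hf' (Y φ + δ * φ).toC
  exact (hleft.trans (congrArg₂ (· + ·) (H φ) (H' φ))).trans <|
    (neg_add _ _).symm.trans (congrArg Neg.neg hright.symm)

omit [BorelSpace M] in
theorem IsWeakDeriv.smul {Y : VF m M} {f g : M →ₘ[μ] ℂ} (h : IsWeakDeriv Y f g) (c : ℂ) :
    IsWeakDeriv Y (c • f) (c • g) := by
  obtain ⟨hf, hg, δ, hδ, H⟩ := h
  refine ⟨(hf.smul c).congr (AEEqFun.coeFn_smul c f).symm,
    (hg.smul c).congr (AEEqFun.coeFn_smul c g).symm, δ, hδ, fun φ => ?_⟩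
  rw [integral_smul_mul, integral_smul_mul, H, mul_neg]

end WeakDerivative

namespace AnisotropicSpaces

variable {m : ℕ} {M : Type*} [TopologicalSpace M] [ChartedSpace (EuclideanSpace ℝ (Fin m)) M]
  [MeasurableSpace M] [BorelSpace M] {μ : Measure M} {d : ℕ} {S : CRStructure m M d}
  (B : AnisotropicSpaces S μ)

open BanachFunctionSpace

variable [IsManifold (𝓡 m) ∞ M] [CompactSpace M] [T2Space M]

theorem exists_incl_bound (l : ℕ) : ∃ C : ℝ, ∀ f ∈ (B.B (l + 1)).carrier,
    (B.B l).nrm f ≤ C * (B.B (l + 1)).nrm f := by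
  let T : (B.B (l + 1)).Space →ₗ[ℂ] (B.B l).Space :=
    { toFun := fun f => (B.B l).mkSpace (Space.val f) (B.antitone_B l f.mem)
      map_add' := fun f g => rfl
      map_smul' := fun c f => rfl }
  obtain ⟨C, -, hT⟩ := exists_nrm_le T
    ((B.B l).continuous_of_pair m T fun φ => ((B.B (l + 1)).pair φ.toC).continuous)
  exact ⟨C, fun f hf => hT (mkSpace _ f hf)⟩

theorem isWeakDeriv_weakDeriv [IsFiniteMeasure μ] [μ.IsOpenPosMeasure] {l : ℕ} {Y : VF m M}
    (hY : Y ∈ S.H ⊔ conjSub S.H) {f : M →ₘ[μ] ℂ} (hf : f ∈ (B.B (l + 1)).carrier) :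
    IsWeakDeriv Y f (weakDeriv Y f) ∧ weakDeriv Y f ∈ (B.B l).carrier := by
  obtain ⟨g, hg, h⟩ := B.exists_weakDeriv l f hf Y hY
  rw [weakDeriv_eq h]
  exact ⟨h, hg⟩

theorem exists_deriv_bound [IsFiniteMeasure μ] [μ.IsOpenPosMeasure] (l : ℕ) {Y : VF m M}
    (hY : Y ∈ S.H ⊔ conjSub S.H) : ∃ C : ℝ, 0 ≤ C ∧ ∀ f ∈ (B.B (l + 1)).carrier,
      (B.B l).nrm (weakDeriv Y f) ≤ C * (B.B (l + 1)).nrm f := by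
  have isWeakDeriv := fun f : (B.B (l + 1)).Space => B.isWeakDeriv_weakDeriv hY f.mem
  let T : (B.B (l + 1)).Space →ₗ[ℂ] (B.B l).Space :=
    { toFun := fun f => (B.B l).mkSpace (weakDeriv Y (Space.val f)) (isWeakDeriv f).2
      map_add' := fun f g =>
        Space.val_injective (weakDeriv_eq ((isWeakDeriv f).1.add (isWeakDeriv g).1))
      map_smul' := fun c f => Space.val_injective (weakDeriv_eq ((isWeakDeriv f).1.smul c)) }
  obtain ⟨-, -, δ, hδ, -⟩ := (isWeakDeriv 0).1
  have pair_weakDeriv (φ : Smooth m M) : (fun f => (B.B l).pair φ.toC (T f)) =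
      fun f => -(B.B (l + 1)).pair (Y φ + δ * φ).toC f := by
    refine funext fun f => ?_
    obtain ⟨-, -, δ', hδ', H⟩ := (isWeakDeriv f).1
    obtain rfl := hδ.eq hδ'
    exact H φ
  obtain ⟨C, hC, hT⟩ := exists_nrm_le T <| (B.B l).continuous_of_pair m T fun φ => by
    rw [pair_weakDeriv φ]
    exact ((B.B (l + 1)).pair _).continuous.neg
  exact ⟨C, hC, fun f hf => hT (mkSpace _ f hf)⟩

/-- Multiplication by a function of class `C^{θ(l)}` on `B^l`. -/
def mulLin (l : ℕ) (g : C(M, ℂ)) (hg : ContMDiff (𝓡 m) 𝓘(ℝ, ℂ) (B.θ l) g) :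
    (B.B l).Space →ₗ[ℂ] (B.B l).Space where
  toFun f := (B.B l).mkSpace (g.toAEEqFun μ * Space.val f) (B.mul_mem l _ f.mem g hg)
  map_add' _ _ := Space.val_injective (aeEqFun_mul_add _ _ _)
  map_smul' c _ := Space.val_injective (aeEqFun_mul_smul c _ _)

omit [IsManifold (𝓡 m) ∞ M] [T2Space M] in
theorem pair_mulLin (l : ℕ) (g : C(M, ℂ)) (hg : ContMDiff (𝓡 m) 𝓘(ℝ, ℂ) (B.θ l) g) (φ : C(M, ℂ))
    (f : (B.B l).Space) : (B.B l).pair φ (B.mulLin l g hg f) = (B.B l).pair (g * φ) f := by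
  refine integral_congr_ae ?_
  filter_upwards [AEEqFun.coeFn_mul (g.toAEEqFun μ) (Space.val f),
    g.coeFn_toAEEqFun μ] with x hx hx'
  change (g.toAEEqFun μ * Space.val f : M →ₘ[μ] ℂ) x * φ x = Space.val f x * (g x * φ x)
  rw [hx, Pi.mul_apply, hx']
  ring

theorem continuous_mulLin (l : ℕ) (g : C(M, ℂ)) (hg : ContMDiff (𝓡 m) 𝓘(ℝ, ℂ) (B.θ l) g) :
    Continuous (B.mulLin l g hg) :=
  (B.B l).continuous_of_pair m _ fun φ => by
    simp only [pair_mulLin]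
    exact ((B.B l).pair _).continuous

variable (F : Frames S) (l : ℕ)

/-- Multiplication by the function underlying a `θ(l)`-jet, on `B^l`. -/
def mulJet (e : JetSpace F.X (B.θ l)) : (B.B l).Space →L[ℂ] (B.B l).Space :=
  ⟨B.mulLin l (JetSpace.base F.X e) (JetSpace.contMDiff_base F.sum_eq e),
    B.continuous_mulLin l _ _⟩

theorem pair_mulJet (e : JetSpace F.X (B.θ l)) (f : (B.B l).Space) (φ : C(M, ℂ)) :
    (B.B l).pair φ (B.mulJet F l e f) = (B.B l).pairLeft f (JetSpace.base F.X e * φ) :=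
  B.pair_mulLin l _ (JetSpace.contMDiff_base F.sum_eq e) _ _

/-- `mulJet` as a linear map in the jet. -/
def mulJetLin : JetSpace F.X (B.θ l) →ₗ[ℝ] ((B.B l).Space →L[ℂ] (B.B l).Space) where
  toFun := B.mulJet F l
  map_add' e e' := ContinuousLinearMap.ext fun f => Space.ext_pair m fun φ => by
    rw [add_apply, map_add, pair_mulJet, pair_mulJet, pair_mulJet, map_add, add_mul, map_add]
  map_smul' c e := ContinuousLinearMap.ext fun f => Space.ext_pair m fun φ => by
    have hc : (B.B l).pair φ.toC ((c • B.mulJet F l e) f) =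
        c • (B.B l).pair φ.toC (B.mulJet F l e f) :=
      ((B.B l).pair φ.toC).map_smul_of_tower c _
    rw [RingHom.id_apply, hc, pair_mulJet, pair_mulJet, map_smul, smul_mul_assoc,
      ((B.B l).pairLeft f).map_smul_of_tower]

theorem continuous_mulJetLin : Continuous (B.mulJetLin F l) := by
  refine (B.mulJetLin F l).continuous_of_seq_closed_graph fun u e T hu hT =>
    ContinuousLinearMap.ext fun f => Space.ext_pair m fun φ => ?_
  have hlim : Tendsto (fun n => (B.B l).pair φ.toC (B.mulJet F l (u n) f)) atTop
      (𝓝 ((B.B l).pair φ.toC (T f))) :=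
    ((B.B l).pair φ.toC).continuous.continuousAt.tendsto.comp
      (((ContinuousLinearMap.apply ℂ (B.B l).Space f).continuous.tendsto T).comp hT)
  have hbase : Tendsto (fun n => (B.B l).pairLeft f (JetSpace.base F.X (u n) * φ.toC)) atTop
      (𝓝 ((B.B l).pairLeft f (JetSpace.base F.X e * φ.toC))) :=
    (((B.B l).pairLeft f).continuous.tendsto _).comp
      ((((JetSpace.base F.X).continuous.tendsto e).comp hu).mul tendsto_const_nhds)
  simp only [pair_mulJet] at hlim
  exact (tendsto_nhds_unique hlim hbase).trans (B.pair_mulJet F l e f φ.toC).symm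

theorem exists_mul_bound : ∃ C : ℝ, 0 ≤ C ∧ ∀ (a : Smooth m M), ∀ f ∈ (B.B l).carrier,
    (B.B l).nrm (a • f) ≤ C * cNorm F.X (B.θ l) a * (B.B l).nrm f := by
  let T : JetSpace F.X (B.θ l) →L[ℝ] ((B.B l).Space →L[ℂ] (B.B l).Space) :=
    ⟨B.mulJetLin F l, B.continuous_mulJetLin F l⟩
  refine ⟨‖T‖, T.opNorm_nonneg, fun a f hf => ?_⟩
  let e : JetSpace F.X (B.θ l) := ⟨jet F.X _ a, Submodule.le_topologicalClosure _ ⟨a, rfl⟩⟩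
  calc (B.B l).nrm (a • f) = ‖T e (mkSpace _ f hf)‖ := rfl
    _ ≤ ‖T e‖ * (B.B l).nrm f := (T e).le_opNorm _
    _ ≤ ‖T‖ * cNorm F.X (B.θ l) a * (B.B l).nrm f := by
      refine mul_le_mul_of_nonneg_right ((T.le_opNorm e).trans ?_) (nrm_nonneg _ hf)
      exact mul_le_mul_of_nonneg_left (norm_jet_le F.X _ a) T.opNorm_nonneg

end AnisotropicSpaces

section NonSmooth

theorem not_contDiffAt_rpow {k : ℕ} {f : ℝ → ℝ} {c : ℝ} (hc : c ≠ 0)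
    (hf : ∀ᶠ t in 𝓝[>] (0 : ℝ), f t = c * t ^ ((k : ℝ) - 1 / 2)) : ¬ContDiffAt ℝ k f 0 := by
  induction k generalizing f c with
  | zero =>
    intro hcont
    have hlim : Tendsto f (𝓝[>] 0) (𝓝 (f 0)) :=
      hcont.continuousAt.tendsto.mono_left nhdsWithin_le_nhds
    have hblowup : Tendsto (fun t => f t / c) (𝓝[>] 0) atTop := by
      refine (tendsto_rpow_neg_nhdsGT_zero (y := -(1 / 2 : ℝ)) (by norm_num)).congr' ?_
      filter_upwards [hf] with t ht
      rw [ht, mul_div_cancel_left₀ _ hc]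
      norm_num
    exact not_tendsto_nhds_of_tendsto_atTop hblowup _ (hlim.div_const c)
  | succ k ih =>
    intro hsmooth
    have hderiv : ContDiffAt ℝ k (deriv f) 0 :=
      (hsmooth.fderiv_right (m := k) (by norm_cast)).clm_apply contDiffAt_const
    refine ih (c := c * ((k : ℝ) + 1 / 2)) (mul_ne_zero hc (by positivity)) ?_ hderiv
    rw [eventually_nhdsWithin_iff] at hf ⊢
    filter_upwards [eventually_eventually_nhds.2 hf] with t ht (htpos : 0 < t)
    have hrpow : f =ᶠ[𝓝 t] fun t => c * t ^ (((k + 1 : ℕ) : ℝ) - 1 / 2) := by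
      filter_upwards [ht, lt_mem_nhds htpos] with s hs hspos using hs hspos
    rw [hrpow.deriv_eq, ((Real.hasDerivAt_rpow_const (Or.inl htpos.ne')).const_mul c).deriv]
    push_cast
    ring_nf

variable {m : ℕ} {M : Type*} [TopologicalSpace M] [ChartedSpace (EuclideanSpace ℝ (Fin m)) M]
  [T2Space M] {x₀ : M} (χ : SmoothBumpFunction (𝓡 m) x₀) (j : Fin m)

/-- The function `h (x_j - x_j(x₀))` of the `j`-th coordinate in a chart, cut off by `χ`. -/
def chartProfile (h : ℝ → ℝ) (x : M) : ℂ :=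
  χ x • ((h (extChartAt (𝓡 m) x₀ x j - extChartAt (𝓡 m) x₀ x₀ j) : ℝ) : ℂ)

variable {h : ℝ → ℝ} {n : ℕ∞ω} [IsManifold (𝓡 m) ∞ M]

theorem contMDiff_chartProfile (hn : n ≤ ∞) (hh : ContDiff ℝ n h) :
    ContMDiff (𝓡 m) 𝓘(ℝ, ℂ) n (chartProfile χ j h) := by
  have : IsManifold (𝓡 m) n M := IsManifold.of_le hn
  have hcoord : ContDiff ℝ n fun y : EuclideanSpace ℝ (Fin m) =>
      ((h (y j - extChartAt (𝓡 m) x₀ x₀ j) : ℝ) : ℂ) :=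
    Complex.ofRealCLM.contDiff.comp <| hh.comp <|
      (EuclideanSpace.proj j : EuclideanSpace ℝ (Fin m) →L[ℝ] ℝ).contDiff.sub contDiff_const
  refine contMDiff_of_tsupport fun x hx => ?_
  have hx' : x ∈ (chartAt (EuclideanSpace ℝ (Fin m)) x₀).source :=
    χ.tsupport_subset_chartAt_source (tsupport_smul_subset_left _ _ hx)
  exact (χ.contMDiffAt.of_le hn).smul <|
    (hcoord.contMDiff.comp_contMDiffOn contMDiffOn_extChartAt _ hx').contMDiffAt
      ((chartAt _ _).open_source.mem_nhds hx')

omit [T2Space M] in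
theorem contDiffAt_of_contMDiff_chartProfile (hn : n ≤ ∞)
    (hh : ContMDiff (𝓡 m) 𝓘(ℝ, ℂ) n (chartProfile χ j h)) : ContDiffAt ℝ n h 0 := by
  set φ := extChartAt (𝓡 m) x₀
  let line : ℝ → EuclideanSpace ℝ (Fin m) := fun t => φ x₀ + t • EuclideanSpace.single j 1
  have hline : ContDiff ℝ n line := contDiff_const.add (contDiff_id.smul contDiff_const)
  have hline₀ : line 0 = φ x₀ := by simp [line]
  have htendsto : Tendsto line (𝓝 0) (𝓝 (φ x₀)) := hline₀ ▸ hline.continuous.tendsto 0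
  have htarget : ∀ᶠ y in 𝓝 (φ x₀), y ∈ φ.target :=
    (isOpen_extChartAt_target x₀).mem_nhds (mem_extChartAt_target x₀)
  have hχ : ∀ᶠ y in 𝓝 (φ x₀), χ (φ.symm y) = 1 := by
    have hc := (continuousAt_extChartAt_symm (I := 𝓡 m) x₀).tendsto
    rw [extChartAt_to_inv] at hc
    exact hc.eventually χ.eventuallyEq_one
  have hsmooth : ContDiffAt ℝ n (fun t => (chartProfile χ j h (φ.symm (line t))).re) 0 := by
    have hchart := (contDiffOn_comp_symm hn hh x₀).contDiffAt (hline₀ ▸ htarget)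
    exact Complex.reCLM.contDiff.contDiffAt.comp 0 (hchart.comp 0 hline.contDiffAt)
  refine hsmooth.congr_of_eventuallyEq ?_
  filter_upwards [htendsto.eventually hχ, htendsto.eventually htarget] with t ht htt
  rw [chartProfile, ht, one_smul, φ.right_inv htt, Complex.ofReal_re]
  simp [line, φ]

variable (M) in
theorem exists_contMDiff_not_smooth [Nonempty M] (hm : 0 < m) (k : ℕ) :
    ∃ g : C(M, ℂ), ContMDiff (𝓡 m) 𝓘(ℝ, ℂ) k g ∧ ¬ContMDiff (𝓡 m) 𝓘(ℝ, ℂ) ∞ g := by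
  obtain ⟨x₀⟩ := ‹Nonempty M›
  obtain ⟨χ⟩ : Nonempty (SmoothBumpFunction (𝓡 m) x₀) := inferInstance
  have hpow : ContDiff ℝ k fun t : ℝ => t ^ (((k + 1 : ℕ) : ℝ) - 1 / 2) :=
    Real.contDiff_rpow_const_of_le (by push_cast; linarith)
  have hg := contMDiff_chartProfile χ ⟨0, hm⟩ (by exact_mod_cast le_top) hpow
  refine ⟨⟨_, hg.continuous⟩, hg, fun hsmooth => ?_⟩
  exact not_contDiffAt_rpow (k := k + 1) one_ne_zero (.of_forall fun t => (one_mul _).symm) <|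
    (contDiffAt_of_contMDiff_chartProfile χ ⟨0, hm⟩ le_rfl hsmooth).of_le
      (by exact_mod_cast le_top)

theorem AnisotropicSpaces.exists_le_θ [MeasurableSpace M] [BorelSpace M] {μ : Measure M} {d : ℕ}
    {S : CRStructure m M d} [Nonempty M] [μ.IsOpenPosMeasure] (B : AnisotropicSpaces S μ)
    (hB : B.InterEqSmooth) (hm : 0 < m) (k : ℕ) : ∃ l, k ≤ B.θ l := by
  by_contra! hlt
  obtain ⟨g, hg, hnot⟩ := exists_contMDiff_not_smooth M hm k
  have hmem : ∀ l, g.toAEEqFun μ ∈ (B.B l).carrier := fun l => by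
    have hmul := B.mul_mem l _ ((hB _).2 ⟨1, rfl⟩ l) g (hg.of_le (by exact_mod_cast (hlt l).le))
    rwa [show toAE μ (1 : Smooth m M) = 1 from rfl, mul_one] at hmul
  obtain ⟨a, ha⟩ := (hB _).1 hmem
  have hga := (g.continuous.ae_eq_iff_eq μ a.contMDiff.continuous).1 (AEEqFun.mk_eq_mk.1 ha)
  exact hnot (hga ▸ a.contMDiff)

end NonSmooth

section Small

variable {m : ℕ} {M : Type*} [TopologicalSpace M] [ChartedSpace (EuclideanSpace ℝ (Fin m)) M]

section CNormAlgebra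

variable [CompactSpace M] {N : ℕ} (X : Fin N → VF m M) (k : ℕ)

theorem cNorm_add_le (a b : Smooth m M) : cNorm X k (a + b) ≤ cNorm X k a + cNorm X k b := by
  have hadd : ∀ a b : Smooth m M, ‖(a + b).toC‖ ≤ ‖a.toC‖ + ‖b.toC‖ := fun a b =>
    norm_add_le a.toC b.toC
  induction k generalizing a b with
  | zero => simpa only [cNorm_zero_eq] using hadd a b
  | succ k ih =>
    simp only [cNorm_succ_eq, map_add]
    refine (add_le_add (hadd a b) (Finset.sum_le_sum fun i _ => ih _ _)).trans ?_
    rw [Finset.sum_add_distrib, add_add_add_comm]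

theorem cNorm_neg (a : Smooth m M) : cNorm X k (-a) = cNorm X k a := by
  have hneg : ∀ a : Smooth m M, ‖(-a).toC‖ = ‖a.toC‖ := fun a => norm_neg a.toC
  induction k generalizing a with
  | zero => rw [cNorm_zero_eq, cNorm_zero_eq, hneg]
  | succ k ih => simp only [cNorm_succ_eq, map_neg, ih, hneg]

theorem cNorm_zero : cNorm X k (0 : Smooth m M) = 0 := by
  have hzero : ‖(0 : Smooth m M).toC‖ = 0 := norm_zero (E := C(M, ℂ))
  induction k with
  | zero => rw [cNorm_zero_eq, hzero]
  | succ k ih => simp only [cNorm_succ_eq, map_zero, ih, hzero, Finset.sum_const_zero, add_zero]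

theorem cNorm_mul_le (a b : Smooth m M) :
    cNorm X k (a * b) ≤ 2 ^ k * (cNorm X k a * cNorm X k b) := by
  have hmul : ∀ a b : Smooth m M, ‖(a * b).toC‖ ≤ ‖a.toC‖ * ‖b.toC‖ := fun a b =>
    norm_mul_le a.toC b.toC
  induction k generalizing a b with
  | zero => simpa only [cNorm_zero_eq, pow_zero, one_mul] using hmul a b
  | succ k ih =>
    have hle : ∀ c : Smooth m M, ‖c.toC‖ ≤ cNorm X (k + 1) c := fun c => by
      rw [← cNorm_zero_eq X]
      exact cNorm_mono X c (Nat.zero_le _)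
    have hleibniz : ∀ i, cNorm X k (X i (a * b)) ≤
        2 ^ k * (cNorm X (k + 1) a * cNorm X k (X i b) +
          cNorm X k (X i a) * cNorm X (k + 1) b) := fun i => by
      rw [Derivation.leibniz, smul_eq_mul, smul_eq_mul, mul_comm b]
      refine (cNorm_add_le X k _ _).trans
        ((add_le_add (ih _ _) (ih _ _)).trans ?_)
      rw [mul_add]
      gcongr
      all_goals first | exact cNorm_le_succ X k _ | exact cNorm_nonneg X k _
    calc cNorm X (k + 1) (a * b)
        ≤ ‖a.toC‖ * ‖b.toC‖ + ∑ i, 2 ^ k * (cNorm X (k + 1) a * cNorm X k (X i b) +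
            cNorm X k (X i a) * cNorm X (k + 1) b) := by
          rw [cNorm_succ_eq]
          exact add_le_add (hmul a b) (Finset.sum_le_sum fun i _ => hleibniz i)
      _ ≤ 2 ^ k * (cNorm X (k + 1) a * ‖b.toC‖ + ‖a.toC‖ * cNorm X (k + 1) b) +
            ∑ i, 2 ^ k * (cNorm X (k + 1) a * cNorm X k (X i b) +
              cNorm X k (X i a) * cNorm X (k + 1) b) := by
          have hsup := mul_le_mul_of_nonneg_right (hle a) (norm_nonneg b.toC)
          have hrest := mul_nonneg (norm_nonneg a.toC) (cNorm_nonneg X (k + 1) b)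
          refine add_le_add_left ((le_add_of_le_of_nonneg hsup hrest).trans ?_) _
          exact le_mul_of_one_le_left ((add_nonneg ((mul_nonneg (norm_nonneg _)
            (norm_nonneg _)).trans hsup) hrest)) (one_le_pow₀ one_le_two)
      _ = 2 ^ k * (cNorm X (k + 1) a * (‖b.toC‖ + ∑ i, cNorm X k (X i b)) +
            (‖a.toC‖ + ∑ i, cNorm X k (X i a)) * cNorm X (k + 1) b) := by
          rw [← Finset.mul_sum, Finset.sum_add_distrib, ← Finset.mul_sum, ← Finset.sum_mul]
          ring
      _ = 2 ^ (k + 1) * (cNorm X (k + 1) a * cNorm X (k + 1) b) := by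
          rw [← cNorm_succ_eq, ← cNorm_succ_eq]
          ring

end CNormAlgebra

section Frames

variable {d : ℕ} {S : CRStructure m M d} (F : Frames S)

theorem Frames.apply_eq (Y : VF m M) (a : Smooth m M) : Y a = ∑ i, F.ξ i Y * F.X i a := by
  conv_lhs => rw [← F.sum_eq Y, VF.sum_apply]
  rfl

theorem Frames.lie_eq (W Y : VF m M) :
    ⁅W, Y⁆ = ∑ i, (F.ξ i Y • ⁅W, F.X i⁆ + W (F.ξ i Y) • F.X i) := by
  conv_lhs => rw [← F.sum_eq Y]
  exact (lie_sum Finset.univ _ W).trans <| Finset.sum_congr rfl fun i _ =>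
    LieRinehartRing.leibniz_smul_right W (F.X i) (F.ξ i Y)

theorem Frames.map_eq {N : Type*} [AddCommGroup N] [Module (Smooth m M) N]
    (f : VF m M →ₗ[Smooth m M] N) (Y : VF m M) : f Y = ∑ i, F.ξ i Y • f (F.X i) := by
  conv_lhs => rw [← F.sum_eq Y, map_sum]
  simp only [map_smul]

theorem Frames.exists_coeff (Z : S.H) : ∃ c : Fin F.N₂ → Smooth m M, ∑ j, c j • F.Z j = Z :=
  (Submodule.mem_span_range_iff_exists_fun _).1 (F.span_eq ▸ Submodule.mem_top)

theorem Frames.cNorm_coeff_le_normΦ (k : ℕ) (Φ : S.H →ₗ[Smooth m M] conjSub S.H) (i : Fin F.N₁)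
    (j : Fin F.N₂) : cNorm F.X k (F.ξ i (Φ (F.Z j))) ≤ F.normΦ k Φ := by
  refine (Finset.single_le_sum (f := fun j => cNorm F.X k (F.ξ i (Φ (F.Z j))))
    (fun j _ => cNorm_nonneg _ _ _) (Finset.mem_univ j)).trans ?_
  exact Finset.single_le_sum (f := fun i => ∑ j, cNorm F.X k (F.ξ i (Φ (F.Z j))))
    (fun i _ => Finset.sum_nonneg fun j _ => cNorm_nonneg _ _ _) (Finset.mem_univ i)

end Frames

variable {ι : Type*} {𝓕 : Filter ι}

/-- A family of smooth functions that tends to zero in all `C^k` norms along a filter. -/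
def Small {N : ℕ} (X : Fin N → VF m M) (𝓕 : Filter ι) (a : ι → Smooth m M) : Prop :=
  ∀ k, Tendsto (fun t => cNorm X k (a t)) 𝓕 (𝓝 0)

section Functions

variable {N : ℕ} {X : Fin N → VF m M} {a b : ι → Smooth m M}

theorem Small.of_le {β : ℕ → ι → ℝ} (hβ : ∀ k, Tendsto (β k) 𝓕 (𝓝 0))
    (h : ∀ k t, cNorm X k (a t) ≤ β k t) : Small X 𝓕 a := fun k =>
  squeeze_zero (fun _ => cNorm_nonneg X k _) (h k) (hβ k)

variable [CompactSpace M]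

theorem Small.add (ha : Small X 𝓕 a) (hb : Small X 𝓕 b) : Small X 𝓕 fun t => a t + b t :=
  .of_le (fun k => by simpa using (ha k).add (hb k)) fun k _ => cNorm_add_le X k _ _

theorem Small.neg (ha : Small X 𝓕 a) : Small X 𝓕 fun t => -a t := fun k => by
  simpa only [cNorm_neg] using ha k

theorem Small.sum {κ : Type*} (s : Finset κ) {a : κ → ι → Smooth m M}
    (h : ∀ i ∈ s, Small X 𝓕 (a i)) : Small X 𝓕 fun t => ∑ i ∈ s, a i t := by
  classical
  induction s using Finset.induction_on with
  | empty => exact fun k => by simp only [Finset.sum_empty, cNorm_zero, tendsto_const_nhds]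
  | insert i s hi ih =>
    rw [Finset.forall_mem_insert] at h
    simpa only [Finset.sum_insert hi] using h.1.add (ih h.2)

theorem Small.mul (ha : Small X 𝓕 a) (hb : Small X 𝓕 b) : Small X 𝓕 fun t => a t * b t :=
  .of_le (fun k => by simpa using ((ha k).mul (hb k)).const_mul (2 ^ k))
    fun k _ => cNorm_mul_le X k _ _

theorem Small.const_mul (ha : Small X 𝓕 a) (c : Smooth m M) : Small X 𝓕 fun t => c * a t :=
  .of_le (fun k => by simpa using ((ha k).const_mul (cNorm X k c)).const_mul (2 ^ k))
    fun k _ => cNorm_mul_le X k _ _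

end Functions

section Fields

variable {d : ℕ} {S : CRStructure m M d} {F : Frames S} {a : ι → Smooth m M} {Y Y' : ι → VF m M}

variable (F) in
/-- A family of vector fields whose coefficients tend to zero in all `C^k` norms. -/
def SmallVF (𝓕 : Filter ι) (Y : ι → VF m M) : Prop := ∀ i, Small F.X 𝓕 fun t => F.ξ i (Y t)

variable [CompactSpace M]

theorem Small.deriv (ha : Small F.X 𝓕 a) (W : VF m M) : Small F.X 𝓕 fun t => W (a t) := by
  have hframe : ∀ i, Small F.X 𝓕 fun t => F.X i (a t) := fun i =>
    .of_le (fun k => ha (k + 1)) fun k _ => cNorm_deriv_le F.X k _ i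
  rw [funext fun t => F.apply_eq W (a t)]
  exact .sum _ fun i _ => (hframe i).const_mul _

theorem SmallVF.add (h : SmallVF F 𝓕 Y) (h' : SmallVF F 𝓕 Y') :
    SmallVF F 𝓕 fun t => Y t + Y' t := fun i => by
  simpa only [map_add] using (h i).add (h' i)

theorem SmallVF.neg (h : SmallVF F 𝓕 Y) : SmallVF F 𝓕 fun t => -Y t := fun i => by
  simpa only [map_neg] using (h i).neg

theorem SmallVF.sub (h : SmallVF F 𝓕 Y) (h' : SmallVF F 𝓕 Y') :
    SmallVF F 𝓕 fun t => Y t - Y' t := by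
  simpa only [sub_eq_add_neg] using h.add h'.neg

theorem SmallVF.sum {κ : Type*} (s : Finset κ) {Y : κ → ι → VF m M}
    (h : ∀ i ∈ s, SmallVF F 𝓕 (Y i)) : SmallVF F 𝓕 fun t => ∑ i ∈ s, Y i t := fun i => by
  simpa only [map_sum] using Small.sum s fun j hj => h j hj i

theorem Small.smul_const (h : Small F.X 𝓕 a) (W : VF m M) : SmallVF F 𝓕 fun t => a t • W :=
  fun i => by simpa only [map_smul, smul_eq_mul, mul_comm] using h.const_mul (F.ξ i W)

theorem Small.smul (h : Small F.X 𝓕 a) (h' : SmallVF F 𝓕 Y) : SmallVF F 𝓕 fun t => a t • Y t :=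
  fun i => by simpa only [map_smul, smul_eq_mul] using h.mul (h' i)

theorem SmallVF.apply (h : SmallVF F 𝓕 Y) (ha : Small F.X 𝓕 a) :
    Small F.X 𝓕 fun t => Y t (a t) := by
  rw [funext fun t => F.apply_eq (Y t) (a t)]
  exact .sum _ fun i _ => (h i).mul (ha.deriv (F.X i))

theorem SmallVF.lie_const (h : SmallVF F 𝓕 Y) (W : VF m M) : SmallVF F 𝓕 fun t => ⁅W, Y t⁆ := by
  rw [funext fun t => F.lie_eq W (Y t)]
  exact .sum _ fun i _ => ((h i).smul_const _).add (((h i).deriv W).smul_const _)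

theorem SmallVF.const_lie (h : SmallVF F 𝓕 Y) (W : VF m M) : SmallVF F 𝓕 fun t => ⁅Y t, W⁆ := by
  simpa only [lie_skew] using (h.lie_const W).neg

theorem SmallVF.lie (h : SmallVF F 𝓕 Y) (h' : SmallVF F 𝓕 Y') :
    SmallVF F 𝓕 fun t => ⁅Y t, Y' t⁆ := by
  rw [funext fun t => F.lie_eq (Y t) (Y' t)]
  exact .sum _ fun i _ => ((h' i).smul (h.const_lie _)).add ((h.apply (h' i)).smul_const _)

variable {Φ : ι → S.H →ₗ[Smooth m M] conjSub S.H}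

theorem smallVF_extΦ (hΦ : ∀ k, Tendsto (fun t => F.normΦ k (Φ t)) 𝓕 (𝓝 0)) (W : VF m M) :
    SmallVF F 𝓕 fun t => extΦ (Φ t) W := by
  obtain ⟨c, hc⟩ := F.exists_coeff (projH S W)
  intro i
  have hcoeff : ∀ t, F.ξ i (extΦ (Φ t) W) = ∑ j, c j * F.ξ i (Φ t (F.Z j)) := fun t => by
    rw [extΦ_apply, ← hc]
    exact (map_sum (F.ξ i ∘ₗ (conjSub S.H).subtype ∘ₗ Φ t) _ _).trans <|
      Finset.sum_congr rfl fun j _ => map_smul (F.ξ i ∘ₗ (conjSub S.H).subtype ∘ₗ Φ t) _ _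
  simp only [hcoeff]
  exact .sum _ fun j _ => .const_mul (.of_le hΦ fun k t => F.cNorm_coeff_le_normΦ k (Φ t) i j) _

theorem SmallVF.extΦ (hΦ : ∀ k, Tendsto (fun t => F.normΦ k (Φ t)) 𝓕 (𝓝 0))
    (h : SmallVF F 𝓕 Y) : SmallVF F 𝓕 fun t => CR.extΦ (Φ t) (Y t) := by
  rw [funext fun t => F.map_eq (CR.extΦ (Φ t)) (Y t)]
  exact .sum _ fun i _ => (h i).smul (smallVF_extΦ hΦ _)

theorem smallVF_brDiff (hΦ : ∀ k, Tendsto (fun t => F.normΦ k (Φ t)) 𝓕 (𝓝 0)) (Z W : VF m M) :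
    SmallVF F 𝓕 fun t => brDiff (autΦ (Φ t)) Z W := by
  rw [funext fun t => brDiff_autΦ (Φ t) Z W]
  have hext : ∀ W, SmallVF F 𝓕 fun t => CR.extΦ (Φ t) W := smallVF_extΦ hΦ
  have hZ := (hext W).lie_const Z
  have hW := (hext Z).const_lie W
  have hZW := (hext Z).lie (hext W)
  exact ((((hext _).sub hZ).sub hW).add hZW).add (((hZW.sub hZ).sub hW).extΦ hΦ)

end Fields

end Small

section Expansion

theorem alternatingMap_sum_smul {R Q N ι κ : Type*} [CommRing R] [AddCommGroup Q] [Module R Q]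
    [AddCommGroup N] [Module R N] [DecidableEq ι] [Fintype ι] [Fintype κ]
    (f : Q [⋀^ι]→ₗ[R] N) (c : ι → κ → R) (v : κ → Q) : f (fun i => ∑ j, c i j • v j)
      = ∑ J : ι → κ, (∏ i, c i (J i)) • f (fun i => v (J i)) := by
  rw [← AlternatingMap.coe_multilinearMap, MultilinearMap.map_sum]
  exact Finset.sum_congr rfl fun J _ => MultilinearMap.map_smul_univ _ _ _

variable {m : ℕ} {M : Type*} [TopologicalSpace M] [ChartedSpace (EuclideanSpace ℝ (Fin m)) M]
  {d : ℕ} {S : CRStructure m M d} {p r : ℕ}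

theorem Form.ev_sum_smul (u : Form S p r (Smooth m M)) {κ₁ κ₂ : Type*} [Fintype κ₁] [Fintype κ₂]
    (c : Fin r → κ₁ → Smooth m M) (Z : κ₁ → S.H) (e : Fin p → κ₂ → Smooth m M) (X : κ₂ → VF m M) :
    u.ev (fun i => ∑ j, c i j • Z j) (fun i => ∑ j, e i j • X j)
      = ∑ J : Fin r → κ₁, ∑ I : Fin p → κ₂, ((∏ i, c i (J i)) * ∏ i, e i (I i)) *
          u.ev (fun i => Z (J i)) (fun i => X (I i)) := by
  rw [Form.ev, alternatingMap_sum_smul, alternatingMap_sum_apply]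
  refine Finset.sum_congr rfl fun J _ => ?_
  simp only [AlternatingMap.smul_apply, map_sum, map_smul]
  rw [alternatingMap_sum_smul, Finset.smul_sum]
  exact Finset.sum_congr rfl fun I _ => smul_smul _ _ _

theorem Form.exists_expansion (F : Frames S) (Z : Fin r → S.H) (X : Fin p → VF m M) :
    ∃ c : (Fin r → Fin F.N₂) → (Fin p → Fin F.N₁) → Smooth m M,
      ∀ u : Form S p r (Smooth m M), u.ev Z X = ∑ J : Fin r → Fin F.N₂, ∑ I : Fin p → Fin F.N₁,
        c J I * u.ev (fun i => F.Z (J i)) (fun i => F.X (I i)) := by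
  choose z hz using fun i => F.exists_coeff (Z i)
  refine ⟨fun J I => (∏ i, z i (J i)) * ∏ i, F.ξ (I i) (X i), fun u => ?_⟩
  rw [← u.ev_sum_smul z F.Z (fun i j => F.ξ j (X i)) F.X]
  simp only [hz, F.sum_eq]

end Expansion

namespace AnisotropicSpaces

variable {m : ℕ} {M : Type*} [TopologicalSpace M] [ChartedSpace (EuclideanSpace ℝ (Fin m)) M]
  [MeasurableSpace M] [BorelSpace M] {μ : Measure M} {d : ℕ} {S : CRStructure m M d}
  {p r : ℕ}

section SmoothNorm

variable (B : AnisotropicSpaces S μ)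

/-- The norm of a smooth function in `B^l`. -/
def smoothNorm (l : ℕ) (a : Smooth m M) : ℝ := (B.B l).nrm (toAE μ a)

/-- The norm of a smooth form in `B^l`. -/
def smoothFormNorm (F : Frames S) (l : ℕ) (u : Form S p r (Smooth m M)) : ℝ :=
  ∑ J : Fin r → Fin F.N₂, ∑ I : Fin p → Fin F.N₁,
    B.smoothNorm l (u.ev (fun i => F.Z (J i)) (fun i => F.X (I i)))

theorem smoothNorm_zero (l : ℕ) : B.smoothNorm l 0 = 0 := by
  rw [smoothNorm, toAE_zero, (B.B l).nrm_zero]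

variable {B} (hB : B.InterEqSmooth)
include hB

theorem InterEqSmooth.mem (l : ℕ) (a : Smooth m M) : toAE μ a ∈ (B.B l).carrier :=
  (hB _).2 ⟨a, rfl⟩ l

theorem smoothNorm_nonneg (l : ℕ) (a : Smooth m M) : 0 ≤ B.smoothNorm l a :=
  (B.B l).nrm_nonneg (hB.mem l a)

theorem smoothNorm_add_le (l : ℕ) (a b : Smooth m M) :
    B.smoothNorm l (a + b) ≤ B.smoothNorm l a + B.smoothNorm l b := by
  rw [smoothNorm, toAE_add]
  exact (B.B l).nrm_add_le _ (hB.mem l a) _ (hB.mem l b)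

theorem smoothNorm_neg (l : ℕ) (a : Smooth m M) : B.smoothNorm l (-a) = B.smoothNorm l a :=
  (congrArg (B.B l).nrm (map_neg (toAELin μ) a)).trans ((B.B l).nrm_neg (hB.mem l a))

theorem smoothNorm_sum_le {ι : Type*} (l : ℕ) (s : Finset ι) (a : ι → Smooth m M) :
    B.smoothNorm l (∑ i ∈ s, a i) ≤ ∑ i ∈ s, B.smoothNorm l (a i) :=
  (congrArg (B.B l).nrm (map_sum (toAELin μ) a s)).trans_le <|
    (B.B l).nrm_sum_le s _ fun i _ => hB.mem l (a i)

theorem eq_zero_of_smoothNorm [μ.IsOpenPosMeasure] {l : ℕ} {a : Smooth m M}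
    (h : B.smoothNorm l a = 0) : a = 0 :=
  toAE_injective (((B.B l).eq_zero_of_nrm (hB.mem l a) h).trans toAE_zero.symm)

variable (F : Frames S)

theorem smoothFormNorm_nonneg (l : ℕ) (u : Form S p r (Smooth m M)) :
    0 ≤ B.smoothFormNorm F l u :=
  Finset.sum_nonneg fun _ _ => Finset.sum_nonneg fun _ _ => smoothNorm_nonneg hB l _

theorem smoothNorm_ev_frame_le (l : ℕ) (u : Form S p r (Smooth m M)) (J : Fin r → Fin F.N₂)
    (I : Fin p → Fin F.N₁) :
    B.smoothNorm l (u.ev (fun i => F.Z (J i)) (fun i => F.X (I i))) ≤ B.smoothFormNorm F l u := by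
  have nonneg (J : Fin r → Fin F.N₂) (I : Fin p → Fin F.N₁) :
      0 ≤ B.smoothNorm l (u.ev (fun i => F.Z (J i)) (fun i => F.X (I i))) :=
    smoothNorm_nonneg hB l _
  exact (Finset.single_le_sum (fun I _ => nonneg J I) (Finset.mem_univ I)).trans <|
    Finset.single_le_sum (f := fun J => ∑ I, B.smoothNorm l (u.ev (F.Z ∘ J) (F.X ∘ I)))
      (fun J _ => Finset.sum_nonneg fun I _ => nonneg J I) (Finset.mem_univ J)

theorem smoothFormNorm_add_le (l : ℕ) (u v : Form S p r (Smooth m M)) :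
    B.smoothFormNorm F l (u + v) ≤ B.smoothFormNorm F l u + B.smoothFormNorm F l v := by
  simp only [smoothFormNorm, ← Finset.sum_add_distrib]
  exact Finset.sum_le_sum fun _ _ => Finset.sum_le_sum fun _ _ => smoothNorm_add_le hB l _ _

theorem smoothFormNorm_neg (l : ℕ) (u : Form S p r (Smooth m M)) :
    B.smoothFormNorm F l (-u) = B.smoothFormNorm F l u :=
  Finset.sum_congr rfl fun _ _ => Finset.sum_congr rfl fun _ _ => smoothNorm_neg hB l _

theorem eq_zero_of_smoothFormNorm [μ.IsOpenPosMeasure] {l : ℕ} {u : Form S p r (Smooth m M)}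
    (h : B.smoothFormNorm F l u ≤ 0) : u = 0 := by
  refine Form.ext_ev fun Z X => ?_
  obtain ⟨c, hc⟩ := Form.exists_expansion F Z X
  rw [hc]
  refine Finset.sum_eq_zero fun J _ => Finset.sum_eq_zero fun I _ => ?_
  have ev_frame : u.ev (fun i => F.Z (J i)) (fun i => F.X (I i)) = 0 :=
    eq_zero_of_smoothNorm hB <| le_antisymm ((smoothNorm_ev_frame_le hB F l u J I).trans h)
      (smoothNorm_nonneg hB l _)
  rw [ev_frame, mul_zero]

variable [IsManifold (𝓡 m) ∞ M] [CompactSpace M] [T2Space M]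

theorem exists_smoothNorm_mul_le (l : ℕ) : ∃ C : ℝ, 0 ≤ C ∧ ∀ a b : Smooth m M,
    B.smoothNorm l (a * b) ≤ C * cNorm F.X (B.θ l) a * B.smoothNorm l b := by
  obtain ⟨C, hC, h⟩ := B.exists_mul_bound F l
  refine ⟨C, hC, fun a b => ?_⟩
  simpa only [smoothNorm, smul_toAE] using h a _ (hB.mem l b)

theorem exists_smoothNorm_ev_le (l : ℕ) (Z : Fin r → S.H) (X : Fin p → VF m M) :
    ∃ C : ℝ, 0 ≤ C ∧ ∀ u : Form S p r (Smooth m M),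
      B.smoothNorm l (u.ev Z X) ≤ C * B.smoothFormNorm F l u := by
  obtain ⟨c, hc⟩ := Form.exists_expansion F Z X
  obtain ⟨C, hC, h⟩ := exists_smoothNorm_mul_le hB F l
  have coeff_nonneg (J I) : 0 ≤ C * cNorm F.X (B.θ l) (c J I) :=
    mul_nonneg hC (cNorm_nonneg _ _ _)
  refine ⟨∑ J, ∑ I, C * cNorm F.X (B.θ l) (c J I),
    Finset.sum_nonneg fun J _ => Finset.sum_nonneg fun I _ => coeff_nonneg J I, fun u => ?_⟩
  rw [hc]
  simp only [Finset.sum_mul]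
  refine (smoothNorm_sum_le hB l _ _).trans <| Finset.sum_le_sum fun J _ =>
    (smoothNorm_sum_le hB l _ _).trans <| Finset.sum_le_sum fun I _ => (h _ _).trans ?_
  exact mul_le_mul_of_nonneg_left (smoothNorm_ev_frame_le hB F l u J I) (coeff_nonneg J I)

theorem exists_smoothNorm_le_succ (l : ℕ) : ∃ C : ℝ, ∀ a : Smooth m M,
    B.smoothNorm l a ≤ C * B.smoothNorm (l + 1) a := by
  obtain ⟨C, h⟩ := B.exists_incl_bound l
  exact ⟨C, fun a => h _ (hB.mem (l + 1) a)⟩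

theorem exists_smoothFormNorm_le_succ (l p r : ℕ) :
    ∃ C : ℝ, ∀ u : Form S p r (Smooth m M),
      B.smoothFormNorm F l u ≤ C * B.smoothFormNorm F (l + 1) u := by
  obtain ⟨C, h⟩ := exists_smoothNorm_le_succ hB l
  refine ⟨C, fun u => ?_⟩
  simp only [smoothFormNorm, Finset.mul_sum]
  exact Finset.sum_le_sum fun _ _ => Finset.sum_le_sum fun _ _ => h _

theorem exists_smoothNorm_ev_le_succ (l : ℕ) (Z : Fin r → S.H) (X : Fin p → VF m M) :
    ∃ C : ℝ, ∀ u : Form S p r (Smooth m M),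
      B.smoothNorm l (u.ev Z X) ≤ C * B.smoothFormNorm F (l + 1) u := by
  obtain ⟨C, hC, h⟩ := exists_smoothNorm_ev_le hB F l Z X
  obtain ⟨C', h'⟩ := exists_smoothFormNorm_le_succ hB F l p r
  refine ⟨C * C', fun u => (h u).trans ?_⟩
  rw [mul_assoc]
  exact mul_le_mul_of_nonneg_left (h' u) hC

variable [IsFiniteMeasure μ] [μ.IsOpenPosMeasure]

theorem exists_smoothNorm_deriv_le (hμ : HasSmoothDivergence m μ) (l : ℕ) {Y : VF m M}
    (hY : Y ∈ S.H ⊔ conjSub S.H) : ∃ C : ℝ, 0 ≤ C ∧ ∀ a : Smooth m M,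
      B.smoothNorm l (Y a) ≤ C * B.smoothNorm (l + 1) a := by
  obtain ⟨C, hC, h⟩ := B.exists_deriv_bound l hY
  refine ⟨C, hC, fun a => ?_⟩
  simpa only [smoothNorm, weakDeriv_toAE hμ] using h _ (hB.mem (l + 1) a)

theorem exists_smoothNorm_deriv_ev_le (hμ : HasSmoothDivergence m μ) (l : ℕ) {Y : VF m M}
    (hY : Y ∈ S.H ⊔ conjSub S.H) (Z : Fin r → S.H) (X : Fin p → VF m M) :
    ∃ C : ℝ, ∀ u : Form S p r (Smooth m M),
      B.smoothNorm l (Y (u.ev Z X)) ≤ C * B.smoothFormNorm F (l + 1) u := by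
  obtain ⟨C, hC, h⟩ := exists_smoothNorm_deriv_le hB hμ l hY
  obtain ⟨C', -, h'⟩ := exists_smoothNorm_ev_le hB F (l + 1) Z X
  refine ⟨C * C', fun u => (h _).trans ?_⟩
  rw [mul_assoc]
  exact mul_le_mul_of_nonneg_left (h' u) hC

end SmoothNorm

section SmallTerms

variable {ι : Type*}

/-- A family of expressions in a form `u` whose `B^l` norms are bounded by the `B^{l+1}` norm of
`u`, with a constant that tends to zero along the filter. -/
def IsSmallTerm (B : AnisotropicSpaces S μ) (F : Frames S) (𝓕 : Filter ι) (l : ℕ)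
    (t : ι → Form S p r (Smooth m M) → Smooth m M) : Prop :=
  ∃ η : ι → ℝ, Tendsto η 𝓕 (𝓝 0) ∧
    ∀ i u, B.smoothNorm l (t i u) ≤ η i * B.smoothFormNorm F (l + 1) u

variable {B : AnisotropicSpaces S μ} (hB : B.InterEqSmooth) {F : Frames S} {𝓕 : Filter ι} {l : ℕ}
  {t t' : ι → Form S p r (Smooth m M) → Smooth m M}

theorem IsSmallTerm.zero : B.IsSmallTerm F 𝓕 l (p := p) (r := r) fun _ _ => 0 :=
  ⟨fun _ => 0, tendsto_const_nhds, fun _ _ => by rw [smoothNorm_zero, zero_mul]⟩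

section Algebra

include hB

theorem IsSmallTerm.add (h : B.IsSmallTerm F 𝓕 l t) (h' : B.IsSmallTerm F 𝓕 l t') :
    B.IsSmallTerm F 𝓕 l fun i u => t i u + t' i u := by
  obtain ⟨η, hη, h⟩ := h
  obtain ⟨η', hη', h'⟩ := h'
  refine ⟨fun i => η i + η' i, by simpa using hη.add hη', fun i u => ?_⟩
  rw [add_mul]
  exact (smoothNorm_add_le hB l _ _).trans (add_le_add (h i u) (h' i u))

theorem IsSmallTerm.neg (h : B.IsSmallTerm F 𝓕 l t) : B.IsSmallTerm F 𝓕 l fun i u => -t i u := by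
  obtain ⟨η, hη, h⟩ := h
  exact ⟨η, hη, fun i u => (smoothNorm_neg hB l _).trans_le (h i u)⟩

theorem IsSmallTerm.sub (h : B.IsSmallTerm F 𝓕 l t) (h' : B.IsSmallTerm F 𝓕 l t') :
    B.IsSmallTerm F 𝓕 l fun i u => t i u - t' i u := by
  simpa only [sub_eq_add_neg] using h.add hB (h'.neg hB)

theorem IsSmallTerm.sum {κ : Type*} (s : Finset κ)
    {t : κ → ι → Form S p r (Smooth m M) → Smooth m M}
    (h : ∀ k ∈ s, B.IsSmallTerm F 𝓕 l (t k)) :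
    B.IsSmallTerm F 𝓕 l fun i u => ∑ k ∈ s, t k i u := by
  classical
  induction s using Finset.induction_on with
  | empty => simpa only [Finset.sum_empty] using .zero
  | insert k s hk ih =>
    rw [Finset.forall_mem_insert] at h
    simpa only [Finset.sum_insert hk] using h.1.add hB (ih h.2)

theorem IsSmallTerm.neg_one_pow_smul (h : B.IsSmallTerm F 𝓕 l t) (k : ℕ) :
    B.IsSmallTerm F 𝓕 l fun i u => (-1 : ℤ) ^ k • t i u := by
  rcases neg_one_pow_eq_or ℤ k with hk | hk
  · simpa only [hk, one_smul] using h
  · simpa only [hk, neg_smul, one_smul] using h.neg hB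

end Algebra

variable [IsManifold (𝓡 m) ∞ M] [CompactSpace M] [T2Space M]

include hB in
theorem isSmallTerm_mul {a : ι → Smooth m M} (ha : Small F.X 𝓕 a)
    {v : Form S p r (Smooth m M) → Smooth m M}
    (hv : ∃ C : ℝ, ∀ u, B.smoothNorm l (v u) ≤ C * B.smoothFormNorm F (l + 1) u) :
    B.IsSmallTerm F 𝓕 l fun i u => a i * v u := by
  obtain ⟨C, hC, h⟩ := exists_smoothNorm_mul_le hB F l
  obtain ⟨C', h'⟩ := hv
  refine ⟨fun i => C * cNorm F.X (B.θ l) (a i) * C', ?_, fun i u => (h _ _).trans ?_⟩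
  · simpa using ((ha (B.θ l)).const_mul C).mul_const C'
  · rw [mul_assoc _ C']
    exact mul_le_mul_of_nonneg_left (h' u) (mul_nonneg hC (cNorm_nonneg _ _ _))

variable {q : ι → Perturbation S}

include hB in
theorem isSmallTerm_brDiff_left (hq : ∀ k, Tendsto (fun i => F.normΦ k (q i).Φ) 𝓕 (𝓝 0))
    (Z V : S.H) (W : Fin r → S.H) (j : Fin r) (X : Fin p → VF m M) :
    B.IsSmallTerm F 𝓕 l fun i u => u.evLeft W X j
      ⟨brDiff (autΦ (q i).Φ) Z V, brDiff_mem _ (q i).map_autΦ Z V⟩ := by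
  have expand (i : ι) (u : Form S p r (Smooth m M)) :
      u.evLeft W X j ⟨brDiff (autΦ (q i).Φ) Z V, brDiff_mem _ (q i).map_autΦ Z V⟩
        = ∑ k, F.ξ k (brDiff (autΦ (q i).Φ) Z V) * u.evLeft W X j (projH S (F.X k)) := by
    rw [← projH_coe S ⟨brDiff (autΦ (q i).Φ) Z V, brDiff_mem _ (q i).map_autΦ Z V⟩]
    exact F.map_eq (u.evLeft W X j ∘ₗ projH S) _
  simp only [expand]
  exact .sum hB _ fun k _ => isSmallTerm_mul hB (smallVF_brDiff hq Z V k)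
    (exists_smoothNorm_ev_le_succ hB F l (Function.update W j (projH S (F.X k))) X)

include hB in
theorem isSmallTerm_brDiff_right {Φ : ι → S.H →ₗ[Smooth m M] conjSub S.H}
    (hΦ : ∀ k, Tendsto (fun i => F.normΦ k (Φ i)) 𝓕 (𝓝 0))
    (Z V : VF m M) (W : Fin r → S.H) (X : Fin p → VF m M) (j : Fin p) :
    B.IsSmallTerm F 𝓕 l fun i u => u.evRight W X j (brDiff (autΦ (Φ i)) Z V) := by
  simp only [fun i (u : Form S p r (Smooth m M)) =>
    F.map_eq (u.evRight W X j) (brDiff (autΦ (Φ i)) Z V)]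
  exact .sum hB _ fun k _ => isSmallTerm_mul hB (smallVF_brDiff hΦ Z V k)
    (exists_smoothNorm_ev_le_succ hB F l W (Function.update X j (F.X k)))

variable [IsFiniteMeasure μ] [μ.IsOpenPosMeasure] (hμ : HasSmoothDivergence m μ)

include hB hμ in
theorem isSmallTerm_autΦ {Φ : ι → S.H →ₗ[Smooth m M] conjSub S.H}
    (hΦ : ∀ k, Tendsto (fun i => F.normΦ k (Φ i)) 𝓕 (𝓝 0))
    (Z : VF m M) (W : Fin r → S.H) (X : Fin p → VF m M) :
    B.IsSmallTerm F 𝓕 l fun i u => (autΦ (Φ i) Z - Z) (u.ev W X) := by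
  -- `projBar` makes the derivatives horizontal, hence bounded from `B^{l+1}` to `B^l`.
  have expand (i : ι) (b : Smooth m M) : (autΦ (Φ i) Z - Z) b
      = -∑ k, F.ξ k (extΦ (Φ i) Z) * (projBar S (F.X k) : VF m M) b := by
    have extΦ_eq : extΦ (Φ i) Z = ∑ k, F.ξ k (extΦ (Φ i) Z) • (projBar S (F.X k) : VF m M) := by
      refine .trans ?_ (F.map_eq ((conjSub S.H).subtype ∘ₗ projBar S) (extΦ (Φ i) Z))
      exact congrArg Subtype.val (projBar_coe S (Φ i (projH S Z))).symm
    rw [autΦ_apply, sub_sub_cancel_left, Derivation.neg_apply]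
    conv_lhs => rw [extΦ_eq, VF.sum_apply]
    rfl
  simp only [expand]
  exact .neg hB <| .sum hB _ fun k _ => isSmallTerm_mul hB (smallVF_extΦ hΦ Z k) <|
    exists_smoothNorm_deriv_ev_le hB F hμ l
      (Submodule.mem_sup_right (S := S.H) (projBar S (F.X k)).2) W X

include hB hμ in
theorem exists_pertOp_bound (hq : ∀ k, Tendsto (fun i => F.normΦ k (q i).Φ) 𝓕 (𝓝 0))
    (l p r : ℕ) : ∃ η : ι → ℝ, Tendsto η 𝓕 (𝓝 0) ∧ ∀ i (u : Form S p r (Smooth m M)),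
      B.smoothFormNorm F l (pertOp (autΦ (q i).Φ) (q i).map_autΦ u)
        ≤ η i * B.smoothFormNorm F (l + 1) u := by
  have isSmallTerm_ev (Z : Fin (r + 1) → S.H) (X : Fin p → VF m M) :
      B.IsSmallTerm F 𝓕 l fun i (u : Form S p r (Smooth m M)) =>
        (pertOp (autΦ (q i).Φ) (q i).map_autΦ u).ev Z X := by
    simp only [pertOp_ev]
    refine .sum hB _ fun i _ => .neg_one_pow_smul hB (.sub hB (.sub hB
      (isSmallTerm_autΦ hB hμ hq _ _ _) (.sum hB _ fun j _ => ?_)) (.sum hB _ fun j _ =>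
        isSmallTerm_brDiff_right hB hq _ _ _ _ _)) _
    split_ifs
    · exact isSmallTerm_brDiff_left hB hq _ _ _ _ _
    · exact .zero
  choose η hη h using fun (J : Fin (r + 1) → Fin F.N₂) (I : Fin p → Fin F.N₁) =>
    isSmallTerm_ev (fun i => F.Z (J i)) (fun i => F.X (I i))
  refine ⟨fun i => ∑ J, ∑ I, η J I i, ?_, fun i u => ?_⟩
  · simpa using tendsto_finsetSum Finset.univ fun J _ => tendsto_finsetSum Finset.univ fun I _ =>
      hη J I
  · simp only [smoothFormNorm, Finset.sum_mul]
    exact Finset.sum_le_sum fun J _ => Finset.sum_le_sum fun I _ => h J I i u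

end SmallTerms

end AnisotropicSpaces

section AlternatingLift

variable {R Q N N' ι : Type*} [CommSemiring R] [AddCommMonoid Q] [Module R Q] [AddCommMonoid N]
  [Module R N] [AddCommMonoid N'] [Module R N']

theorem exists_alternatingMap_lift (T : N →ₗ[R] N') (hT : Function.Injective T)
    (f : Q [⋀^ι]→ₗ[R] N') (h : ∀ v, f v ∈ LinearMap.range T) :
    ∃ g : Q [⋀^ι]→ₗ[R] N, ∀ v, T (g v) = f v :=
  ⟨(LinearEquiv.ofInjective T hT).symm.toLinearMap.compAlternatingMap
    (f.codRestrict (LinearMap.range T) h), fun v =>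
    congrArg Subtype.val ((LinearEquiv.ofInjective T hT).apply_symm_apply ⟨f v, h v⟩)⟩

/-- A notion of limit of sequences in a module for which limits are unique and linear. It allows
to take limits of alternating maps pointwise, without a topology on the module. -/
structure IsLinearLimit (R : Type*) {N : Type*} [CommSemiring R] [AddCommMonoid N] [Module R N]
    (Lim : (ℕ → N) → N → Prop) : Prop where
  unique : ∀ {u x y}, Lim u x → Lim u y → x = y
  add : ∀ {u v x y}, Lim u x → Lim v y → Lim (fun n => u n + v n) (x + y)
  smul : ∀ {u x} (c : R), Lim u x → Lim (fun n => c • u n) (c • x)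
  zero : Lim (fun _ => 0) 0

namespace IsLinearLimit

variable {Lim : (ℕ → N) → N → Prop}

theorem exists_alternatingMap (hL : IsLinearLimit R Lim) (f : ℕ → Q [⋀^ι]→ₗ[R] N)
    (h : ∀ v, ∃ x, Lim (fun n => f n v) x) :
    ∃ g : Q [⋀^ι]→ₗ[R] N, ∀ v, Lim (fun n => f n v) (g v) := by
  choose g hg using h
  exact ⟨{ toFun := g
           map_update_add' := fun v i x y => by
             refine hL.unique (hg _) ?_
             simpa only [AlternatingMap.map_update_add] using
               hL.add (hg (Function.update v i x)) (hg (Function.update v i y))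
           map_update_smul' := fun v i c x => by
             refine hL.unique (hg _) ?_
             simpa only [AlternatingMap.map_update_smul] using
               hL.smul c (hg (Function.update v i x))
           map_eq_zero_of_eq' := fun v i j hv hij => by
             refine hL.unique (hg _) ?_
             simpa only [AlternatingMap.map_eq_zero_of_eq _ v hv hij] using hL.zero }, hg⟩

theorem alternatingMap (hL : IsLinearLimit R Lim) :
    IsLinearLimit R fun (f : ℕ → Q [⋀^ι]→ₗ[R] N) (g : Q [⋀^ι]→ₗ[R] N) =>
      ∀ v, Lim (fun n => f n v) (g v) where
  unique h h' := AlternatingMap.ext fun v => hL.unique (h v) (h' v)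
  add h h' v := hL.add (h v) (h' v)
  smul c h v := hL.smul c (h v)
  zero _ := hL.zero

end IsLinearLimit

end AlternatingLift

/-- Cauchy sequences for a single norm `N`. -/
def IsCauchyFor {E : Type*} [AddCommGroup E] (N : E → ℝ) (g : ℕ → E) : Prop :=
  ∀ ε > 0, ∃ K, ∀ i ≥ K, ∀ j ≥ K, N (g i - g j) < ε

/-- A sequence of group seminorms, the first of which is a norm, for which the group is complete:
the smooth forms with their `B^l` norms are such a Fréchet space. -/
structure IsCompleteNorms {E : Type*} [AddCommGroup E] (N : ℕ → E → ℝ) : Prop where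
  add_le : ∀ l u v, N l (u + v) ≤ N l u + N l v
  neg : ∀ l u, N l (-u) = N l u
  eq_zero : ∀ u, N 0 u ≤ 0 → u = 0
  complete : ∀ g : ℕ → E, (∀ l, IsCauchyFor (N l) g) →
    ∃ u, ∀ l, Tendsto (fun n => N l (g n - u)) atTop (𝓝 0)

/-- The partial sums of the Neumann series of `(1 + T)⁻¹ f`, as fixed point iterates of
`g ↦ f - T g`. -/
def neumannSum {E : Type*} [AddCommGroup E] (T : E →+ E) (f : E) : ℕ → E
  | 0 => 0
  | n + 1 => f - T (neumannSum T f n)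

namespace IsCompleteNorms

variable {E E₀ E₂ : Type*} [AddCommGroup E] [AddCommGroup E₀] [AddCommGroup E₂] {N : ℕ → E → ℝ}

theorem sub_le (hN : IsCompleteNorms N) (l : ℕ) (u v : E) : N l (u - v) ≤ N l u + N l v := by
  rw [sub_eq_add_neg, ← hN.neg l v]
  exact hN.add_le l u _

section Neumann

variable (hN : IsCompleteNorms N) {T : E →+ E}

include hN

theorem neumannSum_le {l : ℕ} (hT : ∀ u, N l (T u) ≤ 1 / 2 * N l u) (f : E) (n : ℕ) :
    N l (neumannSum T f n) ≤ 2 * N l f := by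
  induction n with
  | zero =>
    calc N l (neumannSum T f 0) = N l (f - f) := by rw [sub_self, neumannSum]
      _ ≤ 2 * N l f := (hN.sub_le l f f).trans_eq (two_mul _).symm
  | succ n ih =>
    calc N l (f - T (neumannSum T f n)) ≤ N l f + 1 / 2 * N l (neumannSum T f n) :=
          (hN.sub_le l _ _).trans (add_le_add_right (hT _) _)
      _ ≤ 2 * N l f := by linarith

theorem neumannSum_sub_le {l : ℕ} (hT : ∀ u, N l (T u) ≤ 1 / 2 * N l u) (f : E) (n k : ℕ) :
    N l (neumannSum T f (n + k) - neumannSum T f n) ≤ (1 / 2) ^ n * (2 * N l f) := by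
  induction n with
  | zero => simpa [neumannSum] using hN.neumannSum_le hT f k
  | succ n ih =>
    have sub_succ : neumannSum T f (n + 1 + k) - neumannSum T f (n + 1)
        = -T (neumannSum T f (n + k) - neumannSum T f n) := by
      rw [Nat.add_right_comm, neumannSum, neumannSum, sub_sub_sub_cancel_left, map_sub, neg_sub]
    rw [sub_succ, hN.neg, pow_succ', mul_assoc]
    exact (hT _).trans (mul_le_mul_of_nonneg_left ih (by norm_num))

theorem isCauchyFor_neumannSum {l : ℕ} (hT : ∀ u, N l (T u) ≤ 1 / 2 * N l u) (f : E) :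
    IsCauchyFor (N l) (neumannSum T f) := fun ε hε => by
  have bound_tendsto : Tendsto (fun n : ℕ => (1 / 2 : ℝ) ^ n * (2 * N l f) * 2) atTop (𝓝 0) := by
    simpa using ((tendsto_pow_atTop_nhds_zero_of_lt_one (r := (1 / 2 : ℝ)) (by norm_num)
      (by norm_num)).mul_const (2 * N l f)).mul_const 2
  obtain ⟨K, hK⟩ := (bound_tendsto.eventually_lt_const hε).exists
  refine ⟨K, fun i hi j hj => ?_⟩
  obtain ⟨i, rfl⟩ := Nat.exists_eq_add_of_le hi
  obtain ⟨j, rfl⟩ := Nat.exists_eq_add_of_le hj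
  have triangle := hN.sub_le l (neumannSum T f (K + i) - neumannSum T f K)
    (neumannSum T f (K + j) - neumannSum T f K)
  rw [sub_sub_sub_cancel_right] at triangle
  linarith [hN.neumannSum_sub_le hT f K i, hN.neumannSum_sub_le hT f K j]

theorem exists_add_eq (hT : ∀ l u, N l (T u) ≤ 1 / 2 * N l u) (f : E) : ∃ g, g + T g = f := by
  obtain ⟨g, hg⟩ := hN.complete (neumannSum T f) fun l => hN.isCauchyFor_neumannSum (hT l) f
  refine ⟨g, sub_eq_zero.1 (hN.eq_zero _ ?_)⟩
  have bound_tendsto : Tendsto (fun n => N 0 (neumannSum T f (n + 1) - g)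
      + 1 / 2 * N 0 (neumannSum T f n - g)) atTop (𝓝 (0 + 1 / 2 * 0)) :=
    ((hg 0).comp (tendsto_add_atTop_nat 1)).add ((hg 0).const_mul _)
  refine (ge_of_tendsto' bound_tendsto fun n => ?_).trans_eq (by simp)
  calc N 0 (g + T g - f)
      = N 0 (-(neumannSum T f (n + 1) - g) - T (neumannSum T f n - g)) := by
        rw [neumannSum, map_sub]; congr 1; abel
    _ ≤ N 0 (neumannSum T f (n + 1) - g) + N 0 (T (neumannSum T f n - g)) :=
        (hN.sub_le 0 _ _).trans_eq (by rw [hN.neg])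
    _ ≤ _ := add_le_add_right (hT 0 _) _

end Neumann

theorem exists_primitive_of_close {N₂ : ℕ → E₂ → ℝ} (hN : IsCompleteNorms N)
    (hN₂ : IsCompleteNorms N₂)
    {d₀ D₀ : E₀ →+ E} {d₁ D₁ : E →+ E₂} {A₁ : E →+ E₀} {A₂ : E₂ →+ E}
    (hd : ∀ u, d₁ (d₀ u) = 0) (hD : ∀ u, D₁ (D₀ u) = 0) (H : ∀ u, u = d₀ (A₁ u) + A₂ (d₁ u))
    (h₁ : ∀ l u, N l (D₀ (A₁ u) - d₀ (A₁ u)) ≤ 1 / 2 * N l u)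
    (h₂ : ∀ u, N₂ 0 (D₁ (A₂ u) - d₁ (A₂ u)) ≤ 1 / 2 * N₂ 0 u) {f : E} (hf : D₁ f = 0) :
    ∃ u, D₀ u = f := by
  obtain ⟨g, hg⟩ : ∃ g, g + (D₀ (A₁ g) - d₀ (A₁ g)) = f :=
    hN.exists_add_eq (T := (D₀ - d₀).comp A₁) h₁ f
  have remainder_eq : A₂ (d₁ g) = f - D₀ (A₁ g) := by
    rw [← hg]; nth_rw 2 [H g]; abel
  have remainder_closed : D₁ (A₂ (d₁ g)) = 0 := by
    rw [remainder_eq, map_sub, hD, hf, sub_zero]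
  have d_remainder : d₁ (A₂ (d₁ g)) = d₁ g := by
    conv_rhs => rw [H g, map_add, hd, zero_add]
  have d_eq_zero : d₁ g = 0 := by
    have self_le := h₂ (d₁ g)
    rw [remainder_closed, d_remainder, zero_sub, hN₂.neg] at self_le
    exact hN₂.eq_zero _ (by linarith)
  refine ⟨A₁ g, (sub_eq_zero.1 ?_).symm⟩
  rw [← remainder_eq, d_eq_zero, map_zero]

end IsCompleteNorms

section SmoothForms

variable {m : ℕ} {M : Type*} [TopologicalSpace M] [ChartedSpace (EuclideanSpace ℝ (Fin m)) M]
  [MeasurableSpace M] [BorelSpace M] {μ : Measure M} {d : ℕ} {S : CRStructure m M d} {p r : ℕ}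

/-- Postcomposition of alternating maps with `toAELin`. -/
def toAEAlt (μ : Measure M) (Q : Type*) [AddCommGroup Q] [Module (Smooth m M) Q] (p : ℕ) :
    (Q [⋀^Fin p]→ₗ[Smooth m M] Smooth m M) →ₗ[Smooth m M]
      (Q [⋀^Fin p]→ₗ[Smooth m M] (M →ₘ[μ] ℂ)) where
  toFun w := (toAELin μ).compAlternatingMap w
  map_add' _ _ := AlternatingMap.ext fun _ => toAE_add _ _
  map_smul' _ _ := AlternatingMap.ext fun _ => (smul_toAE _ _).symm

/-- A smooth form as a form whose coefficients are almost everywhere classes. -/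
def Form.toAE (μ : Measure M) (u : Form S p r (Smooth m M)) : Form S p r (M →ₘ[μ] ℂ) :=
  (toAEAlt μ _ p).compAlternatingMap u

theorem Form.toAE_ev (u : Form S p r (Smooth m M)) (Z : Fin r → S.H) (X : Fin p → VF m M) :
    (u.toAE μ).ev Z X = CR.toAE μ (u.ev Z X) := rfl

theorem Form.toAE_add (u v : Form S p r (Smooth m M)) :
    (u + v).toAE μ = u.toAE μ + v.toAE μ :=
  Form.ext_ev fun _ _ => CR.toAE_add _ _

theorem toAEAlt_injective [μ.IsOpenPosMeasure] (Q : Type*) [AddCommGroup Q]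
    [Module (Smooth m M) Q] (p : ℕ) : Function.Injective (toAEAlt (m := m) μ Q p) := fun _ _ h =>
  AlternatingMap.ext fun X => toAE_injective (DFunLike.congr_fun h X)

theorem Form.toAE_injective [μ.IsOpenPosMeasure] :
    Function.Injective (Form.toAE μ : Form S p r (Smooth m M) → _) := fun _ _ h =>
  AlternatingMap.ext fun Z => toAEAlt_injective _ p (DFunLike.congr_fun h Z)

theorem dbar_toAE [CompactSpace M] [IsManifold (𝓡 m) ∞ M] [T2Space M] [IsFiniteMeasure μ]
    [μ.IsOpenPosMeasure] (hμ : HasSmoothDivergence m μ) (u : Form S p r (Smooth m M))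
    (Z : Fin (r + 1) → S.H) (X : Fin p → VF m M) :
    dbar weakDeriv (u.toAE μ) Z X = toAE μ ((dForm u).ev Z X) := by
  rw [dForm_ev]
  change _ = toAELin μ _
  simp only [dbar, map_sum, map_zsmul, map_sub, Form.toAE_ev, weakDeriv_toAE hμ]
  refine Finset.sum_congr rfl fun i _ => ?_
  congr 3
  refine Finset.sum_congr rfl fun j _ => ?_
  split_ifs
  · rfl
  · exact toAE_zero.symm

end SmoothForms

namespace BanachFunctionSpace

variable {M : Type*} [MeasurableSpace M] {μ : Measure M} (E : BanachFunctionSpace μ)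

theorem exists_tendsto {u : ℕ → M →ₘ[μ] ℂ} (hu : ∀ n, u n ∈ E.carrier)
    (h : IsCauchyFor E.nrm u) :
    ∃ f ∈ E.carrier, Tendsto (fun n => E.nrm (u n - f)) atTop (𝓝 0) := by
  obtain ⟨f, hf, H⟩ := E.complete u hu h
  refine ⟨f, hf, Metric.tendsto_atTop.2 fun ε hε => ?_⟩
  obtain ⟨N, hN⟩ := H ε hε
  refine ⟨N, fun n hn => ?_⟩
  rw [Real.dist_eq, sub_zero, abs_of_nonneg (E.nrm_nonneg (E.carrier.sub_mem (hu n) hf))]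
  exact hN n hn

theorem tendsto_unique {u : ℕ → M →ₘ[μ] ℂ} (hu : ∀ n, u n ∈ E.carrier) {f g : M →ₘ[μ] ℂ}
    (hf : f ∈ E.carrier) (hg : g ∈ E.carrier)
    (hf_lim : Tendsto (fun n => E.nrm (u n - f)) atTop (𝓝 0))
    (hg_lim : Tendsto (fun n => E.nrm (u n - g)) atTop (𝓝 0)) : f = g := by
  have hfg := E.carrier.sub_mem hf hg
  refine sub_eq_zero.1 (E.eq_zero_of_nrm hfg (le_antisymm ?_ (E.nrm_nonneg hfg)))
  refine (ge_of_tendsto' (hg_lim.add hf_lim) fun n => ?_).trans_eq (add_zero 0)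
  have hun_f := E.carrier.sub_mem (hu n) hf
  calc E.nrm (f - g) = E.nrm (u n - g + -(u n - f)) := by congr 1; abel
    _ ≤ E.nrm (u n - g) + E.nrm (-(u n - f)) :=
        E.nrm_add_le _ (E.carrier.sub_mem (hu n) hg) _ (E.carrier.neg_mem hun_f)
    _ = E.nrm (u n - g) + E.nrm (u n - f) := by rw [E.nrm_neg hun_f]

end BanachFunctionSpace

namespace AnisotropicSpaces

variable {m : ℕ} {M : Type*} [TopologicalSpace M] [ChartedSpace (EuclideanSpace ℝ (Fin m)) M]
  [MeasurableSpace M] [BorelSpace M] {μ : Measure M} {d : ℕ} {S : CRStructure m M d}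
  {B : AnisotropicSpaces S μ} {p r s : ℕ}

section SmoothHomotopy

variable (hB : B.InterEqSmooth) (F : Frames S)
include hB

theorem toAE_mem_forms (l : ℕ) (u : Form S p r (Smooth m M)) : u.toAE μ ∈ B.forms l p r :=
  fun Z X => hB.mem l (u.ev Z X)

/-- The inclusion of the smooth forms in `B^0_{p,r}`. -/
def smoothIncl (u : Form S p r (Smooth m M)) : B.forms 0 p r :=
  ⟨u.toAE μ, toAE_mem_forms hB 0 u⟩

theorem smoothIncl_add (u v : Form S p r (Smooth m M)) :
    smoothIncl hB (u + v) = smoothIncl hB u + smoothIncl hB v :=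
  Subtype.ext (Form.toAE_add u v)

variable [μ.IsOpenPosMeasure]

theorem exists_toAE_eq {v : Form S p r (M →ₘ[μ] ℂ)} (hv : ∀ l, v ∈ B.forms l p r) :
    ∃ u : Form S p r (Smooth m M), u.toAE μ = v := by
  have mem_range (Z : Fin r → S.H) : v Z ∈ LinearMap.range (toAEAlt (m := m) μ _ p) := by
    obtain ⟨w, hw⟩ := exists_alternatingMap_lift (toAELin μ)
      (fun a b h => toAE_injective h) (v Z) fun X => by
        choose Y hY using fun j => S.H.mkQ_surjective (X j)
        obtain rfl : (fun j => S.H.mkQ (Y j)) = X := funext hY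
        obtain ⟨a, ha⟩ := (hB (v.ev Z Y)).1 fun l => hv l Z Y
        exact ⟨a, ha.symm⟩
    exact ⟨w, AlternatingMap.ext hw⟩
  obtain ⟨u, hu⟩ := exists_alternatingMap_lift (toAEAlt μ _ p) (toAEAlt_injective _ p) v mem_range
  exact ⟨u, AlternatingMap.ext hu⟩

theorem GainsOne.exists_smooth {F : Frames S} {A : B.forms 0 p r →ₗ[ℂ] B.forms 0 p s}
    (hA : B.GainsOne F A) : ∃ A' : Form S p r (Smooth m M) →+ Form S p s (Smooth m M),
      (∀ u, (A' u).toAE μ = (A (smoothIncl hB u)).1) ∧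
      ∀ l, ∃ C : ℝ, ∀ u, B.smoothFormNorm F (l + 1) (A' u) ≤ C * B.smoothFormNorm F l u := by
  choose A' hA' using fun u : Form S p r (Smooth m M) =>
    exists_toAE_eq hB (v := (A (smoothIncl hB u)).1) fun l => by
      cases l with
      | zero => exact (A _).2
      | succ l => exact (hA l).1 _ (toAE_mem_forms hB l u)
  have map_add (u v) : A' (u + v) = A' u + A' v := Form.toAE_injective (μ := μ) <|
    calc (A' (u + v)).toAE μ = (A (smoothIncl hB u) + A (smoothIncl hB v)).1 := by
          rw [hA', smoothIncl_add]
          exact congrArg Subtype.val (A.map_add _ _)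
      _ = (A' u).toAE μ + (A' v).toAE μ := (congrArg₂ (· + ·) (hA' u) (hA' v)).symm
      _ = (A' u + A' v).toAE μ := (Form.toAE_add _ _).symm
  refine ⟨AddMonoidHom.mk' A' map_add, hA', fun l => ?_⟩
  obtain ⟨C, hC⟩ := (hA l).2
  refine ⟨C, fun u => ?_⟩
  have bound := hC (smoothIncl hB u) (toAE_mem_forms hB l u)
  rwa [← hA'] at bound

theorem IsAdapted.exists_smooth_homotopy [CompactSpace M] [IsManifold (𝓡 m) ∞ M] [T2Space M]
    [IsFiniteMeasure μ] {F : Frames S} (ha : B.IsAdapted F (r + 1)) (hμ : HasSmoothDivergence m μ)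
    (hv : CohomologyVanishes S p (r + 1)) :
    ∃ (A₁ : Form S p (r + 1) (Smooth m M) →+ Form S p r (Smooth m M))
      (A₂ : Form S p (r + 2) (Smooth m M) →+ Form S p (r + 1) (Smooth m M)),
      (∀ l, ∃ C : ℝ, ∀ u, B.smoothFormNorm F (l + 1) (A₁ u) ≤ C * B.smoothFormNorm F l u) ∧
      (∀ l, ∃ C : ℝ, ∀ u, B.smoothFormNorm F (l + 1) (A₂ u) ≤ C * B.smoothFormNorm F l u) ∧
      ∀ u, u = dForm (A₁ u) + A₂ (dForm u) := by
  obtain ⟨A₁, A₂, gains₁, gains₂, homotopy⟩ := ha p hv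
  obtain ⟨A₁', toAE_A₁', bound₁⟩ := gains₁.exists_smooth hB
  obtain ⟨A₂', toAE_A₂', bound₂⟩ := gains₂.exists_smooth hB
  refine ⟨A₁', A₂', bound₁, bound₂, fun u => Form.ext_ev fun Z X => toAE_injective (μ := μ) ?_⟩
  have homotopy_ev := homotopy (smoothIncl hB u) (smoothIncl hB (dForm u))
    (toAE_mem_forms hB 1 u) (fun Z X => (dbar_toAE hμ u Z X).symm) Z X
  rw [← toAE_A₁', ← toAE_A₂', dbar_toAE hμ] at homotopy_ev
  exact homotopy_ev.trans (toAE_add _ _).symm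

end SmoothHomotopy

section Completeness

/-- Convergence of a sequence of smooth functions in all the spaces `B^l`. -/
def TendstoSmooth (B : AnisotropicSpaces S μ) (a : ℕ → Smooth m M) (b : Smooth m M) : Prop :=
  ∀ l, Tendsto (fun n => B.smoothNorm l (a n - b)) atTop (𝓝 0)

variable (hB : B.InterEqSmooth) (F : Frames S) [IsManifold (𝓡 m) ∞ M] [CompactSpace M] [T2Space M]

include hB

include F in
theorem isLinearLimit_tendstoSmooth [μ.IsOpenPosMeasure] :
    IsLinearLimit (Smooth m M) B.TendstoSmooth where
  unique {u x y} h h' := toAE_injective <| (B.B 0).tendsto_unique (fun n => hB.mem 0 (u n))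
    (hB.mem 0 x) (hB.mem 0 y) (by simpa only [smoothNorm, toAE_sub] using h 0)
    (by simpa only [smoothNorm, toAE_sub] using h' 0)
  add {u v x y} h h' l := by
    refine squeeze_zero (fun n => smoothNorm_nonneg hB l _) (fun n => ?_)
      (by simpa using (h l).add (h' l))
    rw [add_sub_add_comm]
    exact smoothNorm_add_le hB l _ _
  smul {u x} c h l := by
    obtain ⟨C, -, hC⟩ := exists_smoothNorm_mul_le hB F l
    refine squeeze_zero (fun n => smoothNorm_nonneg hB l _) (fun n => ?_)
      (by simpa using (h l).const_mul (C * cNorm F.X (B.θ l) c))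
    rw [← smul_sub, smul_eq_mul]
    exact hC c _
  zero l := by simp only [sub_zero, smoothNorm_zero, tendsto_const_nhds]

omit hB in
theorem tendsto_nrm_of_succ {l : ℕ} {u : ℕ → M →ₘ[μ] ℂ} (hu : ∀ n, u n ∈ (B.B (l + 1)).carrier)
    {f : M →ₘ[μ] ℂ} (hf : f ∈ (B.B (l + 1)).carrier)
    (h : Tendsto (fun n => (B.B (l + 1)).nrm (u n - f)) atTop (𝓝 0)) :
    Tendsto (fun n => (B.B l).nrm (u n - f)) atTop (𝓝 0) := by
  obtain ⟨C, hC⟩ := B.exists_incl_bound l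
  have mem (n : ℕ) := (B.B (l + 1)).carrier.sub_mem (hu n) hf
  exact squeeze_zero (fun n => (B.B l).nrm_nonneg (B.antitone_B l (mem n)))
    (fun n => hC _ (mem n)) (by simpa using h.const_mul C)

theorem exists_tendstoSmooth {a : ℕ → Smooth m M} (h : ∀ l, IsCauchyFor (B.smoothNorm l) a) :
    ∃ b, B.TendstoSmooth a b := by
  choose f hf hlim using fun l => (B.B l).exists_tendsto (fun n => hB.mem l (a n))
    (by simpa only [IsCauchyFor, smoothNorm, toAE_sub] using h l)
  have f_succ (l : ℕ) : f (l + 1) = f l :=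
    (B.B l).tendsto_unique (fun n => hB.mem l (a n)) (B.antitone_B l (hf (l + 1))) (hf l)
      (tendsto_nrm_of_succ (fun n => hB.mem (l + 1) (a n)) (hf (l + 1)) (hlim (l + 1))) (hlim l)
  have f_const (l : ℕ) : f l = f 0 := by
    induction l with
    | zero => rfl
    | succ l ih => rw [f_succ, ih]
  obtain ⟨b, hb⟩ := (hB (f 0)).1 fun l => f_const l ▸ hf l
  refine ⟨b, fun l => ?_⟩
  simpa only [f_const l, hb, ← toAE_sub] using! hlim l

variable [μ.IsOpenPosMeasure]

theorem exists_tendsto_smoothForm {g : ℕ → Form S p r (Smooth m M)}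
    (h : ∀ l, IsCauchyFor (B.smoothFormNorm F l) g) :
    ∃ u, ∀ l, Tendsto (fun n => B.smoothFormNorm F l (g n - u)) atTop (𝓝 0) := by
  have hL := isLinearLimit_tendstoSmooth hB F
  have exists_limit (Z : Fin r → S.H) (X : Fin p → VF m M ⧸ S.H) :
      ∃ b, B.TendstoSmooth (fun n => g n Z X) b := by
    choose Y hY using fun j => S.H.mkQ_surjective (X j)
    obtain rfl : (fun j => S.H.mkQ (Y j)) = X := funext hY
    refine exists_tendstoSmooth hB fun l ε hε => ?_
    obtain ⟨C, hC, ev_le⟩ := exists_smoothNorm_ev_le hB F l Z Y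
    obtain ⟨N, hN⟩ := h l (ε / (C + 1)) (by positivity)
    refine ⟨N, fun i hi j hj => ?_⟩
    calc B.smoothNorm l ((g i - g j).ev Z Y) ≤ C * B.smoothFormNorm F l (g i - g j) := ev_le _
      _ ≤ C * (ε / (C + 1)) := mul_le_mul_of_nonneg_left (hN i hi j hj).le hC
      _ < ε := by rw [← mul_div_assoc, div_lt_iff₀ (by positivity)]; linarith
  obtain ⟨u, hu⟩ := (hL.alternatingMap (ι := Fin p) (Q := VF m M ⧸ S.H)).exists_alternatingMap g
    fun Z => hL.exists_alternatingMap (fun n => g n Z) (exists_limit Z)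
  refine ⟨u, fun l => ?_⟩
  simpa only [Finset.sum_const_zero] using! tendsto_finsetSum Finset.univ
    fun (J : Fin r → Fin F.N₂) _ => tendsto_finsetSum Finset.univ fun (I : Fin p → Fin F.N₁) _ =>
      hu (fun i => F.Z (J i)) (fun i => S.H.mkQ (F.X (I i))) l

theorem isCompleteNorms_smoothFormNorm :
    IsCompleteNorms fun l (u : Form S p r (Smooth m M)) => B.smoothFormNorm F l u where
  add_le := smoothFormNorm_add_le hB F
  neg := smoothFormNorm_neg hB F
  eq_zero _ h := eq_zero_of_smoothFormNorm hB F h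
  complete _ h := exists_tendsto_smoothForm hB F h

theorem cohomologyVanishes_of_homotopy
    {A₁ : Form S p (r + 1) (Smooth m M) →+ Form S p r (Smooth m M)}
    {A₂ : Form S p (r + 2) (Smooth m M) →+ Form S p (r + 1) (Smooth m M)}
    (H : ∀ u, u = dForm (A₁ u) + A₂ (dForm u)) {S' : CRStructure m M d}
    (ψ : VF m M ≃ₗ[Smooth m M] VF m M)
    (hψ : S.H.map (ψ : VF m M →ₗ[Smooth m M] VF m M) = S'.H)
    (h₁ : ∀ l u, B.smoothFormNorm F l (pertOp ψ hψ (A₁ u)) ≤ 1 / 2 * B.smoothFormNorm F l u)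
    (h₂ : ∀ u, B.smoothFormNorm F 0 (pertOp ψ hψ (A₂ u)) ≤ 1 / 2 * B.smoothFormNorm F 0 u) :
    CohomologyVanishes S' p (r + 1) :=
  cohomologyVanishes_of_pulledD ψ hψ fun _ hf =>
    (isCompleteNorms_smoothFormNorm hB F).exists_primitive_of_close
      (isCompleteNorms_smoothFormNorm hB F) dForm_dForm (pulledD_pulledD ψ hψ) H h₁ h₂ hf

end Completeness

end AnisotropicSpaces

section NormFilter

variable {X : Type*} {N : ℕ → X → ℝ}

/-- The coarsest filter along which all the functions `N l` tend to `0`: the neighbourhoods of the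
origin when the `N l` are seminorms. -/
def normFilter (N : ℕ → X → ℝ) : Filter X := ⨅ l, comap (N l) (𝓝 0)

theorem tendsto_normFilter (N : ℕ → X → ℝ) (l : ℕ) : Tendsto (N l) (normFilter N) (𝓝 0) :=
  tendsto_iff_comap.2 (iInf_le _ l)

theorem exists_lt_imp_of_eventually_normFilter (h0 : ∀ l x, 0 ≤ N l x) (hN : Monotone N)
    {good : X → Prop} (h : ∀ᶠ x in normFilter N, good x) :
    ∃ l, ∃ ε > 0, ∀ x, N l x < ε → good x := by
  have comap_mono {i k : ℕ} (hik : i ≤ k) : comap (N k) (𝓝 0) ≤ comap (N i) (𝓝 0) :=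
    tendsto_iff_comap.1 (squeeze_zero (h0 i) (hN hik) tendsto_comap)
  rw [normFilter, Filter.Eventually, mem_iInf_of_directed fun i j =>
    ⟨max i j, comap_mono (le_max_left i j), comap_mono (le_max_right i j)⟩] at h
  obtain ⟨l, V, hV, hVgood⟩ := h
  obtain ⟨ε, hε, ball_subset⟩ := Metric.mem_nhds_iff.1 hV
  refine ⟨l, ε, hε, fun x hx => hVgood (ball_subset ?_)⟩
  rwa [Metric.mem_ball, Real.dist_eq, sub_zero, abs_of_nonneg (h0 l x)]

theorem exists_delta_of_eventually_normFilter (h0 : ∀ l x, 0 ≤ N l x) (hN : Monotone N)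
    {ι : Type*} [Countable ι] {good : ι → X → Prop} (h : ∀ i, ∀ᶠ x in normFilter N, good i x) :
    ∃ δ : ℕ → ℝ, (∀ l, 0 < δ l) ∧ ∀ x, (∀ l, N l x < δ l) → ∀ i, good i x := by
  choose L ε hε good_of_lt using fun i =>
    exists_lt_imp_of_eventually_normFilter h0 hN (h i)
  rcases isEmpty_or_nonempty ι with hι | hι
  · exact ⟨fun _ => 1, fun _ => one_pos, fun _ _ i => isEmptyElim i⟩
  obtain ⟨e, he⟩ := exists_surjective_nat ι
  refine ⟨fun l => (Finset.range (l + 1)).inf' Finset.nonempty_range_add_one (ε ∘ e),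
    fun l => (Finset.lt_inf'_iff _).2 fun j _ => hε (e j), fun x hx => he.forall.2 fun j => ?_⟩
  -- The condition with index `e j` is imposed by every `δ l` with `j ≤ l`.
  refine good_of_lt (e j) x <| (hN (le_max_left (L (e j)) j) x).trans_lt <|
    (Finset.lt_inf'_iff _).1 (hx _) j ?_
  exact Finset.mem_range.2 (Nat.lt_succ_of_le (le_max_right _ _))

end NormFilter

section Perturbations

variable {m : ℕ} {M : Type*} [TopologicalSpace M] [ChartedSpace (EuclideanSpace ℝ (Fin m)) M]
  {d : ℕ} {S : CRStructure m M d}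

theorem Frames.normΦ_nonneg (F : Frames S) (k : ℕ) (Φ : S.H →ₗ[Smooth m M] conjSub S.H) :
    0 ≤ F.normΦ k Φ :=
  Finset.sum_nonneg fun _ _ => Finset.sum_nonneg fun _ _ => cNorm_nonneg _ _ _

theorem Frames.normΦ_mono (F : Frames S) : Monotone F.normΦ := fun _ _ h _ =>
  Finset.sum_le_sum fun _ _ => Finset.sum_le_sum fun _ _ => cNorm_mono _ _ h

theorem cohomologyVanishes_of_isEmpty [IsEmpty M] (S : CRStructure m M d) (p r : ℕ) :
    CohomologyVanishes S p (r + 1) := fun _ _ =>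
  ⟨0, fun _ _ => ContMDiffMap.ext fun x => isEmptyElim x⟩

end Perturbations

namespace AnisotropicSpaces

variable {m : ℕ} {M : Type*} [TopologicalSpace M] [ChartedSpace (EuclideanSpace ℝ (Fin m)) M]
  [MeasurableSpace M] [BorelSpace M] {μ : Measure M} {d : ℕ} {S : CRStructure m M d}
  {B : AnisotropicSpaces S μ} {F : Frames S} {p r s : ℕ}
  [IsManifold (𝓡 m) ∞ M] [CompactSpace M] [T2Space M] [IsFiniteMeasure μ] [μ.IsOpenPosMeasure]
  (hB : B.InterEqSmooth) (hμ : HasSmoothDivergence m μ)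

include hB hμ

section Filter

variable {𝓕 : Filter (Perturbation S)} (h𝓕 : ∀ k, Tendsto (fun q => F.normΦ k q.Φ) 𝓕 (𝓝 0))

include h𝓕

theorem eventually_pertOp_comp_le {A : Form S p s (Smooth m M) →+ Form S p r (Smooth m M)} {l : ℕ}
    (hA : ∃ C : ℝ, ∀ u, B.smoothFormNorm F (l + 1) (A u) ≤ C * B.smoothFormNorm F l u) :
    ∀ᶠ q in 𝓕, ∀ u, B.smoothFormNorm F l (pertOp (autΦ q.Φ) q.map_autΦ (A u))
      ≤ 1 / 2 * B.smoothFormNorm F l u := by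
  obtain ⟨η, hη, pertOp_le⟩ := exists_pertOp_bound (q := id) hB hμ h𝓕 l p r
  obtain ⟨C, hC⟩ := hA
  have product_tendsto : Tendsto (fun q => |η q| * C) 𝓕 (𝓝 0) := by
    simpa using hη.abs.mul_const C
  filter_upwards [product_tendsto.eventually_le_const one_half_pos] with q hq u
  calc B.smoothFormNorm F l (pertOp (autΦ q.Φ) q.map_autΦ (A u))
      ≤ |η q| * B.smoothFormNorm F (l + 1) (A u) := (pertOp_le q _).trans <|
        mul_le_mul_of_nonneg_right (le_abs_self _) (smoothFormNorm_nonneg hB F _ _)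
    _ ≤ |η q| * C * B.smoothFormNorm F l u := by
        rw [mul_assoc]
        exact mul_le_mul_of_nonneg_left (hC u) (abs_nonneg _)
    _ ≤ 1 / 2 * B.smoothFormNorm F l u :=
        mul_le_mul_of_nonneg_right hq (smoothFormNorm_nonneg hB F _ _)

theorem IsAdapted.exists_eventually_cohomologyVanishes (ha : B.IsAdapted F (r + 1))
    (hv : CohomologyVanishes S p (r + 1)) :
    ∃ good : ℕ → Perturbation S → Prop, (∀ l, ∀ᶠ q in 𝓕, good l q) ∧
      ∀ q, (∀ l, good l q) → CohomologyVanishes q.toCRStructure p (r + 1) := by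
  obtain ⟨A₁, A₂, bound₁, bound₂, homotopy⟩ := ha.exists_smooth_homotopy hB hμ hv
  exact ⟨_, fun l => (eventually_pertOp_comp_le hB hμ h𝓕 (bound₁ l)).and
    (eventually_pertOp_comp_le hB hμ h𝓕 (bound₂ 0)), fun q hq =>
    cohomologyVanishes_of_homotopy hB F homotopy (autΦ q.Φ) q.map_autΦ
      (fun l => (hq l).1) (hq 0).2⟩

end Filter

end AnisotropicSpaces

end CR

end

open CR Filter Topology in
theorem corollary3p3_general {m : ℕ} (hm : 0 < m) {M : Type*} [TopologicalSpace M]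
    [ChartedSpace (EuclideanSpace ℝ (Fin m)) M] [IsManifold (𝓡 m) ∞ M] [CompactSpace M] [T2Space M]
    [MeasurableSpace M] [BorelSpace M] {μ : Measure M} [IsFiniteMeasure μ] [μ.IsOpenPosMeasure]
    (hμ : HasSmoothDivergence m μ) {d : ℕ} {S : CRStructure m M d} (F : Frames S)
    {B : AnisotropicSpaces S μ} (hB : B.InterEqSmooth) :
    ∃ δ : ℕ → ℝ, (∀ l, 0 < δ l) ∧
      ∀ (Φ : S.H →ₗ[Smooth m M] conjSub S.H) (S' : CRStructure m M d), S'.H = graph S Φ →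
        (∀ l, F.normΦ (B.θ l) Φ < δ l) → ∀ p r, 1 ≤ r → B.IsAdapted F r →
          CohomologyVanishes S p r → CohomologyVanishes S' p r := by
  rcases isEmpty_or_nonempty M with hM | hM
  · refine ⟨fun _ => 1, fun _ => one_pos, fun _ S' _ _ p r hr _ _ => ?_⟩
    exact Nat.sub_add_cancel hr ▸ cohomologyVanishes_of_isEmpty S' p (r - 1)
  let N : ℕ → Perturbation S → ℝ := fun l q => F.normΦ (B.θ l) q.Φ
  have normΦ_tendsto (k : ℕ) :
      Tendsto (fun q : Perturbation S => F.normΦ k q.Φ) (normFilter N) (𝓝 0) := by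
    obtain ⟨l, hl⟩ := B.exists_le_θ hB hm k
    exact squeeze_zero (fun q => F.normΦ_nonneg k q.Φ) (fun q => F.normΦ_mono hl q.Φ)
      (tendsto_normFilter N l)
  choose good eventually_good vanishes using
    fun i : {i : ℕ × ℕ // B.IsAdapted F (i.2 + 1) ∧ CohomologyVanishes S i.1 (i.2 + 1)} =>
      i.2.1.exists_eventually_cohomologyVanishes hB hμ normΦ_tendsto i.2.2
  obtain ⟨δ, hδ, good_of_lt⟩ := exists_delta_of_eventually_normFilter (N := N)
    (fun l q => F.normΦ_nonneg _ q.Φ) (fun l l' h q => F.normΦ_mono (B.monotone_θ h) q.Φ)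
    (good := fun i : _ × ℕ => good i.1 i.2) fun i => eventually_good i.1 i.2
  refine ⟨δ, hδ, fun Φ S' hS' hΦ p r hr ha hv => ?_⟩
  obtain ⟨r, rfl⟩ := Nat.exists_eq_add_of_le' hr
  exact vanishes ⟨(p, r), ha, hv⟩ ⟨Φ, S', hS'⟩ fun l =>
    good_of_lt ⟨Φ, S', hS'⟩ hΦ (⟨(p, r), ha, hv⟩, l)

theorem corollary3p3 (n k : ℕ) {M : Type*} [TopologicalSpace M]
    [ChartedSpace (EuclideanSpace ℝ (Fin (2 * n - k))) M]
    [IsManifold (𝓡 (2 * n - k)) ∞ M] [CompactSpace M] [T2Space M]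
    [MeasurableSpace M] [BorelSpace M]
    (μ : Measure M) [IsFiniteMeasure μ] [μ.IsOpenPosMeasure]
    (hμ : CR.HasSmoothDivergence (2 * n - k) μ)
    (S : CR.CRStructure (2 * n - k) M (n - k)) (F : CR.Frames S)
    (B : CR.AnisotropicSpaces S μ) (hB : B.InterEqSmooth)
    (q : ℕ) (hq : 1 ≤ q) (hqn : 2 * q ≤ n - k) (s₁ s₂ : ℕ → ℕ) :
    ∃ δ : ℕ → ℝ, (∀ l, 0 < δ l) ∧
      ∀ (Φ : S.H →ₗ[CR.Smooth (2 * n - k) M] CR.conjSub S.H)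
        (S' : CR.CRStructure (2 * n - k) M (n - k)), S'.H = CR.graph S Φ →
        (∀ l, F.normΦ (B.θ l) Φ < δ l) →
        ((∀ r, 1 ≤ r → r ≤ s₁ q → B.IsAdapted F r) →
          ∀ r, 1 ≤ r → r ≤ s₁ q →
            (∀ p < r, CR.CohomologyVanishes S p (r - p)) →
            CR.CohomologyVanishes S' 0 r) ∧
        ((∀ r, 1 ≤ r → s₂ q ≤ r → r ≤ n - k → B.IsAdapted F r) →
          ∀ r, 1 ≤ r → s₂ q ≤ r → r ≤ n - k →
            (∀ p ≤ n - k - r, CR.CohomologyVanishes S (n - p) (r + p)) →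
            CR.CohomologyVanishes S' n r) := by
  obtain ⟨δ, hδ, H⟩ := corollary3p3_general (by omega) hμ F hB
  exact ⟨δ, hδ, fun Φ S' hS' hΦ =>
    ⟨fun ha r hr hrs hv => H Φ S' hS' hΦ 0 r hr (ha r hr hrs) (hv 0 hr),
      fun ha r hr hrs hrn hv =>
        H Φ S' hS' hΦ n r hr (ha r hr hrs hrn) (hv 0 (Nat.zero_le _))⟩⟩
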